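/- **Model.** Fix $K\ge 2$ and $0<\alpha_1\le\dots\le\alpha_K$. For network sizes $n\to\infty$, a set $V$ of $n$ nodes is partitioned into hidden clusters $V_1,\dots,V_K$ with $|V_k|=\alpha_k n$. The numbers $0\le q<p\le 1$ and the budget $T\in\mathbb N$ may depend on $n$. Unordered pairs of distinct nodes are observed $T$ times; the outcomes are independent given the sequence of observed pairs, and an observation is positive with probability $p$ if the two nodes are in the same cluster, and $q$ otherwise. Under URS-1 the observed pairs are independent and uniform. Under URS-2, with $T=m\,n(n-1)/2+r$ and $0\le r<n(n-1)/2$, every pair is first observed $m$ times, and then $r$ distinct pairs, chosen uniformly without replacement, are observed once more. Let $A_{vw}$ be the number of positive observations of $\{v,w\}$ (so $A_{vv}=0$) and $\Sigma=\sum_{(v,w)\in V\times V}A_{vw}$. **Spectral Partition (SP).** 1. *Trimming.* $\Gamma=\{v:\sum_w A_{vw}\le 5K\,\Sigma/n\}$ and $A_\Gamma=(A_{vw})_{v,w\in\Gamma}$. 2. *Spectral step.* - If $K=2$: let $x_1,x_2$ be orthonormal eigenvectors of $A_\Gamma$ for its largest and second largest eigenvalues. If $\big(\sum_v x_1(v)\big)\big(\sum_v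 x_2(v)\big)>0$, replace $x_2$ by $-x_2$. Let $\hat x=x_1+x_2-\frac1{|\Gamma|}J(x_1+x_2)$, where $J$ is the $\Gamma\times\Gamma$ all-ones matrix. Then $S_1\supseteq\{v\in\Gamma:\hat x(v)>0\}$ and $S_2\supseteq\{v\in\Gamma:\hat x(v)<0\}$, and all other nodes of $V$ are placed in $S_1$ or $S_2$ independently and uniformly at random. - If $K\ge3$: extend $A_\Gamma$ by zeros to a $V\times V$ matrix, and let $\hat A$, with columns $\hat A_v$, be obtained from a singular value decomposition of it by keeping the $K$ largest singular values. For each $i=1,\dots,\lfloor\log n\rfloor$ do the following. Let $Q_{i,v}=\{w\in V:\|\hat A_w-\hat A_v\|^2\le i\,\Sigma/(100n^2)\}$. For $k=1,\dots,K$ in turn, let $v_k^\star$ maximize $|Q_{i,v}\setminus\bigcup_{l<k}T_{i,l}|$ over $v$, let $T_{i,k}=Q_{i,v_k^\star}\setminus\bigcup_{l<k}T_{i,l}$, and let $\xi_{i,k}$ be the mean of $\hat A_v$ over $v\in T_{i,k}$. Then add each remaining node $v$ to a $T_{i,k}$ with $\|\hat A_v-\xi_{i,k}\|$ minimal (the $\xi_{i,k}$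 are not changed), and let $r_i=\sum_k\sum_{v\in T_{i,k}}\|\hat A_v-\xi_{i,k}\|^2$. Output $S_k=T_{i^\star,k}$, where $i^\star$ minimizes $r_i$. 3. *Improvement.* Put $S^{(0)}_k=S_k$. For $i=1,\dots,\lfloor\log n\rfloor$, put each node $v\in V$ in $S^{(i)}_{k^\star}$, where $k^\star$ maximizes $\sum_{w\in S_k^{(i-1)}}A_{vw}\,/\,|S_k^{(i-1)}|$, ties being broken independently and uniformly at random. Output $\hat V_k=S_k^{(\lfloor\log n\rfloor)}$. Let $\varepsilon^{SP}(n,T)$ be the proportion of misclassified nodes, $\min_{\sigma}\frac1n\big|\bigcup_k\hat V_{\sigma(k)}\setminus V_k\big|$ over the permutations $\sigma$ of $\{1,\dots,K\}$. **Theorem.** Assume that $\frac{(p-q)^2}{p}\frac{\alpha_1T}{n}=\omega(1)$, that $\frac{(p-q)^2}{20p}\frac{\alpha_1T}{n}\ge\log\big(p\frac Tn\big)$ for all large $n$, and that $\frac{(p-q)n}{p}=\omega(1)$ (this last condition follows from the first one whenever $pT=O(n^3)$). Then under URS-1 as well as under URS-2, whatever choice of eigenvectors, singular vectors and tied maximizers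 and minimizers is made in the spectral step, $$\lim_{n\to\infty}\mathbb P\left[\varepsilon^{SP}(n,T)\le\exp\left(-\frac{(p-q)^2}{20p}\,\frac{\alpha_1T}{n}\right)\right]=1 .$$ -/

import Mathlib

open Filter Topology
open scoped ENNReal

noncomputable section

namespace SpectralPartition

/-! ### Observations -/

/-- Unordered pairs of distinct nodes; there are `n (n - 1) / 2` of them. -/
abbrev NodePair (n : ℕ) : Type := {e : Sym2 (Fin n) // ¬ e.IsDiag}

open Classical in
/-- URS-1: the sequence of the `T` observed pairs is uniform among all sequences of pairs
(i.e. the observed pairs are independent and uniform). -/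
def urs1 (n T : ℕ) : Finset (Fin T → NodePair n) := Finset.univ

open Classical in
/-- URS-2, where `T = m * (n (n - 1) / 2) + r` with `r < n (n - 1) / 2`: the sequence of the
observed pairs is uniform among the sequences whose first `m * (n (n - 1) / 2)` terms contain each
pair exactly `m` times and whose last `r` terms are distinct. -/
def urs2 (n T : ℕ) : Finset (Fin T → NodePair n) :=
  let M := n * (n - 1) / 2
  let m := T / M
  Finset.univ.filter fun e => ∀ x : NodePair n,
    (Finset.univ.filter fun t : Fin T => (t : ℕ) < m * M ∧ e t = x).card = m ∧
    (Finset.univ.filter fun t : Fin T => m * M ≤ (t : ℕ) ∧ e t = x).card ≤ 1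

open Classical in
/-- The probability that an observation of the pair `e` is positive: `p` inside a cluster, `q`
across clusters, where `τ v` is the cluster of `v`. -/
def pairProb {n K : ℕ} (τ : Fin n → Fin K) (p q : unitInterval) (e : NodePair n) : unitInterval :=
  if (Sym2.map τ e.1).IsDiag then p else q

/-- The Bernoulli law on `Bool` with success probability `x`. -/
def bern (x : unitInterval) : PMF Bool :=
  PMF.ofFintype (fun b => if b then ENNReal.ofReal x else ENNReal.ofReal (1 - x)) (by
    have h0 : (0 : ℝ) ≤ x := x.2.1
    have h1 : (0 : ℝ) ≤ 1 - x := sub_nonneg.2 x.2.2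
    simp [← ENNReal.ofReal_add h0 h1])

/-- The law of independent Bernoulli variables with parameters `x t`. -/
def bernPi {ι : Type} [Fintype ι] [DecidableEq ι] (x : ι → unitInterval) : PMF (ι → Bool) :=
  PMF.ofFintype (fun X => ∏ t, bern (x t) (X t)) (by
    have h := Finset.prod_univ_sum (fun _ : ι => (Finset.univ : Finset Bool))
      (fun t b => bern (x t) b)
    rw [Fintype.piFinset_univ] at h
    rw [← h]
    refine Finset.prod_eq_one fun t _ => ?_
    have := (bern (x t)).tsum_coe
    rwa [tsum_fintype] at this)

open Classical in
/-- `A v w` is the number of positive observations of the pair `{v, w}`. -/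
def observationMatrix {n T : ℕ} (e : Fin T → NodePair n) (X : Fin T → Bool) :
    Matrix (Fin n) (Fin n) ℕ :=
  fun v w => (Finset.univ.filter fun t : Fin T => (e t).1 = s(v, w) ∧ X t = true).card

open Classical in
/-- The law of the observation matrix: the sequence `e` of observed pairs is uniform in `U`, and
given `e` the outcomes are independent, positive with probability `pairProb τ p q (e t)`. -/
def observationLaw {n K T : ℕ} (U : Finset (Fin T → NodePair n)) (τ : Fin n → Fin K)
    (p q : unitInterval) : PMF (Matrix (Fin n) (Fin n) ℕ) :=
  -- `U` is empty only in the degenerate case where there is no pair to observe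
  if hU : U.Nonempty then
    (PMF.uniformOfFinset U hU).bind fun e =>
      (bernPi fun t => pairProb τ p q (e t)).map fun X => observationMatrix e X
  else PMF.pure 0

/-! ### Trimming -/

/-- The sum of `A v w` over all ordered pairs `(v, w)`. -/
def total {n : ℕ} (A : Matrix (Fin n) (Fin n) ℕ) : ℝ := ∑ v, ∑ w, (A v w : ℝ)

open Classical in
/-- The set `Γ` of the nodes kept by the trimming. -/
def kept {n : ℕ} (K : ℕ) (A : Matrix (Fin n) (Fin n) ℕ) : Finset (Fin n) :=
  Finset.univ.filter fun v => ∑ w, (A v w : ℝ) ≤ 5 * K * (total A / n)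

/-! ### Spectral decomposition, two clusters -/

/-- The trimmed matrix `A_Γ`, indexed by `Γ`. -/
def trimmed {n : ℕ} (K : ℕ) (A : Matrix (Fin n) (Fin n) ℕ) :
    Matrix (kept K A) (kept K A) ℝ :=
  fun v w => (A v w : ℝ)

/-- `x₁`, `x₂` are orthonormal eigenvectors of `B` for its largest and its second largest
eigenvalue (counted with multiplicity): they belong to an orthonormal basis of eigenvectors. -/
def IsTopEigenpair {ι : Type} [Fintype ι] (B : Matrix ι ι ℝ) (x₁ x₂ : EuclideanSpace ℝ ι) : Prop :=
  ∃ (u : OrthonormalBasis ι ℝ (EuclideanSpace ℝ ι)) (μ : ι → ℝ) (a b : ι),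
    (∀ i, B.mulVec (u i).ofLp = μ i • (u i).ofLp) ∧
    a ≠ b ∧ μ b ≤ μ a ∧ (∀ c, c ≠ a → μ c ≤ μ b) ∧ x₁ = u a ∧ x₂ = u b

open Classical in
/-- The vector `x̂`: change the sign of `x₂` if the sums of the coordinates of `x₁` and of `x₂` have
a positive product, add `x₁`, and subtract the mean. -/
def centered {ι : Type} [Fintype ι] (x₁ x₂ : EuclideanSpace ℝ ι) : ι → ℝ :=
  let y : EuclideanSpace ℝ ι := if 0 < (∑ v, x₁ v) * (∑ v, x₂ v) then -x₂ else x₂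
  fun v => x₁ v + y v - (1 / (Fintype.card ι : ℝ)) * ∑ w, (x₁ w + y w)

open Classical in
/-- The clusters in which node `v` may be put according to `x`: the sign of `x v` decides; a node
outside `Γ`, or with `x v = 0`, may be put in either cluster. -/
def sides {n : ℕ} {Γ : Finset (Fin n)} (x : Γ → ℝ) (v : Fin n) : Finset (Fin 2) :=
  if h : v ∈ Γ then
    if 0 < x ⟨v, h⟩ then {0} else if x ⟨v, h⟩ < 0 then {1} else Finset.univ
  else Finset.univ

theorem sides_nonempty {n : ℕ} {Γ : Finset (Fin n)} (x : Γ → ℝ) (v : Fin n) :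
    (sides x v).Nonempty := by
  unfold sides
  split_ifs <;> simp

open Classical in
/-- The random partition obtained from the signs of `x`: undecided nodes are placed independently
and uniformly at random. -/
def signPartition {n : ℕ} {Γ : Finset (Fin n)} (x : Γ → ℝ) : PMF (Fin n → Fin 2) :=
  PMF.uniformOfFinset (Fintype.piFinset (sides x))
    (Fintype.piFinset_nonempty.2 (sides_nonempty x))

/-! ### Spectral decomposition, at least three clusters -/

open Classical in
/-- The trimmed matrix as an `n × n` matrix: rows and columns outside `Γ` are set to zero. -/
def trimmedPadded {n : ℕ} (K : ℕ) (A : Matrix (Fin n) (Fin n) ℕ) : Matrix (Fin n) (Fin n) ℝ :=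
  fun v w => if v ∈ kept K A ∧ w ∈ kept K A then (A v w : ℝ) else 0

open Classical in
/-- `Ahat` is obtained from a singular value decomposition of `B` by keeping the `K` largest
singular values. -/
def IsRankApprox {n : ℕ} (K : ℕ) (B Ahat : Matrix (Fin n) (Fin n) ℝ) : Prop :=
  ∃ (u w : OrthonormalBasis (Fin n) ℝ (EuclideanSpace ℝ (Fin n))) (s : Fin n → ℝ),
    Antitone s ∧ (∀ i, 0 ≤ s i) ∧
    (∀ a b, B a b = ∑ i, s i * u i a * w i b) ∧
    (∀ a b, Ahat a b = ∑ i ∈ Finset.univ.filter (fun i : Fin n => (i : ℕ) < K), s i * u i a * w i b)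

/-- The column of node `v`, with the Euclidean norm. -/
def column {n : ℕ} (Ahat : Matrix (Fin n) (Fin n) ℝ) (v : Fin n) : EuclideanSpace ℝ (Fin n) :=
  WithLp.toLp 2 fun w => Ahat w v

open Classical in
/-- The set `Q_v` of the nodes whose column is at squared distance at most `ρ` from that of `v`. -/
def nearby {n : ℕ} (Ahat : Matrix (Fin n) (Fin n) ℝ) (ρ : ℝ) (v : Fin n) : Finset (Fin n) :=
  Finset.univ.filter fun w => ‖column Ahat w - column Ahat v‖ ^ 2 ≤ ρ

open Classical in
/-- `Q_v` without the sets chosen before step `k`, when the centers `c l`, `l < k`, were used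
(the union of the sets chosen before is the union of the corresponding `Q`). -/
def newNearby {n K : ℕ} (Ahat : Matrix (Fin n) (Fin n) ℝ) (ρ : ℝ) (c : Fin K → Fin n) (k : Fin K)
    (v : Fin n) : Finset (Fin n) :=
  nearby Ahat ρ v \ (Finset.univ.filter fun l => l < k).biUnion fun l => nearby Ahat ρ (c l)

/-- The initial set `T_k`, before the remaining nodes are attached. -/
def core {n K : ℕ} (Ahat : Matrix (Fin n) (Fin n) ℝ) (ρ : ℝ) (c : Fin K → Fin n) (k : Fin K) :
    Finset (Fin n) :=
  newNearby Ahat ρ c k (c k)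

/-- The mean `ξ_k` of the columns of the nodes of `T_k`. -/
def coreMean {n K : ℕ} (Ahat : Matrix (Fin n) (Fin n) ℝ) (ρ : ℝ) (c : Fin K → Fin n) (k : Fin K) :
    EuclideanSpace ℝ (Fin n) :=
  ((core Ahat ρ c k).card : ℝ)⁻¹ • ∑ v ∈ core Ahat ρ c k, column Ahat v

/-- One pass of the greedy clustering with squared radius `ρ`: `c k` maximises the number of new
nearby nodes; the nodes of `T_k` get label `k`, and each remaining node gets the label of a nearest
mean. -/
structure IsGreedy {n K : ℕ} (Ahat : Matrix (Fin n) (Fin n) ℝ) (ρ : ℝ) (c : Fin K → Fin n)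
    (label : Fin n → Fin K) : Prop where
  center_max : ∀ k v, (newNearby Ahat ρ c k v).card ≤ (newNearby Ahat ρ c k (c k)).card
  label_core : ∀ k, ∀ v ∈ core Ahat ρ c k, label v = k
  label_rest : ∀ v, (∀ k, v ∉ core Ahat ρ c k) → ∀ k,
    ‖column Ahat v - coreMean Ahat ρ c (label v)‖ ≤ ‖column Ahat v - coreMean Ahat ρ c k‖

/-- The residual `r` of a pass. -/
def residual {n K : ℕ} (Ahat : Matrix (Fin n) (Fin n) ℝ) (ρ : ℝ) (c : Fin K → Fin n)
    (label : Fin n → Fin K) : ℝ :=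
  ∑ v, ‖column Ahat v - coreMean Ahat ρ c (label v)‖ ^ 2

/-- `out` is a possible output: passes `i = 1, …, ⌊log n⌋` with squared radius
`i * total A / (100 n²)` are made, and a pass with the smallest residual is kept. -/
def IsGreedyOutput {n : ℕ} (K : ℕ) (A : Matrix (Fin n) (Fin n) ℕ) (out : Fin n → Fin K) : Prop :=
  ∃ (Ahat : Matrix (Fin n) (Fin n) ℝ) (c : ℕ → Fin K → Fin n) (label : ℕ → Fin n → Fin K) (i₀ : ℕ),
    let ρ : ℕ → ℝ := fun i => i * (total A / (100 * (n : ℝ) ^ 2))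
    let I : Finset ℕ := Finset.Icc 1 ⌊Real.log n⌋₊
    IsRankApprox K (trimmedPadded K A) Ahat ∧
    (∀ i ∈ I, IsGreedy Ahat (ρ i) (c i) (label i)) ∧
    i₀ ∈ I ∧
    (∀ i ∈ I, residual Ahat (ρ i₀) (c i₀) (label i₀) ≤ residual Ahat (ρ i) (c i) (label i)) ∧
    out = label i₀

/-- `S` is a (law of a) possible output of the trimming and spectral decomposition steps on `A`,
for some choice of what the algorithm leaves open: the eigenvectors or singular vectors, and the
maximisers and minimisers in case of ties. Partitions are coded by labellings of the nodes. -/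
def IsSpectralStep {n : ℕ} : (K : ℕ) → Matrix (Fin n) (Fin n) ℕ → PMF (Fin n → Fin K) → Prop
  | 2, A, S => ∃ x₁ x₂, IsTopEigenpair (trimmed 2 A) x₁ x₂ ∧ S = signPartition (centered x₁ x₂)
  | K, A, S => ∃ out, IsGreedyOutput K A out ∧ S = PMF.pure out

/-! ### Improvement -/

open Classical in
/-- The number of positive observations between `v` and cluster `k`, divided by the size of the
cluster. -/
def score {n K : ℕ} (A : Matrix (Fin n) (Fin n) ℕ) (label : Fin n → Fin K) (v : Fin n) (k : Fin K) :
    ℝ :=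
  (∑ w ∈ Finset.univ.filter (fun w => label w = k), (A v w : ℝ)) /
    ((Finset.univ.filter fun w => label w = k).card : ℝ)

open Classical in
/-- The clusters with the largest score. -/
def best {n K : ℕ} (A : Matrix (Fin n) (Fin n) ℕ) (label : Fin n → Fin K) (v : Fin n) :
    Finset (Fin K) :=
  Finset.univ.filter fun k => ∀ l, score A label v l ≤ score A label v k

theorem best_nonempty {n K : ℕ} [NeZero K] (A : Matrix (Fin n) (Fin n) ℕ) (label : Fin n → Fin K)
    (v : Fin n) : (best A label v).Nonempty := by
  obtain ⟨k, -, hk⟩ :=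
    Finset.exists_max_image Finset.univ (score A label v) ⟨0, Finset.mem_univ _⟩
  exact ⟨k, by simpa [best] using hk⟩

open Classical in
/-- One round: every node moves to a cluster with the largest score with respect to the previous
partition, ties being broken independently and uniformly at random. -/
def improveRound {n K : ℕ} [NeZero K] (A : Matrix (Fin n) (Fin n) ℕ) (label : Fin n → Fin K) :
    PMF (Fin n → Fin K) :=
  PMF.uniformOfFinset (Fintype.piFinset (best A label))
    (Fintype.piFinset_nonempty.2 (best_nonempty A label))

/-- A number of rounds of improvement. -/
def improve {n K : ℕ} [NeZero K] (A : Matrix (Fin n) (Fin n) ℕ) :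
    ℕ → (Fin n → Fin K) → PMF (Fin n → Fin K)
  | 0, label => PMF.pure label
  | t + 1, label => (improveRound A label).bind (improve A t)

/-- The law of the output of Spectral Partition, on observations with sampling strategy `U` and with
`spectral` as trimming and spectral decomposition steps. -/
def outputLaw {n K T : ℕ} [NeZero K] (U : Finset (Fin T → NodePair n)) (τ : Fin n → Fin K)
    (p q : unitInterval) (spectral : Matrix (Fin n) (Fin n) ℕ → PMF (Fin n → Fin K)) :
    PMF (Fin n → Fin K) :=
  (observationLaw U τ p q).bind fun A => (spectral A).bind (improve A ⌊Real.log n⌋₊)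

open Classical in
/-- The proportion of misclassified nodes: clusters are matched by the best permutation of the
labels. -/
def misclassified {n K : ℕ} (τ label : Fin n → Fin K) : ℝ :=
  (Finset.univ.inf' Finset.univ_nonempty fun σ : Equiv.Perm (Fin K) =>
    (Finset.univ.filter fun v => label v ≠ σ (τ v)).card : ℕ) / (n : ℝ)

end SpectralPartition

end

noncomputable section

namespace SpectralPartition

/-! ### An averaging inequality over permutations -/

section Permutations

variable {X : Type} [Fintype X] [DecidableEq X]

/-- The sum over all permutations of the products of the values of `g` on the image of `R`. -/
def permSum (g : X → ℝ) (R : Finset X) : ℝ := ∑ π : Equiv.Perm X, ∏ x ∈ R, g (π x)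

theorem permSum_comp_swap (h : Equiv.Perm X → ℝ) (σ : Equiv.Perm X) :
    ∑ π : Equiv.Perm X, h (π * σ) = ∑ π, h π :=
  Fintype.sum_equiv (Equiv.mulRight σ) _ _ fun _ => rfl

theorem permSum_insert_le (g : X → ℝ) (hg : ∀ x, 0 ≤ g x) (R : Finset X) (y : X) (hy : y ∉ R) :
    Fintype.card X * permSum g (insert y R) ≤ (∑ x, g x) * permSum g R := by
  have key : ∀ z, permSum g (insert y R) ≤ ∑ π : Equiv.Perm X, g (π z) * ∏ x ∈ R, g (π x) := by
    intro z
    have hins : permSum g (insert y R) = ∑ π : Equiv.Perm X, g (π y) * ∏ x ∈ R, g (π x) := by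
      simp [permSum, Finset.prod_insert hy]
    by_cases hz : z ∈ R
    · have hR : R = insert z (R.erase z) := (Finset.insert_erase hz).symm
      have hzy : z ≠ y := fun h => hy (h ▸ hz)
      have hprod : ∀ π : Equiv.Perm X, ∏ x ∈ R, g (π x) = g (π z) * ∏ x ∈ R.erase z, g (π x) :=
        fun π => (Finset.mul_prod_erase R (fun x => g (π x)) hz).symm
      have hsw : ∑ π : Equiv.Perm X, g (π y) ^ 2 * ∏ x ∈ R.erase z, g (π x)
          = ∑ π : Equiv.Perm X, g (π z) ^ 2 * ∏ x ∈ R.erase z, g (π x) := by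
        rw [← permSum_comp_swap (fun π => g (π z) ^ 2 * ∏ x ∈ R.erase z, g (π x)) (Equiv.swap z y)]
        refine Finset.sum_congr rfl fun π _ => ?_
        simp only [Equiv.Perm.mul_apply, Equiv.swap_apply_left]
        congr 1
        refine Finset.prod_congr rfl fun x hx => ?_
        rw [Equiv.swap_apply_of_ne_of_ne (Finset.ne_of_mem_erase hx)
          (by rintro rfl; exact hy (Finset.mem_of_mem_erase hx))]
      rw [hins]
      have h2 : ∑ π : Equiv.Perm X, 2 * (g (π y) * ∏ x ∈ R, g (π x)) ≤
          ∑ π : Equiv.Perm X, (g (π y) ^ 2 * ∏ x ∈ R.erase z, g (π x) +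
            g (π z) ^ 2 * ∏ x ∈ R.erase z, g (π x)) := by
        refine Finset.sum_le_sum fun π _ => ?_
        rw [hprod π]
        have hQ : 0 ≤ ∏ x ∈ R.erase z, g (π x) := Finset.prod_nonneg fun x _ => hg _
        nlinarith [mul_nonneg hQ (sq_nonneg (g (π y) - g (π z)))]
      rw [Finset.sum_add_distrib, hsw, ← Finset.mul_sum] at h2
      have h3 : ∑ π : Equiv.Perm X, g (π z) * ∏ x ∈ R, g (π x) =
          ∑ π : Equiv.Perm X, g (π z) ^ 2 * ∏ x ∈ R.erase z, g (π x) :=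
        Finset.sum_congr rfl fun π _ => by rw [hprod π]; ring
      linarith
    · rw [hins, ← permSum_comp_swap (fun π => g (π z) * ∏ x ∈ R, g (π x)) (Equiv.swap z y)]
      refine le_of_eq (Finset.sum_congr rfl fun π _ => ?_)
      simp only [Equiv.Perm.mul_apply, Equiv.swap_apply_left]
      congr 1
      refine Finset.prod_congr rfl fun x hx => ?_
      rw [Equiv.swap_apply_of_ne_of_ne (by rintro rfl; exact hz hx) (by rintro rfl; exact hy hx)]
  have hsum := Finset.sum_le_sum fun z (_ : z ∈ (Finset.univ : Finset X)) => key z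
  rw [Finset.sum_const, nsmul_eq_mul, Finset.card_univ, Finset.sum_comm] at hsum
  refine hsum.trans (le_of_eq ?_)
  rw [permSum, Finset.mul_sum]
  refine Finset.sum_congr rfl fun π _ => ?_
  rw [← Finset.sum_mul, Equiv.sum_comp π g]

/-- Sampling without replacement is dominated by sampling with replacement. -/
theorem permSum_le [Nonempty X] (g : X → ℝ) (hg : ∀ x, 0 ≤ g x) (R : Finset X) :
    permSum g R ≤
      (Fintype.card (Equiv.Perm X) : ℝ) * ((∑ x, g x) / Fintype.card X) ^ R.card := by
  have hc : (0 : ℝ) < Fintype.card X := by exact_mod_cast Fintype.card_pos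
  induction R using Finset.induction_on with
  | empty => simp [permSum]
  | insert y R hy ih =>
    have h := permSum_insert_le g hg R y hy
    have hS : 0 ≤ ∑ x, g x := Finset.sum_nonneg fun x _ => hg x
    rw [Finset.card_insert_of_notMem hy, pow_succ]
    have h2 : permSum g (insert y R) ≤ (∑ x, g x) / Fintype.card X * permSum g R := by
      rw [div_mul_eq_mul_div, le_div_iff₀ hc]; linarith
    refine h2.trans ?_
    have := mul_le_mul_of_nonneg_left ih (div_nonneg hS hc.le)
    linarith

end Permutations

/-! ### Exponential moments of the two sampling strategies -/

open Classical in
theorem card_nodePair (n : ℕ) : Fintype.card (NodePair n) = n * (n - 1) / 2 := by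
  have h := Sym2.card_subtype_not_diag (α := Fin n)
  rw [Fintype.card_fin, Nat.choose_two_right] at h
  rw [← h]

theorem nodePair_nonempty {n : ℕ} (hn : 2 ≤ n) : Nonempty (NodePair n) :=
  ⟨⟨s(⟨0, by omega⟩, ⟨1, by omega⟩), by simp⟩⟩

theorem urs1_nonempty {n : ℕ} (hn : 2 ≤ n) (T : ℕ) : (urs1 n T).Nonempty := by
  have := nodePair_nonempty hn
  exact Finset.univ_nonempty

theorem card_filter_mod_eq (T M m i : ℕ) (hM : 0 < M) (hmT : m * M ≤ T) (hi : i < M) :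
    (Finset.univ.filter fun t : Fin T => (t : ℕ) < m * M ∧ (t : ℕ) % M = i).card = m := by
  conv_rhs => rw [← Finset.card_range m]
  symm
  refine Finset.card_bij (fun c hc => ⟨M * c + i, ?_⟩) ?_ ?_ ?_
  · have : c + 1 ≤ m := Finset.mem_range.1 hc
    nlinarith [Nat.mul_le_mul_left M this]
  · intro c hc
    have : c + 1 ≤ m := Finset.mem_range.1 hc
    simp only [Finset.mem_filter, Finset.mem_univ, true_and]
    refine ⟨by nlinarith [Nat.mul_le_mul_left M this], ?_⟩
    rw [Nat.mul_add_mod, Nat.mod_eq_of_lt hi]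
  · intro c _ d _ h
    have : M * c + i = M * d + i := by simpa using h
    exact Nat.eq_of_mul_eq_mul_left hM (by omega)
  · intro t ht
    simp only [Finset.mem_filter, Finset.mem_univ, true_and] at ht
    refine ⟨t / M, Finset.mem_range.2 ?_, ?_⟩
    · exact Nat.div_lt_of_lt_mul (by rw [mul_comm]; exact ht.1)
    · ext; simp only; rw [← ht.2]; exact Nat.div_add_mod _ _

theorem urs2_nonempty {n : ℕ} (hn : 2 ≤ n) (T : ℕ) : (urs2 n T).Nonempty := by
  classical
  have := nodePair_nonempty hn
  set M := n * (n - 1) / 2 with hMdef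
  have hcard : Fintype.card (NodePair n) = M := card_nodePair n
  have hM : 0 < M := hcard ▸ Fintype.card_pos
  let φ : NodePair n ≃ Fin M := Fintype.equivFinOfCardEq hcard
  have hdm := Nat.div_add_mod T M
  have hlt := Nat.mod_lt T hM
  have hmul := Nat.div_mul_le_self T M
  have heq : ∀ (t : ℕ) (x : NodePair n), φ.symm ⟨t % M, Nat.mod_lt _ hM⟩ = x ↔ t % M = φ x := by
    intro t x
    rw [Equiv.symm_apply_eq, Fin.ext_iff]
  refine ⟨fun t => φ.symm ⟨t % M, Nat.mod_lt _ hM⟩, ?_⟩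
  simp only [urs2, Finset.mem_filter, Finset.mem_univ, true_and, ← hMdef, heq]
  intro x
  refine ⟨card_filter_mod_eq T M (T / M) (φ x) hM hmul (φ x).2, Finset.card_le_one.2 ?_⟩
  intro s hs t ht
  simp only [Finset.mem_filter, Finset.mem_univ, true_and] at hs ht
  have h1 := Nat.div_add_mod s M
  have h2 := Nat.div_add_mod t M
  have hdiv : ∀ u : Fin T, T / M * M ≤ (u : ℕ) → (u : ℕ) / M = T / M := fun u hu =>
    le_antisymm (Nat.div_le_div_right u.2.le) ((Nat.le_div_iff_mul_le hM).2 hu)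
  rw [hs.2, hdiv s hs.1] at h1
  rw [ht.2, hdiv t ht.1] at h2
  exact Fin.ext (h1.symm.trans h2)

open Classical in
theorem urs1_sum_prod_le {n : ℕ} (T : ℕ) (g : NodePair n → ℝ) (hn : 2 ≤ n) :
    ∑ e ∈ urs1 n T, ∏ t, g (e t) ≤
      ((urs1 n T).card : ℝ) * ((∑ x, g x) / Fintype.card (NodePair n)) ^ T := by
  have := nodePair_nonempty hn
  have hc : (0 : ℝ) < Fintype.card (NodePair n) := by exact_mod_cast Fintype.card_pos
  have h := Finset.prod_univ_sum (fun _ : Fin T => (Finset.univ : Finset (NodePair n)))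
    (fun _ b => g b)
  rw [Fintype.piFinset_univ] at h
  rw [urs1, ← h, Finset.card_univ, Fintype.card_fun, Fintype.card_fin]
  simp only [Finset.prod_const, Finset.card_univ, Fintype.card_fin]
  rw [div_pow, Nat.cast_pow, mul_div_cancel₀ _ (pow_ne_zero _ hc.ne')]

open Classical in
theorem urs2_comp_perm {n T : ℕ} (π : Equiv.Perm (NodePair n)) {e : Fin T → NodePair n}
    (he : e ∈ urs2 n T) : (fun t => π (e t)) ∈ urs2 n T := by
  simp only [urs2, Finset.mem_filter, Finset.mem_univ, true_and] at he ⊢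
  intro x
  have := he (π.symm x)
  simpa [Equiv.eq_symm_apply] using this

open Classical in
theorem urs2_perm_sum_le {n T : ℕ} (hn : 2 ≤ n) (g : NodePair n → ℝ) (hg : ∀ x, 0 ≤ g x)
    {e : Fin T → NodePair n} (he : e ∈ urs2 n T) :
    ∑ π : Equiv.Perm (NodePair n), ∏ t, g (π (e t)) ≤
      (Fintype.card (Equiv.Perm (NodePair n)) : ℝ) *
        ((∑ x, g x) / Fintype.card (NodePair n)) ^ T := by
  have := nodePair_nonempty hn
  set M := n * (n - 1) / 2 with hMdef
  have hcard : Fintype.card (NodePair n) = M := card_nodePair n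
  have hmul := Nat.div_mul_le_self T M
  simp only [urs2, Finset.mem_filter, Finset.mem_univ, true_and, ← hMdef] at he
  set m := T / M
  let c : NodePair n → ℕ := fun x =>
    (Finset.univ.filter fun t : Fin T => m * M ≤ (t : ℕ) ∧ e t = x).card
  let R : Finset (NodePair n) := Finset.univ.filter fun x => c x = 1
  have hfib : ∀ x, (Finset.univ.filter fun t : Fin T => e t = x).card = m + c x := by
    intro x
    rw [← (he x).1]
    rw [← Finset.card_filter_add_card_filter_not (s := Finset.univ.filter fun t : Fin T => e t = x)
      (p := fun t : Fin T => (t : ℕ) < m * M)]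
    congr 1
    · congr 1; ext t; simp [and_comm]
    · simp only [c]; congr 1; ext t; simp [and_comm]
  have hcle : ∀ x, c x = if x ∈ R then 1 else 0 := by
    intro x
    have := (he x).2
    simp only [R, Finset.mem_filter, Finset.mem_univ, true_and]
    change c x ≤ 1 at this
    split_ifs with h
    · exact h
    · omega
  have hprod : ∀ π : Equiv.Perm (NodePair n),
      ∏ t, g (π (e t)) = (∏ x, g x) ^ m * ∏ x ∈ R, g (π x) := by
    intro π
    rw [← Finset.prod_fiberwise Finset.univ e (fun t => g (π (e t)))]
    have : ∀ x, ∏ t ∈ Finset.univ.filter (fun t => e t = x), g (π (e t)) = g (π x) ^ (m + c x) := by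
      intro x
      rw [← hfib x]
      refine Finset.prod_eq_pow_card fun t ht => ?_
      rw [(Finset.mem_filter.1 ht).2]
    rw [Finset.prod_congr rfl fun x _ => this x]
    simp only [pow_add, Finset.prod_mul_distrib, Finset.prod_pow]
    rw [Equiv.prod_comp π g]
    congr 1
    simp only [hcle]
    simp only [pow_ite, pow_one, pow_zero, Finset.prod_ite_mem, Finset.univ_inter]
  have hT : T = M * m + R.card := by
    have h1 : ∑ x, (m + c x) = T := by
      simp only [← hfib]
      rw [← Finset.card_eq_sum_card_fiberwise (fun t _ => Finset.mem_univ (e t))]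
      simp
    rw [Finset.sum_add_distrib, Finset.sum_const, Finset.card_univ, hcard] at h1
    simp only [hcle] at h1
    rw [Finset.sum_ite_mem, Finset.univ_inter] at h1
    simp only [Finset.sum_const, smul_eq_mul, mul_one] at h1
    exact h1.symm
  set avg := (∑ x, g x) / Fintype.card (NodePair n) with havg
  have havg0 : 0 ≤ avg := div_nonneg (Finset.sum_nonneg fun x _ => hg x) (Nat.cast_nonneg _)
  have hall : ∏ x, g x ≤ avg ^ M := by
    have h := permSum_le g hg Finset.univ
    have hp : (0 : ℝ) < Fintype.card (Equiv.Perm (NodePair n)) := by exact_mod_cast Fintype.card_pos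
    rw [permSum, Finset.sum_congr rfl fun π _ => Equiv.prod_comp π g, Finset.sum_const,
      nsmul_eq_mul, Finset.card_univ, Finset.card_univ, hcard] at h
    have := le_of_mul_le_mul_left h hp
    rwa [havg, hcard]
  rw [Finset.sum_congr rfl fun π _ => hprod π, ← Finset.mul_sum]
  have h1 : (∏ x, g x) ^ m ≤ avg ^ (M * m) := by
    rw [pow_mul]
    exact pow_le_pow_left₀ (Finset.prod_nonneg fun x _ => hg x) hall m
  have h2 := permSum_le g hg R
  rw [permSum] at h2
  refine (mul_le_mul h1 h2 (Finset.sum_nonneg fun π _ => Finset.prod_nonneg fun x _ => hg _)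
    (pow_nonneg havg0 _)).trans (le_of_eq ?_)
  rw [← havg]
  conv_rhs => rw [hT, pow_add]
  ring

open Classical in
theorem urs2_sum_prod_le {n : ℕ} (T : ℕ) (g : NodePair n → ℝ) (hn : 2 ≤ n) (hg : ∀ x, 0 ≤ g x) :
    ∑ e ∈ urs2 n T, ∏ t, g (e t) ≤
      ((urs2 n T).card : ℝ) * ((∑ x, g x) / Fintype.card (NodePair n)) ^ T := by
  have hp : (0 : ℝ) < Fintype.card (Equiv.Perm (NodePair n)) := by exact_mod_cast Fintype.card_pos
  have hinv : ∀ π : Equiv.Perm (NodePair n),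
      ∑ e ∈ urs2 n T, ∏ t, g (π (e t)) = ∑ e ∈ urs2 n T, ∏ t, g (e t) := by
    intro π
    refine Finset.sum_nbij' (fun e t => π (e t)) (fun e t => π⁻¹ (e t)) ?_ ?_ ?_ ?_ ?_
    · exact fun e he => urs2_comp_perm π he
    · exact fun e he => urs2_comp_perm π⁻¹ he
    · intro e _; simp
    · intro e _; simp
    · intro e _; rfl
  have h : (Fintype.card (Equiv.Perm (NodePair n)) : ℝ) * ∑ e ∈ urs2 n T, ∏ t, g (e t) =
      ∑ e ∈ urs2 n T, ∑ π : Equiv.Perm (NodePair n), ∏ t, g (π (e t)) := by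
    rw [Finset.sum_comm, Finset.sum_congr rfl fun π _ => hinv π, Finset.sum_const, nsmul_eq_mul,
      Finset.card_univ]
  refine le_of_mul_le_mul_left ?_ hp
  rw [h]
  refine (Finset.sum_le_sum fun e he => urs2_perm_sum_le hn g hg he).trans (le_of_eq ?_)
  rw [Finset.sum_const, nsmul_eq_mul]
  ring

/-! ### Expectations -/

/-- The expectation of a nonnegative function. -/
def mean {Ω : Type*} (P : PMF Ω) (f : Ω → ℝ≥0∞) : ℝ≥0∞ := ∑' x, P x * f x

theorem mean_bind {Ω Ω' : Type*} (P : PMF Ω) (Q : Ω → PMF Ω') (f : Ω' → ℝ≥0∞) :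
    mean (P.bind Q) f = mean P fun x => mean (Q x) f := by
  simp only [mean, PMF.bind_apply, ← ENNReal.tsum_mul_right, ← ENNReal.tsum_mul_left]
  rw [ENNReal.tsum_comm]
  simp only [mul_assoc]

theorem mean_pure {Ω : Type*} (x : Ω) (f : Ω → ℝ≥0∞) : mean (PMF.pure x) f = f x := by
  classical
  rw [mean, tsum_eq_single x]
  · simp
  · intro y hy; simp [PMF.pure_apply, hy]

theorem mean_map {Ω Ω' : Type*} (P : PMF Ω) (g : Ω → Ω') (f : Ω' → ℝ≥0∞) :
    mean (P.map g) f = mean P fun x => f (g x) := by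
  rw [← PMF.bind_pure_comp, mean_bind]
  simp [mean_pure]

theorem mean_uniformOfFinset {Ω : Type*} (s : Finset Ω) (hs : s.Nonempty) (f : Ω → ℝ≥0∞) :
    mean (PMF.uniformOfFinset s hs) f = (s.card : ℝ≥0∞)⁻¹ * ∑ x ∈ s, f x := by
  rw [mean, tsum_eq_sum (s := s), Finset.mul_sum]
  · exact Finset.sum_congr rfl fun x hx => by rw [PMF.uniformOfFinset_apply_of_mem hs hx]
  · intro x hx; rw [PMF.uniformOfFinset_apply_of_notMem hs hx, zero_mul]

theorem toOuterMeasure_le_mean {Ω : Type*} (P : PMF Ω) {s : Set Ω} {f : Ω → ℝ≥0∞}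
    (h : ∀ x ∈ s, 1 ≤ f x) : P.toOuterMeasure s ≤ mean P f := by
  rw [PMF.toOuterMeasure_apply, mean]
  refine ENNReal.tsum_le_tsum fun x => ?_
  by_cases hx : x ∈ s
  · rw [Set.indicator_of_mem hx]
    exact le_mul_of_one_le_right' (h x hx)
  · rw [Set.indicator_of_notMem hx]; exact zero_le

theorem mean_mul_const {Ω : Type*} (P : PMF Ω) (f : Ω → ℝ≥0∞) (c : ℝ≥0∞) :
    mean P (fun x => f x * c) = mean P f * c := by
  simp only [mean, ← mul_assoc, ENNReal.tsum_mul_right]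

theorem mean_bernPi {ι : Type} [Fintype ι] [DecidableEq ι] (x : ι → unitInterval)
    (g : ι → Bool → ℝ≥0∞) :
    mean (bernPi x) (fun X => ∏ t, g t (X t)) =
      ∏ t, (bern (x t) true * g t true + bern (x t) false * g t false) := by
  have h := Finset.prod_univ_sum (fun _ : ι => (Finset.univ : Finset Bool))
    (fun t b => bern (x t) b * g t b)
  rw [Fintype.piFinset_univ] at h
  simp only [Fintype.sum_bool] at h
  rw [h, mean, tsum_fintype]
  refine Finset.sum_congr rfl fun X _ => ?_
  rw [Finset.prod_mul_distrib]
  rfl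

/-! ### Sums over pairs -/

/-- The sum over the pairs `v < w`. -/
def upperSum {n : ℕ} (F : Fin n → Fin n → ℝ) : ℝ := ∑ v, ∑ w, if v < w then F v w else 0

theorem upperSum_congr {n : ℕ} {F G : Fin n → Fin n → ℝ} (h : ∀ v w, v < w → F v w = G v w) :
    upperSum F = upperSum G := by
  refine Finset.sum_congr rfl fun v _ => Finset.sum_congr rfl fun w _ => ?_
  split_ifs with hvw
  · exact h v w hvw
  · rfl

theorem upperSum_mono {n : ℕ} {F G : Fin n → Fin n → ℝ} (h : ∀ v w, v < w → F v w ≤ G v w) :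
    upperSum F ≤ upperSum G := by
  refine Finset.sum_le_sum fun v _ => Finset.sum_le_sum fun w _ => ?_
  split_ifs with hvw
  · exact h v w hvw
  · rfl

theorem upperSum_add {n : ℕ} (F G : Fin n → Fin n → ℝ) :
    upperSum (fun v w => F v w + G v w) = upperSum F + upperSum G := by
  simp only [upperSum, ← Finset.sum_add_distrib]
  refine Finset.sum_congr rfl fun v _ => Finset.sum_congr rfl fun w _ => ?_
  split_ifs <;> simp

theorem upperSum_const_mul {n : ℕ} (c : ℝ) (F : Fin n → Fin n → ℝ) :
    upperSum (fun v w => c * F v w) = c * upperSum F := by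
  simp only [upperSum, Finset.mul_sum, mul_ite, mul_zero]

theorem upperSum_sub {n : ℕ} (F G : Fin n → Fin n → ℝ) :
    upperSum (fun v w => F v w - G v w) = upperSum F - upperSum G := by
  simp only [upperSum, ← Finset.sum_sub_distrib]
  refine Finset.sum_congr rfl fun v _ => Finset.sum_congr rfl fun w _ => ?_
  split_ifs <;> simp

theorem upperSum_nonneg {n : ℕ} {F : Fin n → Fin n → ℝ} (h : ∀ v w, v < w → 0 ≤ F v w) :
    0 ≤ upperSum F := by
  refine Finset.sum_nonneg fun v _ => Finset.sum_nonneg fun w _ => ?_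
  split_ifs with hvw
  · exact h v w hvw
  · rfl

theorem upperSum_le_sum {n : ℕ} {F : Fin n → Fin n → ℝ} (h : ∀ v w, 0 ≤ F v w) :
    upperSum F ≤ ∑ v, ∑ w, F v w := by
  refine Finset.sum_le_sum fun v _ => Finset.sum_le_sum fun w _ => ?_
  split_ifs with hvw
  · rfl
  · exact h v w

theorem NodePair.exists_lt {n : ℕ} (e : NodePair n) : ∃ v w, v < w ∧ e.1 = s(v, w) := by
  obtain ⟨e, he⟩ := e
  induction e using Sym2.ind with
  | _ v w =>
    have hvw : v ≠ w := by simpa using he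
    rcases lt_or_gt_of_ne hvw with h | h
    · exact ⟨v, w, h, rfl⟩
    · exact ⟨w, v, h, Sym2.eq_swap⟩

open Classical in
/-- The value at a pair of a function of the two nodes in increasing order. -/
def pairValue {n : ℕ} (F : Fin n → Fin n → ℝ) (e : NodePair n) : ℝ :=
  ∑ v, ∑ w, if v < w ∧ e.1 = s(v, w) then F v w else 0

theorem pairValue_mk {n : ℕ} (F : Fin n → Fin n → ℝ) (e : NodePair n) {v w : Fin n} (h : v < w)
    (he : e.1 = s(v, w)) : pairValue F e = F v w := by
  classical
  have huniq : ∀ v' w', v' < w' → e.1 = s(v', w') → v' = v ∧ w' = w := by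
    intro v' w' h' he'
    rw [he', Sym2.eq_iff] at he
    rcases he with he | ⟨rfl, rfl⟩
    · exact he
    · exact absurd h (not_lt_of_gt h')
  rw [pairValue, Finset.sum_eq_single v, Finset.sum_eq_single w]
  · rw [if_pos ⟨h, he⟩]
  · intro w' _ hw'
    exact if_neg fun hh => hw' (huniq _ _ hh.1 hh.2).2
  · simp
  · intro v' _ hv'
    exact Finset.sum_eq_zero fun w' _ => if_neg fun hh => hv' (huniq _ _ hh.1 hh.2).1
  · simp

theorem sum_pairValue {n : ℕ} (F : Fin n → Fin n → ℝ) : ∑ e, pairValue F e = upperSum F := by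
  classical
  simp only [pairValue, upperSum]
  rw [Finset.sum_comm]
  refine Finset.sum_congr rfl fun v _ => ?_
  rw [Finset.sum_comm]
  refine Finset.sum_congr rfl fun w _ => ?_
  by_cases h : v < w
  · have hd : ¬ (s(v, w) : Sym2 (Fin n)).IsDiag := by simpa using h.ne
    rw [Finset.sum_eq_single (⟨s(v, w), hd⟩ : NodePair n)]
    · simp [h]
    · intro e _ he
      exact if_neg fun hh => he (Subtype.ext hh.2)
    · simp
  · simp [h]

theorem upperSum_mul_observationMatrix {n T : ℕ} (F : Fin n → Fin n → ℝ) (e : Fin T → NodePair n)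
    (X : Fin T → Bool) :
    upperSum (fun v w => F v w * observationMatrix e X v w) =
      ∑ t, if X t = true then pairValue F (e t) else 0 := by
  classical
  have h : ∀ v w, (if v < w then F v w * (observationMatrix e X v w : ℝ) else 0) =
      ∑ t, if X t = true then (if v < w ∧ (e t).1 = s(v, w) then F v w else 0) else 0 := by
    intro v w
    by_cases hvw : v < w
    · rw [if_pos hvw, observationMatrix, Finset.card_filter]
      push_cast
      rw [Finset.mul_sum]
      refine Finset.sum_congr rfl fun t _ => ?_
      by_cases h1 : (e t).1 = s(v, w) <;> by_cases h2 : X t = true <;> simp [h1, h2, hvw]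
    · simp [hvw]
  simp only [upperSum, h, pairValue]
  rw [Finset.sum_comm' (t' := Finset.univ) (s' := fun _ => Finset.univ) (by simp)]
  rw [Finset.sum_congr rfl fun w _ => Finset.sum_comm, Finset.sum_comm]
  refine Finset.sum_congr rfl fun t _ => ?_
  split_ifs with hX
  · rw [Finset.sum_comm]
  · simp

/-! ### The exponential moments of the observation matrix -/

/-- The exponential moments of the entries `A v w`, `v < w`, are at most those of independent
Poisson variables with means `R v w`. -/
def SubPoisson {n : ℕ} (P : PMF (Matrix (Fin n) (Fin n) ℕ)) (R : Fin n → Fin n → ℝ) : Prop :=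
  ∀ F : Fin n → Fin n → ℝ,
    mean P (fun A => ENNReal.ofReal (Real.exp (upperSum fun v w => F v w * A v w))) ≤
      ENNReal.ofReal (Real.exp (upperSum fun v w => R v w * (Real.exp (F v w) - 1)))

theorem SubPoisson.chernoff {n : ℕ} {P : PMF (Matrix (Fin n) (Fin n) ℕ)} {R : Fin n → Fin n → ℝ}
    (hP : SubPoisson P R) (F : Fin n → Fin n → ℝ) (c : ℝ) :
    P.toOuterMeasure {A | c ≤ upperSum fun v w => F v w * A v w} ≤
      ENNReal.ofReal (Real.exp ((upperSum fun v w => R v w * (Real.exp (F v w) - 1)) - c)) := by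
  refine (toOuterMeasure_le_mean P (f := fun A =>
    ENNReal.ofReal (Real.exp (upperSum fun v w => F v w * A v w)) *
      ENNReal.ofReal (Real.exp (-c))) ?_).trans ?_
  · intro A hA
    rw [← ENNReal.ofReal_mul (Real.exp_pos _).le, ← Real.exp_add]
    rw [ENNReal.one_le_ofReal, Real.one_le_exp_iff]
    have : c ≤ _ := hA
    linarith
  · rw [mean_mul_const, sub_eq_add_neg, Real.exp_add, ENNReal.ofReal_mul (Real.exp_pos _).le]
    gcongr
    exact hP F

open Classical in
/-- The mean number of positive observations of the pair `{v, w}` when each pair is observed `c`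
times on average. -/
def rate {n K : ℕ} (τ : Fin n → Fin K) (a b : ℝ) (v w : Fin n) : ℝ :=
  if τ v = τ w then a else b

theorem subPoisson_of_sum_prod_le {n K T : ℕ} (hn : 2 ≤ n) (U : Finset (Fin T → NodePair n))
    (hU : U.Nonempty) (τ : Fin n → Fin K) (p q : unitInterval)
    (hle : ∀ g : NodePair n → ℝ, (∀ x, 0 ≤ g x) → ∑ e ∈ U, ∏ t, g (e t) ≤
      (U.card : ℝ) * ((∑ x, g x) / (n * (n - 1) / 2 : ℝ)) ^ T) :
    SubPoisson (observationLaw U τ p q)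
      (rate τ (T / (n * (n - 1) / 2 : ℝ) * p) (T / (n * (n - 1) / 2 : ℝ) * q)) := by
  classical
  intro F
  set x : NodePair n → ℝ := fun e => pairProb τ p q e with hx
  have hx0 : ∀ e, 0 ≤ x e := fun e => (pairProb τ p q e).2.1
  have hx1 : ∀ e, x e ≤ 1 := fun e => (pairProb τ p q e).2.2
  set g : NodePair n → ℝ := fun e => x e * Real.exp (pairValue F e) + (1 - x e) with hg
  have hg0 : ∀ e, 0 ≤ g e := fun e =>
    add_nonneg (mul_nonneg (hx0 e) (Real.exp_pos _).le) (sub_nonneg.2 (hx1 e))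
  set M : ℝ := n * (n - 1) / 2 with hM
  have hn' : (2 : ℝ) ≤ n := by exact_mod_cast hn
  have hMpos : 0 < M := by rw [hM]; nlinarith
  have hcard : (Fintype.card (NodePair n) : ℝ) = M := by
    have h := Sym2.card_subtype_not_diag (α := Fin n)
    rw [Fintype.card_fin] at h
    rw [h, Nat.cast_choose_two]
  have hinner : ∀ e : Fin T → NodePair n,
      mean ((bernPi fun t => pairProb τ p q (e t)).map fun X => observationMatrix e X)
        (fun A => ENNReal.ofReal (Real.exp (upperSum fun v w => F v w * A v w))) =
      ENNReal.ofReal (∏ t, g (e t)) := by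
    intro e
    rw [mean_map]
    have h1 : ∀ X : Fin T → Bool, ENNReal.ofReal (Real.exp (upperSum fun v w =>
        F v w * observationMatrix e X v w)) =
        ∏ t, ENNReal.ofReal (Real.exp (if X t = true then pairValue F (e t) else 0)) := by
      intro X
      rw [upperSum_mul_observationMatrix, Real.exp_sum,
        ENNReal.ofReal_prod_of_nonneg fun t _ => (Real.exp_pos _).le]
    simp only [h1]
    rw [mean_bernPi (fun t => pairProb τ p q (e t))
      (fun t b => ENNReal.ofReal (Real.exp (if b = true then pairValue F (e t) else 0)))]
    rw [ENNReal.ofReal_prod_of_nonneg fun t _ => hg0 _]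
    refine Finset.prod_congr rfl fun t _ => ?_
    have ht0 := hx0 (e t)
    have ht1 := sub_nonneg.2 (hx1 (e t))
    simp only [bern, PMF.ofFintype_apply, if_true, Bool.false_eq_true, if_false, Real.exp_zero,
      ENNReal.ofReal_one, mul_one]
    rw [← ENNReal.ofReal_mul ht0, ← ENNReal.ofReal_add (mul_nonneg ht0 (Real.exp_pos _).le) ht1]
  rw [observationLaw, dif_pos hU, mean_bind]
  simp only [hinner]
  rw [mean_uniformOfFinset, ← ENNReal.ofReal_sum_of_nonneg
    fun e _ => Finset.prod_nonneg fun t _ => hg0 _]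
  have hUc : (0 : ℝ) < U.card := by exact_mod_cast hU.card_pos
  rw [← ENNReal.ofReal_natCast, ← ENNReal.ofReal_inv_of_pos hUc,
    ← ENNReal.ofReal_mul (inv_nonneg.2 hUc.le)]
  refine ENNReal.ofReal_le_ofReal ?_
  rw [inv_mul_le_iff₀ hUc]
  refine (hle g hg0).trans (mul_le_mul_of_nonneg_left ?_ hUc.le)
  set Y : ℝ := ∑ e, x e * (Real.exp (pairValue F e) - 1) with hY
  have hsum : ∑ e, g e = M + Y := by
    rw [← hcard, hY, ← Finset.card_univ, Finset.card_eq_sum_ones]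
    push_cast
    rw [← Finset.sum_add_distrib]
    refine Finset.sum_congr rfl fun e _ => ?_
    simp only [hg]; ring
  have hYeq : T / M * Y = upperSum fun v w =>
      rate τ (T / M * p) (T / M * q) v w * (Real.exp (F v w) - 1) := by
    rw [← sum_pairValue, hY, Finset.mul_sum]
    refine Finset.sum_congr rfl fun e _ => ?_
    obtain ⟨v, w, hvw, he⟩ := e.exists_lt
    rw [pairValue_mk _ e hvw he, pairValue_mk _ e hvw he, ← mul_assoc]
    congr 1
    simp only [hx, pairProb, rate, he, Sym2.map_mk, Sym2.mk_isDiag_iff]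
    split_ifs <;> rfl
  rw [← hYeq]
  have hnn : 0 ≤ (∑ e, g e) / M := div_nonneg (Finset.sum_nonneg fun e _ => hg0 e) hMpos.le
  have h1 : (∑ e, g e) / M ≤ Real.exp (Y / M) := by
    rw [hsum, add_div, div_self hMpos.ne']
    linarith [Real.add_one_le_exp (Y / M)]
  refine (pow_le_pow_left₀ hnn h1 T).trans (le_of_eq ?_)
  rw [← Real.exp_nat_mul]
  congr 1
  ring

theorem subPoisson_urs1 {n K T : ℕ} (hn : 2 ≤ n) (τ : Fin n → Fin K) (p q : unitInterval) :
    SubPoisson (observationLaw (urs1 n T) τ p q)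
      (rate τ (T / (n * (n - 1) / 2 : ℝ) * p) (T / (n * (n - 1) / 2 : ℝ) * q)) := by
  refine subPoisson_of_sum_prod_le hn _ (urs1_nonempty hn T) τ p q fun g _ => ?_
  have h := urs1_sum_prod_le T g hn
  have hc := Sym2.card_subtype_not_diag (α := Fin n)
  rw [Fintype.card_fin] at hc
  rwa [hc, Nat.cast_choose_two] at h

theorem subPoisson_urs2 {n K T : ℕ} (hn : 2 ≤ n) (τ : Fin n → Fin K) (p q : unitInterval) :
    SubPoisson (observationLaw (urs2 n T) τ p q)
      (rate τ (T / (n * (n - 1) / 2 : ℝ) * p) (T / (n * (n - 1) / 2 : ℝ) * q)) := by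
  refine subPoisson_of_sum_prod_le hn _ (urs2_nonempty hn T) τ p q fun g hg => ?_
  have h := urs2_sum_prod_le T g hn hg
  have hc := Sym2.card_subtype_not_diag (α := Fin n)
  rw [Fintype.card_fin] at hc
  rwa [hc, Nat.cast_choose_two] at h

/-- Almost surely the observation matrix is symmetric with a zero diagonal. -/
theorem observationLaw_support {n K T : ℕ} (U : Finset (Fin T → NodePair n)) (τ : Fin n → Fin K)
    (p q : unitInterval) {A : Matrix (Fin n) (Fin n) ℕ} (hA : observationLaw U τ p q A ≠ 0) :
    A.IsSymm ∧ ∀ v, A v v = 0 := by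
  classical
  rw [← PMF.mem_support_iff] at hA
  unfold observationLaw at hA
  split_ifs at hA with hU
  · rw [PMF.mem_support_bind_iff] at hA
    obtain ⟨e, _, hA⟩ := hA
    rw [PMF.mem_support_map_iff] at hA
    obtain ⟨X, _, rfl⟩ := hA
    constructor
    · ext v w
      simp only [Matrix.transpose_apply, observationMatrix, Sym2.eq_swap (a := w) (b := v)]
    · intro v
      rw [observationMatrix, Finset.card_eq_zero, Finset.filter_eq_empty_iff]
      intro t _ ht
      exact (e t).2 (by rw [ht.1]; simp)
  · rw [PMF.mem_support_pure_iff] at hA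
    subst hA
    exact ⟨by ext; rfl, fun v => rfl⟩

theorem rate_nonneg {n K : ℕ} (τ : Fin n → Fin K) {a b : ℝ} (hb : 0 ≤ b) (hab : b ≤ a)
    (v w : Fin n) : 0 ≤ rate τ a b v w := by
  unfold rate; split_ifs <;> linarith

theorem rate_le {n K : ℕ} (τ : Fin n → Fin K) {a b : ℝ} (hab : b ≤ a) (v w : Fin n) :
    rate τ a b v w ≤ a := by
  unfold rate; split_ifs <;> linarith

theorem rate_symm {n K : ℕ} (τ : Fin n → Fin K) (a b : ℝ) (v w : Fin n) :
    rate τ a b v w = rate τ a b w v := by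
  unfold rate; simp only [eq_comm]

/-! ### Numbers of positive observations between sets of nodes -/

/-- An upper bound for the logarithm of the number of sets of `s` nodes. -/
def setEntropy (n s : ℕ) : ℝ := s * (1 + Real.log (n / s))

theorem log_le_setEntropy {n s : ℕ} (hs : 0 < s) (hsn : s ≤ n) : Real.log n ≤ setEntropy n s := by
  have hs' : (1 : ℝ) ≤ s := by exact_mod_cast hs
  have hn' : (s : ℝ) ≤ n := by exact_mod_cast hsn
  have h1 : Real.log n = Real.log (n / s) + Real.log s := by
    rw [Real.log_div (by linarith) (by linarith), sub_add_cancel]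
  have h2 : 0 ≤ Real.log (n / s) := Real.log_nonneg (by rw [le_div_iff₀ (by linarith)]; linarith)
  have h3 := Real.log_le_sub_one_of_pos (show (0 : ℝ) < s by linarith)
  rw [setEntropy]
  nlinarith

theorem choose_le_exp_setEntropy {n s : ℕ} (hs : 0 < s) (hsn : s ≤ n) :
    (n.choose s : ℝ) ≤ Real.exp (setEntropy n s) := by
  have hs' : (0 : ℝ) < s := by exact_mod_cast hs
  have hn' : (0 : ℝ) < n := by exact_mod_cast hs.trans_le hsn
  refine (Nat.choose_le_pow_div s n).trans ?_
  have h := Real.pow_div_factorial_le_exp (s : ℝ) hs'.le s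
  rw [setEntropy, mul_add, mul_one, Real.exp_add, mul_comm (s : ℝ) (Real.log _), Real.exp_mul,
    Real.exp_log (by positivity), Real.rpow_natCast, div_pow]
  have hf : (0 : ℝ) < (s.factorial : ℝ) := by exact_mod_cast s.factorial_pos
  rw [div_le_iff₀ hf] at h
  rw [div_le_iff₀ hf, mul_div_assoc', div_mul_eq_mul_div, le_div_iff₀ (by positivity)]
  nlinarith [pow_pos hn' s]

/-- The number of positive observations of pairs `v < w` with `v ∈ S` and `w ∈ U`. -/
def crossSum {n : ℕ} (A : Matrix (Fin n) (Fin n) ℕ) (S U : Finset (Fin n)) : ℝ :=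
  upperSum fun v w => if v ∈ S ∧ w ∈ U then (A v w : ℝ) else 0

/-- There are not many more positive observations between any two sets than expected. -/
def Discrepancy {n : ℕ} (A : Matrix (Fin n) (Fin n) ℕ) (a : ℝ) : Prop :=
  ∀ S U : Finset (Fin n), S.Nonempty → U.Nonempty → ∀ k ≤ n,
    (k + 1) * Real.log 2 * crossSum A S U ≤
      a * S.card * U.card * 2 ^ (k + 1) + 3 * (setEntropy n S.card + setEntropy n U.card)

theorem sum_exp_neg_setEntropy_le (n : ℕ) (hn : 0 < n) :
    ∑ S : Finset (Fin n), (if S.Nonempty then Real.exp (-(3 * setEntropy n S.card)) else 0) ≤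
      1 / n := by
  have hn' : (0 : ℝ) < n := by exact_mod_cast hn
  obtain ⟨f, hf⟩ : ∃ f : ℕ → ℝ,
      f = fun s => if s = 0 then 0 else Real.exp (-(3 * setEntropy n s)) := ⟨_, rfl⟩
  have h1 : ∀ S : Finset (Fin n),
      (if S.Nonempty then Real.exp (-(3 * setEntropy n S.card)) else 0) = f S.card := by
    intro S
    rw [hf]
    by_cases hS : S.Nonempty
    · simp [hS, hS.card_pos.ne']
    · rw [Finset.not_nonempty_iff_eq_empty] at hS
      simp [hS]
  rw [Finset.sum_congr rfl fun S _ => h1 S, ← Finset.powerset_univ, Finset.sum_powerset_apply_card,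
    hf, Finset.card_univ, Fintype.card_fin, Finset.sum_range_succ']
  simp only [Nat.add_eq_zero_iff, one_ne_zero, and_false, if_false, if_true, smul_zero, add_zero]
  have h2 : ∀ s ∈ Finset.range n, n.choose (s + 1) • Real.exp (-(3 * setEntropy n (s + 1))) ≤
      1 / (n : ℝ) ^ 2 := by
    intro s hs
    have hs1 : s + 1 ≤ n := Finset.mem_range.1 hs
    have hc := choose_le_exp_setEntropy (Nat.succ_pos s) hs1
    have hl := log_le_setEntropy (Nat.succ_pos s) hs1
    rw [nsmul_eq_mul]
    calc (n.choose (s + 1) : ℝ) * Real.exp (-(3 * setEntropy n (s + 1)))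
        ≤ Real.exp (setEntropy n (s + 1)) * Real.exp (-(3 * setEntropy n (s + 1))) := by gcongr
      _ = Real.exp (-(2 * setEntropy n (s + 1))) := by rw [← Real.exp_add]; ring_nf
      _ ≤ Real.exp (-(2 * Real.log n)) := by
          apply Real.exp_le_exp.2
          have : setEntropy n (s + 1) = setEntropy n s.succ := rfl
          linarith
      _ = 1 / (n : ℝ) ^ 2 := by
          rw [Real.exp_neg, two_mul, Real.exp_add, Real.exp_log hn']
          field_simp
  refine (Finset.sum_le_sum h2).trans (le_of_eq ?_)
  rw [Finset.sum_const, Finset.card_range, nsmul_eq_mul]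
  field_simp

theorem crossSum_chernoff {n : ℕ} {P : PMF (Matrix (Fin n) (Fin n) ℕ)} {R : Fin n → Fin n → ℝ}
    (hP : SubPoisson P R) {a : ℝ} (ha : 0 ≤ a) (hR : ∀ v w, R v w ≤ a) (S U : Finset (Fin n))
    (k : ℕ) (c : ℝ) :
    P.toOuterMeasure {A | a * S.card * U.card * 2 ^ (k + 1) + c <
        (k + 1) * Real.log 2 * crossSum A S U} ≤ ENNReal.ofReal (Real.exp (-c)) := by
  classical
  set F : Fin n → Fin n → ℝ := fun v w => if v ∈ S ∧ w ∈ U then (k + 1) * Real.log 2 else 0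
  have hF : ∀ A : Matrix (Fin n) (Fin n) ℕ, (k + 1) * Real.log 2 * crossSum A S U =
      upperSum fun v w => F v w * A v w := by
    intro A
    rw [crossSum, ← upperSum_const_mul]
    refine upperSum_congr fun v w _ => ?_
    simp only [F]; split_ifs <;> simp
  have hE : (upperSum fun v w => R v w * (Real.exp (F v w) - 1)) ≤
      a * S.card * U.card * 2 ^ (k + 1) := by
    have h1 : (upperSum fun v w => R v w * (Real.exp (F v w) - 1)) ≤
        upperSum fun v w => if v ∈ S ∧ w ∈ U then a * 2 ^ (k + 1) else 0 := by
      refine upperSum_mono fun v w _ => ?_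
      simp only [F]
      split_ifs with h
      · have : Real.exp ((k + 1) * Real.log 2) = 2 ^ (k + 1) := by
          rw [mul_comm, Real.exp_mul, Real.exp_log (by norm_num)]
          exact_mod_cast Real.rpow_natCast 2 (k + 1)
        rw [this]
        have h2 : (1 : ℝ) ≤ 2 ^ (k + 1) := one_le_pow₀ (by norm_num)
        nlinarith [hR v w]
      · simp
    refine h1.trans ((upperSum_le_sum fun v w => ?_).trans (le_of_eq ?_))
    · split_ifs <;> positivity
    · simp only [ite_and]
      rw [Finset.sum_congr rfl (g := fun v => if v ∈ S then U.card * (a * 2 ^ (k + 1)) else 0)]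
      · rw [Finset.sum_ite_mem, Finset.univ_inter, Finset.sum_const, nsmul_eq_mul]; ring
      · intro v _
        split_ifs
        · rw [Finset.sum_ite_mem, Finset.univ_inter, Finset.sum_const, nsmul_eq_mul]
        · simp
  refine (MeasureTheory.measure_mono fun A hA => ?_).trans
    ((hP.chernoff F (a * S.card * U.card * 2 ^ (k + 1) + c)).trans ?_)
  · rw [Set.mem_ofPred_eq, hF] at hA
    exact hA.le
  · exact ENNReal.ofReal_le_ofReal (Real.exp_le_exp.2 (by linarith))

theorem discrepancy_prob {n : ℕ} (hn : 0 < n) {P : PMF (Matrix (Fin n) (Fin n) ℕ)}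
    {R : Fin n → Fin n → ℝ} (hP : SubPoisson P R) {a : ℝ} (ha : 0 ≤ a) (hR : ∀ v w, R v w ≤ a) :
    P.toOuterMeasure {A | ¬ Discrepancy A a} ≤ ENNReal.ofReal (2 / n) := by
  classical
  have hn' : (1 : ℝ) ≤ n := by exact_mod_cast hn
  let E : (Finset (Fin n) × Finset (Fin n)) × ℕ → Set (Matrix (Fin n) (Fin n) ℕ) := fun x =>
    if x.1.1.Nonempty ∧ x.1.2.Nonempty then
      {A | a * x.1.1.card * x.1.2.card * 2 ^ (x.2 + 1) +
        3 * (setEntropy n x.1.1.card + setEntropy n x.1.2.card) <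
        (x.2 + 1) * Real.log 2 * crossSum A x.1.1 x.1.2} else ∅
  let I : Finset ((Finset (Fin n) × Finset (Fin n)) × ℕ) := Finset.univ ×ˢ Finset.range (n + 1)
  have hsub : {A | ¬ Discrepancy A a} ⊆ ⋃ x ∈ I, E x := by
    intro A hA
    simp only [Discrepancy, Set.mem_ofPred_eq] at hA
    push Not at hA
    obtain ⟨S, U, hS, hU, k, hk, hlt⟩ := hA
    refine Set.mem_iUnion₂.2 ⟨((S, U), k), ?_, ?_⟩
    · simp only [I, Finset.mem_product, Finset.mem_univ, true_and, Finset.mem_range]; omega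
    · simp only [E, hS, hU, and_self, if_true]; exact hlt
  let W : Finset (Fin n) → ℝ := fun S =>
    if S.Nonempty then Real.exp (-(3 * setEntropy n S.card)) else 0
  have hW : ∀ S, 0 ≤ W S := fun S => by simp only [W]; split_ifs <;> positivity
  refine (MeasureTheory.measure_mono hsub).trans ((MeasureTheory.measure_biUnion_finset_le I E).trans ?_)
  have hE : ∀ x ∈ I, P.toOuterMeasure (E x) ≤ ENNReal.ofReal (W x.1.1 * W x.1.2) := by
    intro x _
    simp only [E, W]
    by_cases h : x.1.1.Nonempty ∧ x.1.2.Nonempty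
    · rw [if_pos h, if_pos h.1, if_pos h.2, ← Real.exp_add]
      refine (crossSum_chernoff hP ha hR _ _ x.2 _).trans (le_of_eq ?_)
      congr 2; ring
    · rw [if_neg h]; simp
  refine (Finset.sum_le_sum hE).trans ?_
  rw [← ENNReal.ofReal_sum_of_nonneg fun x _ => mul_nonneg (hW _) (hW _)]
  refine ENNReal.ofReal_le_ofReal ?_
  have hsum : ∑ x ∈ I, W x.1.1 * W x.1.2 = (n + 1) * ((∑ S, W S) * ∑ S, W S) := by
    rw [Finset.sum_product]
    simp only [Finset.sum_const, Finset.card_range, nsmul_eq_mul]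
    rw [← Finset.mul_sum, Finset.sum_mul_sum, ← Finset.univ_product_univ, Finset.sum_product]
    push_cast; rfl
  rw [hsum]
  have hs := sum_exp_neg_setEntropy_le n hn
  have hs0 : 0 ≤ ∑ S, W S := Finset.sum_nonneg fun S _ => hW S
  calc ((n : ℝ) + 1) * ((∑ S, W S) * ∑ S, W S) ≤ (n + 1) * (1 / n * (1 / n)) := by
        gcongr
    _ ≤ 2 / n := by
        rw [div_mul_div_comm, mul_div_assoc', div_le_div_iff₀ (by positivity) (by positivity)]
        nlinarith

/-! ### Bilinear forms at dyadic vectors -/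

/-- `0, 1, 2, 4, 8, …` -/
def dyadic : ℕ → ℝ
  | 0 => 0
  | i + 1 => 2 ^ i

theorem dyadic_nonneg (i : ℕ) : 0 ≤ dyadic i := by
  cases i <;> simp [dyadic]

/-- The vectors with dyadic coordinates that are used to bound bilinear forms. -/
def IsDyadicVector {n : ℕ} (l : Fin n → ℕ) : Prop := ∑ v, dyadic (l v) ^ 2 ≤ 5 * n

/-- The part of a bilinear form with small coefficients is concentrated. -/
def LightBound {n : ℕ} (A : Matrix (Fin n) (Fin n) ℕ) (R : Fin n → Fin n → ℝ) (θ : ℝ) : Prop :=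
  ∀ l l' : Fin n → ℕ, IsDyadicVector l → IsDyadicVector l' →
    |upperSum fun v w => if dyadic (l v) * dyadic (l' w) ≤ θ then
      dyadic (l v) * dyadic (l' w) * ((A v w : ℝ) - R v w) else 0| ≤ 114 * n * θ

theorem IsDyadicVector.lt {n : ℕ} {l : Fin n → ℕ} (h : IsDyadicVector l) (v : Fin n) :
    l v < n + 4 := by
  by_contra! hv
  have h1 : dyadic (l v) ^ 2 ≤ 5 * n :=
    (Finset.single_le_sum (fun w _ => sq_nonneg (dyadic (l w))) (Finset.mem_univ v)).trans h
  obtain ⟨i, hi⟩ : ∃ i, l v = i + 1 := ⟨l v - 1, by omega⟩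
  rw [hi, dyadic, ← pow_mul] at h1
  have h2 : (n : ℝ) + 3 < 2 ^ (n + 3) := by exact_mod_cast Nat.lt_two_pow_self (n := n + 3)
  have h3 : (2 : ℝ) ^ (n + 3 + 3) ≤ 2 ^ (i * 2) := pow_le_pow_right₀ (by norm_num) (by omega)
  rw [pow_add] at h3
  have : (0 : ℝ) ≤ n := Nat.cast_nonneg n
  linarith

theorem sum_exp_neg_dyadic_le (B : ℕ) :
    ∑ i ∈ Finset.range B, Real.exp (-dyadic i ^ 2) ≤ 2 := by
  cases B with
  | zero => simp
  | succ B =>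
    rw [Finset.sum_range_succ']
    have h : ∀ i ∈ Finset.range B, Real.exp (-dyadic (i + 1) ^ 2) ≤ 1 / 2 * (1 / 2) ^ i := by
      intro i _
      have h1 : ((i + 1 : ℕ) : ℝ) ≤ dyadic (i + 1) ^ 2 := by
        have h2 : (i + 1 : ℕ) ≤ 2 ^ i := Nat.lt_two_pow_self
        have h3 : ((i + 1 : ℕ) : ℝ) ≤ 2 ^ i := by exact_mod_cast h2
        have h4 : (1 : ℝ) ≤ 2 ^ i := one_le_pow₀ (by norm_num)
        rw [dyadic]; nlinarith
      calc Real.exp (-dyadic (i + 1) ^ 2) ≤ Real.exp (-((i + 1 : ℕ) : ℝ)) := by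
            apply Real.exp_le_exp.2; linarith
        _ = (Real.exp (-1)) ^ (i + 1) := by rw [← Real.exp_nat_mul]; ring_nf
        _ ≤ (1 / 2) ^ (i + 1) := by
            refine pow_le_pow_left₀ (Real.exp_pos _).le ?_ _
            rw [Real.exp_neg, ← one_div]
            exact one_div_le_one_div_of_le (by norm_num) (by linarith [Real.add_one_le_exp (1:ℝ)])
        _ = _ := by ring
    have h2 := Finset.sum_le_sum h
    rw [← Finset.mul_sum] at h2
    have h3 := sum_geometric_two_le B
    simp only [dyadic]
    simp only [dyadic] at h2
    norm_num
    norm_num at h2 h3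
    linarith

open Classical in
/-- The finite set of dyadic vectors. -/
def dyadicVectors (n : ℕ) : Finset (Fin n → ℕ) :=
  (Fintype.piFinset fun _ : Fin n => Finset.range (n + 4)).filter IsDyadicVector

theorem mem_dyadicVectors {n : ℕ} {l : Fin n → ℕ} (h : IsDyadicVector l) :
    l ∈ dyadicVectors n := by
  simp only [dyadicVectors, Finset.mem_filter, Fintype.mem_piFinset, Finset.mem_range]
  exact ⟨h.lt, h⟩

theorem card_dyadicVectors_le (n : ℕ) : ((dyadicVectors n).card : ℝ) ≤ Real.exp (6 * n) := by
  classical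
  have h1 : ((dyadicVectors n).card : ℝ) ≤
      ∑ l ∈ Fintype.piFinset fun _ : Fin n => Finset.range (n + 4),
        Real.exp (5 * n) * ∏ v, Real.exp (-dyadic (l v) ^ 2) := by
    rw [Finset.card_eq_sum_ones]
    push_cast
    rw [dyadicVectors, Finset.sum_filter]
    refine Finset.sum_le_sum fun l _ => ?_
    split_ifs with h
    · rw [← Real.exp_sum, ← Real.exp_add, Real.one_le_exp_iff, Finset.sum_neg_distrib]
      have : _ ≤ _ := h
      linarith
    · exact mul_nonneg (Real.exp_pos _).le (Finset.prod_nonneg fun v _ => (Real.exp_pos _).le)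
  refine h1.trans ?_
  rw [← Finset.mul_sum, ← Finset.prod_univ_sum (fun _ : Fin n => Finset.range (n + 4))
    (fun _ i => Real.exp (-dyadic i ^ 2)), Finset.prod_const, Finset.card_univ, Fintype.card_fin]
  have h2 : (∑ i ∈ Finset.range (n + 4), Real.exp (-dyadic i ^ 2)) ^ n ≤ (Real.exp 1) ^ n :=
    pow_le_pow_left₀ (Finset.sum_nonneg fun i _ => (Real.exp_pos _).le)
      ((sum_exp_neg_dyadic_le _).trans (by linarith [Real.add_one_le_exp (1:ℝ)])) n
  rw [← Real.exp_nat_mul] at h2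
  calc _ ≤ Real.exp (5 * n) * Real.exp (n * 1) := by gcongr
    _ = _ := by rw [← Real.exp_add]; ring_nf

theorem lightSum_chernoff {n : ℕ} {P : PMF (Matrix (Fin n) (Fin n) ℕ)} {R : Fin n → Fin n → ℝ}
    (hP : SubPoisson P R) {a θ : ℝ} (hθ : 0 < θ) (haθ : n * a ≤ 4 * θ ^ 2)
    (hR0 : ∀ v w, 0 ≤ R v w) (hR : ∀ v w, R v w ≤ a) {l l' : Fin n → ℕ}
    (hl : IsDyadicVector l) (hl' : IsDyadicVector l') {σ : ℝ} (hσ : |σ| = 1) :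
    P.toOuterMeasure {A | 114 * n * θ < σ * upperSum fun v w =>
        if dyadic (l v) * dyadic (l' w) ≤ θ then
          dyadic (l v) * dyadic (l' w) * ((A v w : ℝ) - R v w) else 0} ≤
      ENNReal.ofReal (Real.exp (-(14 * n))) := by
  classical
  set X : Fin n → Fin n → ℝ := fun v w => dyadic (l v) * dyadic (l' w) with hX
  have hX0 : ∀ v w, 0 ≤ X v w := fun v w => mul_nonneg (dyadic_nonneg _) (dyadic_nonneg _)
  set F : Fin n → Fin n → ℝ := fun v w => if X v w ≤ θ then σ * (X v w / θ) else 0 with hF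
  have hσ2 : σ ^ 2 = 1 := by rw [← sq_abs, hσ, one_pow]
  have hFabs : ∀ v w, |F v w| ≤ 1 := by
    intro v w
    simp only [hF]
    split_ifs with h
    · rw [abs_mul, hσ, one_mul, abs_of_nonneg (div_nonneg (hX0 v w) hθ.le)]
      exact (div_le_one hθ).2 h
    · simp
  have hFsq : ∀ v w, F v w ^ 2 ≤ (X v w) ^ 2 / θ ^ 2 := by
    intro v w
    simp only [hF]
    split_ifs with h
    · rw [mul_pow, hσ2, div_pow, one_mul]
    · simp only [ne_eq, OfNat.ofNat_ne_zero, not_false_eq_true, zero_pow]; positivity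
  have hvar : upperSum (fun v w => R v w * F v w ^ 2) ≤ 100 * n := by
    have ha : ∀ v w : Fin n, 0 ≤ a := fun v w => (hR0 v w).trans (hR v w)
    have h1 : upperSum (fun v w => R v w * F v w ^ 2) ≤
        ∑ v, ∑ w, a * ((X v w) ^ 2 / θ ^ 2) := by
      refine (upperSum_mono fun v w _ => ?_).trans (upperSum_le_sum fun v w => ?_)
      · exact mul_le_mul (hR v w) (hFsq v w) (sq_nonneg _) (ha v w)
      · exact mul_nonneg (ha v w) (by positivity)
    have h2 : ∑ v, ∑ w, a * ((X v w) ^ 2 / θ ^ 2) =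
        a / θ ^ 2 * ((∑ v, dyadic (l v) ^ 2) * ∑ w, dyadic (l' w) ^ 2) := by
      rw [Finset.sum_mul_sum, Finset.mul_sum]
      refine Finset.sum_congr rfl fun v _ => ?_
      rw [Finset.mul_sum]
      refine Finset.sum_congr rfl fun w _ => ?_
      simp only [hX]; ring
    rw [h2] at h1
    rcases Nat.eq_zero_or_pos n with rfl | hn
    · simp [upperSum]
    have hn' : (0 : ℝ) < n := by exact_mod_cast hn
    have ha0 : 0 ≤ a := ha ⟨0, hn⟩ ⟨0, hn⟩
    have hl1 : ∑ v, dyadic (l v) ^ 2 ≤ 5 * n := hl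
    have hl2 : ∑ w, dyadic (l' w) ^ 2 ≤ 5 * n := hl'
    have h3 : (∑ v, dyadic (l v) ^ 2) * ∑ w, dyadic (l' w) ^ 2 ≤ (5 * n) * (5 * n) :=
      mul_le_mul hl1 hl2 (Finset.sum_nonneg fun _ _ => sq_nonneg _) (by positivity)
    refine h1.trans ((mul_le_mul_of_nonneg_left h3 (by positivity)).trans ?_)
    rw [div_mul_eq_mul_div, div_le_iff₀ (by positivity)]
    nlinarith
  have hexp : ∀ v w, R v w * (Real.exp (F v w) - 1) ≤ R v w * F v w + R v w * F v w ^ 2 := by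
    intro v w
    have h := (abs_le.1 (Real.abs_exp_sub_one_sub_id_le (hFabs v w))).2
    nlinarith [hR0 v w]
  have hsum : ∀ A : Matrix (Fin n) (Fin n) ℕ, σ * (upperSum fun v w =>
      if X v w ≤ θ then X v w * ((A v w : ℝ) - R v w) else 0) =
      θ * ((upperSum fun v w => F v w * A v w) - upperSum fun v w => R v w * F v w) := by
    intro A
    rw [← upperSum_sub, ← upperSum_const_mul, ← upperSum_const_mul]
    refine upperSum_congr fun v w _ => ?_
    simp only [hF]
    split_ifs
    · field_simp
    · simp
  refine (MeasureTheory.measure_mono fun A hA => ?_).trans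
    ((hP.chernoff F (114 * n + upperSum fun v w => R v w * F v w)).trans ?_)
  · rw [Set.mem_ofPred_eq, hsum A, mul_comm _ θ] at hA
    have := lt_of_mul_lt_mul_left hA hθ.le
    rw [Set.mem_ofPred_eq]
    linarith
  · refine ENNReal.ofReal_le_ofReal (Real.exp_le_exp.2 ?_)
    have h1 := upperSum_mono fun v w (_ : v < w) => hexp v w
    rw [upperSum_add] at h1
    linarith

theorem lightBound_prob {n : ℕ} {P : PMF (Matrix (Fin n) (Fin n) ℕ)} {R : Fin n → Fin n → ℝ}
    (hP : SubPoisson P R) {a θ : ℝ} (hθ : 0 < θ) (haθ : n * a ≤ 4 * θ ^ 2)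
    (hR0 : ∀ v w, 0 ≤ R v w) (hR : ∀ v w, R v w ≤ a) :
    P.toOuterMeasure {A | ¬ LightBound A R θ} ≤ ENNReal.ofReal (2 * Real.exp (-n)) := by
  classical
  let V : Matrix (Fin n) (Fin n) ℕ → (Fin n → ℕ) × (Fin n → ℕ) → ℝ := fun A x =>
    upperSum fun v w => if dyadic (x.1 v) * dyadic (x.2 w) ≤ θ then
      dyadic (x.1 v) * dyadic (x.2 w) * ((A v w : ℝ) - R v w) else 0
  let E : (Fin n → ℕ) × (Fin n → ℕ) → Set (Matrix (Fin n) (Fin n) ℕ) := fun x =>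
    {A | 114 * n * θ < 1 * V A x} ∪ {A | 114 * n * θ < (-1) * V A x}
  let I := dyadicVectors n ×ˢ dyadicVectors n
  have hsub : {A | ¬ LightBound A R θ} ⊆ ⋃ x ∈ I, E x := by
    intro A hA
    simp only [LightBound, Set.mem_ofPred_eq] at hA
    push Not at hA
    obtain ⟨l, l', hl, hl', hlt⟩ := hA
    refine Set.mem_iUnion₂.2 ⟨(l, l'), Finset.mem_product.2
      ⟨mem_dyadicVectors hl, mem_dyadicVectors hl'⟩, ?_⟩
    rcases lt_abs.1 hlt with h | h
    · exact Or.inl (by simpa [V] using h)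
    · exact Or.inr (by simpa [V] using h)
  refine (MeasureTheory.measure_mono hsub).trans ((MeasureTheory.measure_biUnion_finset_le I E).trans ?_)
  have hE : ∀ x ∈ I, P.toOuterMeasure (E x) ≤ ENNReal.ofReal (2 * Real.exp (-(14 * n))) := by
    intro x hx
    have hx' := Finset.mem_product.1 hx
    have h1 := (Finset.mem_filter.1 hx'.1).2
    have h2 := (Finset.mem_filter.1 hx'.2).2
    refine (MeasureTheory.measure_union_le _ _).trans ?_
    rw [two_mul, ENNReal.ofReal_add (Real.exp_pos _).le (Real.exp_pos _).le]
    exact add_le_add (lightSum_chernoff hP hθ haθ hR0 hR h1 h2 (by simp))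
      (lightSum_chernoff hP hθ haθ hR0 hR h1 h2 (by simp))
  refine (Finset.sum_le_sum hE).trans ?_
  rw [Finset.sum_const, nsmul_eq_mul, ← ENNReal.ofReal_natCast,
    ← ENNReal.ofReal_mul (Nat.cast_nonneg _)]
  refine ENNReal.ofReal_le_ofReal ?_
  have hc := card_dyadicVectors_le n
  rw [Finset.card_product]
  push_cast
  calc ((dyadicVectors n).card : ℝ) * (dyadicVectors n).card * (2 * Real.exp (-(14 * n)))
      ≤ Real.exp (6 * n) * Real.exp (6 * n) * (2 * Real.exp (-(14 * n))) := by gcongr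
    _ = 2 * Real.exp (-(2 * n)) := by
        rw [← Real.exp_add, mul_left_comm, ← Real.exp_add]; ring_nf
    _ ≤ 2 * Real.exp (-n) := by
        have : (0 : ℝ) ≤ n := Nat.cast_nonneg n
        gcongr; linarith

/-! ### Numbers of positive observations between a node and a cluster -/

theorem upperSum_row {n : ℕ} (v : Fin n) (G : Fin n → ℝ) (B : Fin n → Fin n → ℝ)
    (hB : ∀ v w, B v w = B w v) :
    (upperSum fun v' w' => ((if v' = v then G w' else 0) + (if w' = v then G v' else 0)) * B v' w')
      = ∑ w, if w ≠ v then G w * B v w else 0 := by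
  have h1 : (upperSum fun v' w' => (if v' = v then G w' else 0) * B v' w') =
      ∑ w, if v < w then G w * B v w else 0 := by
    rw [upperSum, Finset.sum_eq_single v]
    · simp
    · intro v' _ hv'; simp [hv']
    · simp
  have h2 : (upperSum fun v' w' => (if w' = v then G v' else 0) * B v' w') =
      ∑ w, if w < v then G w * B v w else 0 := by
    rw [upperSum, Finset.sum_comm, Finset.sum_eq_single v]
    · refine Finset.sum_congr rfl fun w _ => ?_
      simp [hB w v]
    · intro v' _ hv'; simp [hv']
    · simp
  simp only [add_mul]
  rw [upperSum_add, h1, h2, ← Finset.sum_add_distrib]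
  refine Finset.sum_congr rfl fun w _ => ?_
  rcases lt_trichotomy v w with h | h | h
  · simp [h, h.ne', h.not_gt]
  · simp [h]
  · simp [h, h.ne, h.not_gt]

open Classical in
/-- The number of nodes of a cluster. -/
def clusterSize {n K : ℕ} (τ : Fin n → Fin K) (l : Fin K) : ℕ :=
  (Finset.univ.filter fun w => τ w = l).card

open Classical in
/-- The number of positive observations between a node and a cluster. -/
def clusterDegree {n K : ℕ} (A : Matrix (Fin n) (Fin n) ℕ) (τ : Fin n → Fin K) (v : Fin n)
    (l : Fin K) : ℝ := ∑ w ∈ Finset.univ.filter (fun w => τ w = l), (A v w : ℝ)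

open Classical in
/-- The mean of `clusterDegree`, if the node itself is counted in its cluster. -/
def clusterMean {n K : ℕ} (τ : Fin n → Fin K) (a b : ℝ) (v : Fin n) (l : Fin K) : ℝ :=
  clusterSize τ l * (if τ v = l then a else b)

theorem clusterMean_eq {n K : ℕ} (τ : Fin n → Fin K) (a b : ℝ) (v : Fin n) (l : Fin K) :
    clusterMean τ a b v l = ∑ w ∈ Finset.univ.filter (fun w => τ w = l), rate τ a b v w := by
  rw [clusterMean, clusterSize, Finset.sum_congr rfl (g := fun _ => if τ v = l then a else b)]
  · rw [Finset.sum_const, nsmul_eq_mul]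
  · intro w hw
    rw [rate, (Finset.mem_filter.1 hw).2]

theorem clusterDegree_chernoff {n K : ℕ} {P : PMF (Matrix (Fin n) (Fin n) ℕ)} {τ : Fin n → Fin K}
    {a b : ℝ} (hb : 0 ≤ b) (hab : b ≤ a) (hP : SubPoisson P (rate τ a b))
    (hsupp : ∀ A, P A ≠ 0 → A.IsSymm ∧ ∀ v, A v v = 0) (v : Fin n) (l : Fin K) {t : ℝ}
    (ht : |t| ≤ 1) (c : ℝ) :
    P.toOuterMeasure {A | c < t * (clusterDegree A τ v l - clusterMean τ a b v l)} ≤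
      ENNReal.ofReal (Real.exp (t ^ 2 * (clusterSize τ l * a) + |t| * a - c)) := by
  classical
  have ha : 0 ≤ a := hb.trans hab
  set G : Fin n → ℝ := fun w => if τ w = l then t else 0 with hG
  set F : Fin n → Fin n → ℝ := fun v' w' =>
    (if v' = v then G w' else 0) + (if w' = v then G v' else 0) with hF
  have hA : ∀ A : Matrix (Fin n) (Fin n) ℕ, P A ≠ 0 →
      t * clusterDegree A τ v l = upperSum fun v w => F v w * A v w := by
    intro A hPA
    obtain ⟨hs, hd⟩ := hsupp A hPA
    simp only [hF]
    rw [upperSum_row v G (fun v w => (A v w : ℝ)) (fun v w => by rw [hs.apply]), clusterDegree,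
      Finset.sum_filter, Finset.mul_sum]
    refine Finset.sum_congr rfl fun w _ => ?_
    simp only [hG]
    by_cases hw : w = v
    · simp [hw, hd]
    · by_cases h2 : τ w = l <;> simp [hw, h2]
  have hE : (upperSum fun v' w' => rate τ a b v' w' * (Real.exp (F v' w') - 1)) ≤
      t * clusterMean τ a b v l + (t ^ 2 * (clusterSize τ l * a) + |t| * a) := by
    have h1 : (upperSum fun v' w' => rate τ a b v' w' * (Real.exp (F v' w') - 1)) =
        upperSum fun v' w' => ((if v' = v then Real.exp (G w') - 1 else 0) +
          (if w' = v then Real.exp (G v') - 1 else 0)) * rate τ a b v' w' := by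
      refine upperSum_congr fun v' w' hlt => ?_
      simp only [hF]
      by_cases h1 : v' = v
      · have h2 : w' ≠ v := by rw [← h1]; exact hlt.ne'
        simp only [h1, h2, if_true, if_false, add_zero]; ring
      · by_cases h2 : w' = v
        · simp only [h1, h2, if_true, if_false, zero_add]; ring
        · simp [h1, h2]
    rw [h1, upperSum_row v (fun w => Real.exp (G w) - 1) (rate τ a b) (rate_symm τ a b)]
    have h3 : ∀ w, (if w ≠ v then (Real.exp (G w) - 1) * rate τ a b v w else 0) ≤
        (if τ w = l then t * rate τ a b v w + t ^ 2 * a else 0) +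
          (if w = v then |t| * a else 0) := by
      intro w
      have hr0 := rate_nonneg τ hb hab v w
      have hr := rate_le τ hab v w
      have he := (abs_le.1 (Real.abs_exp_sub_one_sub_id_le ht)).2
      have ht2 := sq_nonneg t
      simp only [hG]
      by_cases hw : w = v
      · simp only [hw, ne_eq, not_true_eq_false, if_false, if_true]
        have hr0 := rate_nonneg τ hb hab v v
        have hr := rate_le τ hab v v
        split_ifs
        · nlinarith [neg_abs_le t, mul_nonneg ht2 ha, abs_nonneg t,
            mul_le_mul_of_nonneg_left hr (abs_nonneg t), mul_nonneg hr0 (abs_nonneg t)]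
        · nlinarith [abs_nonneg t]
      · simp only [hw, ne_eq, not_false_eq_true, if_true, if_false, add_zero]
        split_ifs
        · nlinarith [mul_le_mul_of_nonneg_left hr ht2]
        · simp
    refine (Finset.sum_le_sum fun w _ => h3 w).trans (le_of_eq ?_)
    rw [Finset.sum_add_distrib, clusterMean_eq, clusterSize, ← Finset.sum_filter,
      Finset.sum_add_distrib, ← Finset.mul_sum, Finset.sum_const, nsmul_eq_mul,
      Finset.sum_ite_eq' Finset.univ v]
    simp only [Finset.mem_univ, if_true]
    ring
  have hsub : P.toOuterMeasure {A | c < t * (clusterDegree A τ v l - clusterMean τ a b v l)} ≤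
      P.toOuterMeasure {A | c + t * clusterMean τ a b v l ≤ upperSum fun v w => F v w * A v w} := by
    rw [PMF.toOuterMeasure_apply, PMF.toOuterMeasure_apply]
    refine ENNReal.tsum_le_tsum fun A => ?_
    by_cases hPA : P A = 0
    · simp [Set.indicator, hPA]
    · simp only [Set.indicator_apply, Set.mem_ofPred_eq]
      split_ifs with h1 h2
      · rfl
      · rw [← hA A hPA] at h2
        exact absurd (by linarith) h2
      · exact zero_le
      · rfl
  refine hsub.trans ((hP.chernoff F _).trans (ENNReal.ofReal_le_ofReal (Real.exp_le_exp.2 ?_)))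
  linarith

/-- The nodes with an atypical number of positive observations with some cluster. -/
def Deviates {n K : ℕ} (A : Matrix (Fin n) (Fin n) ℕ) (τ : Fin n → Fin K) (a b : ℝ)
    (v : Fin n) : Prop :=
  ∃ l, 2 / 5 * clusterSize τ l * (a - b) < |clusterDegree A τ v l - clusterMean τ a b v l|

theorem deviates_prob {n K : ℕ} {P : PMF (Matrix (Fin n) (Fin n) ℕ)} {τ : Fin n → Fin K}
    {a b α : ℝ} (hb : 0 ≤ b) (hab : b < a) (hP : SubPoisson P (rate τ a b))
    (hsupp : ∀ A, P A ≠ 0 → A.IsSymm ∧ ∀ v, A v v = 0)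
    (hα : ∀ l, α * n ≤ clusterSize τ l) (v : Fin n) :
    P.toOuterMeasure {A | Deviates A τ a b v} ≤
      ENNReal.ofReal (2 * K * Real.exp (-(α * n * (a - b) ^ 2 / a / 25) + (a - b) / 5)) := by
  have ha : 0 < a := hb.trans_lt hab
  set t : ℝ := (a - b) / a / 5 with ht
  have ht0 : 0 < t := div_pos (div_pos (sub_pos.2 hab) ha) (by norm_num)
  have hx1 : (a - b) / a ≤ 1 := (div_le_one ha).2 (by linarith)
  have ht1 : |t| ≤ 1 := by rw [abs_of_pos ht0, ht]; linarith
  have hsub : {A | Deviates A τ a b v} ⊆ ⋃ l ∈ (Finset.univ : Finset (Fin K)),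
      ({A | t * (2 / 5 * clusterSize τ l * (a - b)) <
          t * (clusterDegree A τ v l - clusterMean τ a b v l)} ∪
        {A | t * (2 / 5 * clusterSize τ l * (a - b)) <
          (-t) * (clusterDegree A τ v l - clusterMean τ a b v l)}) := by
    intro A hA
    rw [Set.mem_ofPred_eq] at hA
    obtain ⟨l, hl⟩ := hA
    refine Set.mem_iUnion₂.2 ⟨l, Finset.mem_univ _, ?_⟩
    rcases lt_abs.1 hl with h | h
    · left; exact mul_lt_mul_of_pos_left h ht0
    · right
      rw [Set.mem_ofPred_eq, neg_mul_comm]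
      exact mul_lt_mul_of_pos_left h ht0
  refine (MeasureTheory.measure_mono hsub).trans
    ((MeasureTheory.measure_biUnion_finset_le _ _).trans ?_)
  have hE : ∀ l ∈ (Finset.univ : Finset (Fin K)), P.toOuterMeasure
      ({A | t * (2 / 5 * clusterSize τ l * (a - b)) <
          t * (clusterDegree A τ v l - clusterMean τ a b v l)} ∪
        {A | t * (2 / 5 * clusterSize τ l * (a - b)) <
          (-t) * (clusterDegree A τ v l - clusterMean τ a b v l)}) ≤
      ENNReal.ofReal (2 * Real.exp (-(α * n * (a - b) ^ 2 / a / 25) + (a - b) / 5)) := by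
    intro l _
    refine (MeasureTheory.measure_union_le _ _).trans ?_
    rw [two_mul, ENNReal.ofReal_add (Real.exp_pos _).le (Real.exp_pos _).le]
    have hexp : t ^ 2 * (clusterSize τ l * a) + |t| * a - t * (2 / 5 * clusterSize τ l * (a - b)) ≤
        -(α * n * (a - b) ^ 2 / a / 25) + (a - b) / 5 := by
      rw [abs_of_pos ht0]
      have h1 : t ^ 2 * (clusterSize τ l * a) + t * a - t * (2 / 5 * clusterSize τ l * (a - b)) =
          -(clusterSize τ l * ((a - b) ^ 2 / a / 25)) + (a - b) / 5 := by
        rw [ht]; field_simp; ring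
      have h2 := mul_le_mul_of_nonneg_right (hα l)
        (show 0 ≤ (a - b) ^ 2 / a / 25 by positivity)
      rw [h1]
      have h3 : α * n * (a - b) ^ 2 / a / 25 = α * n * ((a - b) ^ 2 / a / 25) := by ring
      linarith
    refine add_le_add
      ((clusterDegree_chernoff hb hab.le hP hsupp v l ht1 _).trans
        (ENNReal.ofReal_le_ofReal (Real.exp_le_exp.2 hexp)))
      ((clusterDegree_chernoff hb hab.le hP hsupp v l (by rwa [abs_neg]) _).trans
        (ENNReal.ofReal_le_ofReal (Real.exp_le_exp.2 ?_)))
    rw [abs_neg, neg_sq]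
    exact hexp
  refine (Finset.sum_le_sum hE).trans (le_of_eq ?_)
  rw [Finset.sum_const, nsmul_eq_mul, Finset.card_univ, Fintype.card_fin, ← ENNReal.ofReal_natCast,
    ← ENNReal.ofReal_mul (Nat.cast_nonneg _)]
  congr 1; ring

open Classical in
theorem toOuterMeasure_card_le {Ω ι : Type*} [Fintype ι] (P : PMF Ω) (E : ι → Set Ω) {c : ℝ}
    (hc : 0 < c) {δ : ℝ}
    (hE : ∀ i, P.toOuterMeasure (E i) ≤ ENNReal.ofReal δ) :
    P.toOuterMeasure {x | c < ((Finset.univ.filter fun i => x ∈ E i).card : ℝ)} ≤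
      ENNReal.ofReal (Fintype.card ι * δ / c) := by
  have h1 : P.toOuterMeasure {x | c < ((Finset.univ.filter fun i => x ∈ E i).card : ℝ)} ≤
      mean P fun x => (∑ i, (E i).indicator (fun _ => (1 : ℝ≥0∞)) x) * (ENNReal.ofReal c)⁻¹ := by
    refine toOuterMeasure_le_mean P fun x hx => ?_
    rw [Set.mem_ofPred_eq] at hx
    have h2 : ∑ i, (E i).indicator (fun _ => (1 : ℝ≥0∞)) x =
        ((Finset.univ.filter fun i => x ∈ E i).card : ℝ≥0∞) := by
      simp only [Set.indicator_apply]
      rw [Finset.card_filter]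
      push_cast; rfl
    rw [h2, ← div_eq_mul_inv, ENNReal.le_div_iff_mul_le (Or.inl (by simpa using hc))
      (Or.inl ENNReal.ofReal_ne_top), one_mul, ← ENNReal.ofReal_natCast]
    exact ENNReal.ofReal_le_ofReal hx.le
  refine h1.trans ?_
  rw [mean_mul_const, ENNReal.ofReal_div_of_pos hc, div_eq_mul_inv]
  gcongr
  have h3 : mean P (fun x => ∑ i, (E i).indicator (fun _ => (1 : ℝ≥0∞)) x) =
      ∑ i, P.toOuterMeasure (E i) := by
    simp only [mean, Finset.mul_sum, PMF.toOuterMeasure_apply]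
    rw [Summable.tsum_finsetSum fun i _ => ENNReal.summable]
    refine Finset.sum_congr rfl fun i _ => tsum_congr fun x => ?_
    simp only [Set.indicator_apply]; split_ifs <;> simp
  rw [h3, ENNReal.ofReal_mul (Nat.cast_nonneg _), ENNReal.ofReal_natCast]
  refine (Finset.sum_le_sum fun i _ => hE i).trans ?_
  rw [Finset.sum_const, nsmul_eq_mul, Finset.card_univ]

/-! ### A bound for bilinear forms -/

theorem sum_two_pow_div_le (k : ℕ) :
    ∑ i ∈ Finset.range k, (2 : ℝ) ^ i / (i + 1) ≤ 4 * 2 ^ k / (k + 1) := by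
  induction k with
  | zero => simp
  | succ k ih =>
    rw [Finset.sum_range_succ]
    rcases Nat.eq_zero_or_pos k with rfl | hk
    · norm_num
    · have hk' : (1 : ℝ) ≤ k := by exact_mod_cast hk
      have h2 : (0 : ℝ) < 2 ^ k := by positivity
      refine (add_le_add_left ih _).trans ?_
      rw [← add_div, pow_succ]
      push_cast
      rw [div_le_div_iff₀ (by linarith) (by linarith)]
      nlinarith

theorem setEntropy_le {n u : ℕ} (hu : 0 < u) (hun : u ≤ n) (j : ℕ) :
    setEntropy n u ≤ 3 * (j + 1) * u + n * (1 / 8) ^ (j + 1) := by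
  have hu' : (0 : ℝ) < u := by exact_mod_cast hu
  have hn' : (0 : ℝ) < n := by exact_mod_cast hu.trans_le hun
  have h8 : Real.log 8 ≤ 3 := by
    have h := Real.log_le_sub_one_of_pos (show (0 : ℝ) < 2 by norm_num)
    rw [show (8 : ℝ) = 2 ^ 3 by norm_num, Real.log_pow]; push_cast; linarith
  have h1 := Real.log_le_sub_one_of_pos (show (0 : ℝ) < n / u * (1 / 8) ^ (j + 1) by positivity)
  rw [Real.log_mul (by positivity) (by positivity), Real.log_pow, one_div, Real.log_inv] at h1
  push_cast at h1
  have hj : (0 : ℝ) ≤ j := Nat.cast_nonneg j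
  have h2 : 1 + Real.log (n / u) ≤ 3 * (j + 1) + n / u * (1 / 8) ^ (j + 1) := by
    rw [one_div]
    nlinarith
  rw [setEntropy]
  refine (mul_le_mul_of_nonneg_left h2 hu'.le).trans (le_of_eq ?_)
  field_simp

theorem five_mul_lt_two_pow {n : ℕ} (hn : 5 ≤ n) : 5 * n < 2 ^ n := by
  induction n, hn using Nat.le_induction with
  | base => norm_num
  | succ n hn ih => rw [pow_succ]; omega

open Classical in
/-- The nodes where a dyadic vector has coordinate `2 ^ i`. -/
def level {n : ℕ} (l : Fin n → ℕ) (i : ℕ) : Finset (Fin n) :=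
  Finset.univ.filter fun v => l v = i + 1

theorem sum_level_le {n : ℕ} {l : Fin n → ℕ} (hl : IsDyadicVector l) (B : ℕ) :
    ∑ i ∈ Finset.range B, ((level l i).card : ℝ) * 4 ^ i ≤ 5 * n := by
  classical
  refine le_trans ?_ hl
  have h1 : ∀ i, ((level l i).card : ℝ) * 4 ^ i =
      ∑ v, if l v = i + 1 then dyadic (l v) ^ 2 else 0 := by
    intro i
    rw [← Finset.sum_filter, Finset.sum_congr rfl (g := fun _ => (4 : ℝ) ^ i)]
    · rw [Finset.sum_const, nsmul_eq_mul, level]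
    · intro v hv
      rw [(Finset.mem_filter.1 hv).2, dyadic, ← pow_mul, mul_comm, pow_mul]; norm_num
  simp only [h1]
  rw [Finset.sum_comm]
  refine Finset.sum_le_sum fun v _ => ?_
  cases hv : l v with
  | zero => simp [dyadic]
  | succ i =>
    simp only [add_left_inj]
    rw [Finset.sum_ite_eq (Finset.range B) i]
    split_ifs
    · rfl
    · positivity

theorem four_pow_le_of_level_nonempty {n : ℕ} {l : Fin n → ℕ} (hl : IsDyadicVector l) {i : ℕ}
    (hi : (level l i).Nonempty) : (4 : ℝ) ^ i ≤ 5 * n := by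
  have h := sum_level_le hl (i + 1)
  have h1 := Finset.single_le_sum (f := fun i => ((level l i).card : ℝ) * 4 ^ i)
    (fun i _ => by positivity) (Finset.mem_range.2 (Nat.lt_succ_self i))
  have h2 : (1 : ℝ) ≤ (level l i).card := by exact_mod_cast hi.card_pos
  have h3 : (0 : ℝ) < 4 ^ i := by positivity
  have h4 := h1.trans h
  nlinarith

/-- The pairs of levels that are not controlled by the degrees. -/
def Balanced (m i j : ℕ) : Prop := m < i + j ∧ i < j + m ∧ j < i + m

theorem Balanced.symm {m i j : ℕ} (h : Balanced m i j) : Balanced m j i :=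
  ⟨by have := h.1; omega, h.2.2, h.2.1⟩

open Classical in
theorem sum_balanced_le (m B j : ℕ) :
    ∑ i ∈ Finset.range B, (if Balanced m i j then (2 : ℝ) ^ (i + j) / ((i + j - m : ℕ) + 1) else 0)
      ≤ 4 * 2 ^ m * 4 ^ j / (j + 1) := by
  have h1 : ∑ i ∈ Finset.range B,
      (if Balanced m i j then (2 : ℝ) ^ (i + j) / ((i + j - m : ℕ) + 1) else 0) ≤
      2 ^ m * ∑ k ∈ Finset.range (2 * j), (2 : ℝ) ^ k / (k + 1) := by
    rw [← Finset.sum_filter, Finset.mul_sum]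
    have h2 : ∀ i ∈ (Finset.range B).filter (fun i => Balanced m i j),
        (2 : ℝ) ^ (i + j) / ((i + j - m : ℕ) + 1) =
        (fun k : ℕ => 2 ^ m * ((2 : ℝ) ^ k / (k + 1))) (i + j - m) := by
      intro i hi
      have h := (Finset.mem_filter.1 hi).2.1
      simp only
      rw [mul_div_assoc', ← pow_add]
      congr 2; omega
    rw [Finset.sum_congr rfl h2, ← Finset.sum_image (g := fun i => i + j - m)
      (f := fun k : ℕ => 2 ^ m * ((2 : ℝ) ^ k / (k + 1)))]
    · refine Finset.sum_le_sum_of_subset_of_nonneg ?_ fun k _ _ => by positivity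
      intro k hk
      obtain ⟨i, hi, rfl⟩ := Finset.mem_image.1 hk
      have h := (Finset.mem_filter.1 hi).2
      exact Finset.mem_range.2 (by have := h.1; have := h.2.1; omega)
    · intro i hi i' hi' h
      have h1 := (Finset.mem_filter.1 (Finset.mem_coe.1 hi)).2.1
      have h2 := (Finset.mem_filter.1 (Finset.mem_coe.1 hi')).2.1
      simp only at h
      omega
  refine h1.trans ?_
  have h2 := sum_two_pow_div_le (2 * j)
  rw [pow_mul] at h2
  norm_num at h2
  have h3 : (4 : ℝ) * 4 ^ j / (2 * j + 1) ≤ 4 * 4 ^ j / (j + 1) := by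
    have : (0 : ℝ) ≤ j := Nat.cast_nonneg j
    gcongr; linarith
  calc _ ≤ (2 : ℝ) ^ m * (4 * 4 ^ j / (j + 1)) := by gcongr; exact h2.trans h3
    _ = _ := by ring

theorem sum_level_entropy_le {n : ℕ} {l : Fin n → ℕ} (hl : IsDyadicVector l) (m B : ℕ) :
    ∑ j ∈ Finset.range B, (4 * 2 ^ m * 4 ^ j / (j + 1)) *
      (if (level l j).Nonempty then setEntropy n (level l j).card else 0) ≤ 61 * n * 2 ^ m := by
  have hn : (0 : ℝ) ≤ n := Nat.cast_nonneg n
  have h1 : ∀ j ∈ Finset.range B, (4 * 2 ^ m * 4 ^ j / (j + 1) : ℝ) *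
      (if (level l j).Nonempty then setEntropy n (level l j).card else 0) ≤
      4 * 2 ^ m * (3 * ((level l j).card * 4 ^ j) + n * (1 / 8 * (1 / 2) ^ j)) := by
    intro j _
    have hj : (0 : ℝ) ≤ j := Nat.cast_nonneg j
    split_ifs with h
    · have h2 := setEntropy_le h.card_pos (by simpa using Finset.card_le_univ (level l j)) j
      calc (4 * 2 ^ m * 4 ^ j / (j + 1) : ℝ) * setEntropy n (level l j).card
          ≤ (4 * 2 ^ m * 4 ^ j / (j + 1) : ℝ) *
            (3 * (j + 1) * (level l j).card + n * (1 / 8) ^ (j + 1)) := by gcongr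
        _ = 4 * 2 ^ m * (3 * ((level l j).card * 4 ^ j) +
            n * (4 ^ j * (1 / 8) ^ (j + 1)) / (j + 1)) := by field_simp
        _ ≤ 4 * 2 ^ m * (3 * ((level l j).card * 4 ^ j) + n * (1 / 8 * (1 / 2) ^ j)) := by
            gcongr
            have h3 : (4 : ℝ) ^ j * (1 / 8) ^ (j + 1) = 1 / 8 * (1 / 2) ^ j := by
              rw [pow_succ, ← mul_assoc, ← mul_pow]; norm_num; ring
            rw [h3]
            exact div_le_self (by positivity) (by linarith)
    · rw [mul_zero]; positivity
  refine (Finset.sum_le_sum h1).trans ?_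
  rw [← Finset.mul_sum, Finset.sum_add_distrib, ← Finset.mul_sum, ← Finset.mul_sum,
    ← Finset.mul_sum]
  have h2 := sum_level_le hl B
  have h3 := sum_geometric_two_le B
  have h4 : (n : ℝ) * (1 / 8 * ∑ i ∈ Finset.range B, (1 / 2 : ℝ) ^ i) ≤ n * (1 / 8 * 2) := by
    gcongr
  have hm : (0 : ℝ) < 2 ^ m := by positivity
  nlinarith

open Classical in
theorem heavy_levels_le {n : ℕ} (hn : 5 ≤ n) {A : Matrix (Fin n) (Fin n) ℕ} {a : ℝ} (ha : 0 ≤ a)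
    (hA : Discrepancy A a) {m : ℕ} (hm : n * a ≤ 4 * (2 ^ m) ^ 2) {l l' : Fin n → ℕ}
    (hl : IsDyadicVector l) (hl' : IsDyadicVector l') (B : ℕ) :
    ∑ i ∈ Finset.range B, ∑ j ∈ Finset.range B,
      (if Balanced m i j then 2 ^ (i + j) * crossSum A (level l i) (level l' j) else 0) ≤
      1132 * n * 2 ^ m := by
  have hn' : (0 : ℝ) < n := by exact_mod_cast (by omega : 0 < n)
  have hθ : (0 : ℝ) < 2 ^ m := by positivity
  set s : ℕ → ℝ := fun i => (level l i).card with hs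
  set u : ℕ → ℝ := fun j => (level l' j).card with hu
  set Ls : ℕ → ℝ := fun i => if (level l i).Nonempty then setEntropy n (level l i).card else 0
  set Lu : ℕ → ℝ := fun i => if (level l' i).Nonempty then setEntropy n (level l' i).card else 0
  have hL0 : ∀ (k : Fin n → ℕ) (i : ℕ),
      0 ≤ if (level k i).Nonempty then setEntropy n (level k i).card else 0 := by
    intro k i
    split_ifs with h
    · refine le_trans ?_ (log_le_setEntropy h.card_pos
        (by simpa using Finset.card_le_univ (level k i)))
      exact Real.log_nonneg (by exact_mod_cast (by omega : 1 ≤ n))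
    · rfl
  set q : ℕ → ℕ → ℝ := fun i j =>
    if Balanced m i j then (2 : ℝ) ^ (i + j) / ((i + j - m : ℕ) + 1) else 0 with hq
  have hq0 : ∀ i j, 0 ≤ q i j := fun i j => by simp only [hq]; split_ifs <;> positivity
  have key : ∀ i j, (if Balanced m i j then 2 ^ (i + j) * crossSum A (level l i) (level l' j)
      else 0) ≤ 4 * a / 2 ^ m * ((s i * 4 ^ i) * (u j * 4 ^ j)) + 6 * (q i j * Ls i) +
        6 * (q i j * Lu j) := by
    intro i j
    have hr : 0 ≤ 4 * a / 2 ^ m * ((s i * 4 ^ i) * (u j * 4 ^ j)) + 6 * (q i j * Ls i) +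
        6 * (q i j * Lu j) := by
      have h1 := mul_nonneg (hq0 i j) (hL0 l i)
      have h2 := mul_nonneg (hq0 i j) (hL0 l' j)
      have h3 : 0 ≤ 4 * a / 2 ^ m * ((s i * 4 ^ i) * (u j * 4 ^ j)) := by positivity
      linarith
    by_cases hB : Balanced m i j
    swap
    · rw [if_neg hB]; exact hr
    rw [if_pos hB]
    by_cases hne : (level l i).Nonempty ∧ (level l' j).Nonempty
    swap
    · have hz : crossSum A (level l i) (level l' j) = 0 := by
        rw [not_and_or, Finset.not_nonempty_iff_eq_empty, Finset.not_nonempty_iff_eq_empty] at hne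
        unfold crossSum upperSum
        rcases hne with h | h <;> simp [h]
      rw [hz, mul_zero]; exact hr
    obtain ⟨hS, hU⟩ := hne
    set k := i + j - m with hk
    have hkij : k + m = i + j := by have := hB.1; omega
    have hkn : k ≤ n := by
      have h1 := four_pow_le_of_level_nonempty hl hS
      have h2 := four_pow_le_of_level_nonempty hl' hU
      have h3 : ((2 : ℝ) ^ (i + j)) ^ 2 ≤ (5 * n) ^ 2 := by
        have h4 : ((2 : ℝ) ^ (i + j)) ^ 2 = 4 ^ i * 4 ^ j := by
          rw [← pow_mul, mul_comm, pow_mul, pow_add]; norm_num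
        rw [h4, sq]
        exact mul_le_mul h1 h2 (by positivity) (by positivity)
      have h5 : (2 : ℝ) ^ (i + j) ≤ 5 * n := le_of_sq_le_sq h3 (by positivity)
      have h6 : (5 * n : ℝ) < 2 ^ n := by exact_mod_cast five_mul_lt_two_pow hn
      have h7 : i + j < n := (pow_lt_pow_iff_right₀ (by norm_num : (1 : ℝ) < 2)).1 (h5.trans_lt h6)
      omega
    have h := hA _ _ hS hU k hkn
    have hk0 : (0 : ℝ) ≤ k := Nat.cast_nonneg k
    have hlog : (1 : ℝ) / 2 ≤ Real.log 2 := by linarith [Real.log_two_gt_d9]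
    have hX0 : 0 ≤ crossSum A (level l i) (level l' j) := by
      refine upperSum_nonneg fun v w _ => ?_
      split_ifs <;> positivity
    have hp : (2 : ℝ) ^ (i + j) = 2 ^ k * 2 ^ m := by rw [← hkij, pow_add]
    have h4 : (4 : ℝ) ^ i * 4 ^ j = 2 ^ (i + j) * (2 ^ k * 2 ^ m) := by
      rw [← hp, ← pow_add, ← sq, ← pow_mul, mul_comm, pow_mul]; norm_num
    have hLs : Ls i = setEntropy n (level l i).card := if_pos hS
    have hLu : Lu j = setEntropy n (level l' j).card := if_pos hU
    rw [← hLs, ← hLu] at h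
    have hLs0 : 0 ≤ Ls i := hL0 l i
    have hLu0 : 0 ≤ Lu j := hL0 l' j
    have h5 : (k + 1) * crossSum A (level l i) (level l' j) ≤
        4 * (a * s i * u j * 2 ^ k) + 6 * (Ls i + Lu j) := by
      have : (k + 1) * (1 / 2) * crossSum A (level l i) (level l' j) ≤
          (k + 1) * Real.log 2 * crossSum A (level l i) (level l' j) := by gcongr
      rw [pow_succ] at h
      simp only [hs, hu]
      linarith
    have h6 : crossSum A (level l i) (level l' j) ≤
        4 * (a * s i * u j * 2 ^ k) + 6 * (Ls i + Lu j) / (k + 1) := by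
      have h7 : 0 ≤ 4 * (a * s i * u j * 2 ^ k) := by positivity
      have h8 : crossSum A (level l i) (level l' j) ≤
        (4 * (a * s i * u j * 2 ^ k) + 6 * (Ls i + Lu j)) / (k + 1) := by
        rw [le_div_iff₀ (by linarith)]; linarith
      refine h8.trans ?_
      rw [add_div]
      gcongr
      exact div_le_self h7 (by linarith)
    have hqv : q i j = 2 ^ (i + j) / ((k : ℝ) + 1) := if_pos hB
    rw [hqv]
    refine (mul_le_mul_of_nonneg_left h6 (by positivity)).trans (le_of_eq ?_)
    have h9 : 4 * a / 2 ^ m * ((s i * 4 ^ i) * (u j * 4 ^ j)) =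
        4 * a / 2 ^ m * (s i * u j * (4 ^ i * 4 ^ j)) := by ring
    rw [h9, h4]
    field_simp
    ring
  refine (Finset.sum_le_sum fun i _ => Finset.sum_le_sum fun j _ => key i j).trans ?_
  simp only [Finset.sum_add_distrib, ← Finset.mul_sum]
  have e1 : ∑ i ∈ Finset.range B, s i * 4 ^ i * ∑ j ∈ Finset.range B, u j * 4 ^ j ≤
      (5 * n) * (5 * n) := by
    rw [← Finset.sum_mul]
    exact mul_le_mul (sum_level_le hl B) (sum_level_le hl' B)
      (Finset.sum_nonneg fun j _ => by positivity) (by positivity)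
  have e2 : ∑ i ∈ Finset.range B, ∑ j ∈ Finset.range B, q i j * Ls i ≤ 61 * n * 2 ^ m := by
    refine le_trans (Finset.sum_le_sum fun i _ => ?_) (sum_level_entropy_le hl m B)
    rw [← Finset.sum_mul]
    refine mul_le_mul_of_nonneg_right ?_ (hL0 l i)
    refine le_trans (le_of_eq (Finset.sum_congr rfl fun j _ => ?_)) (sum_balanced_le m B i)
    simp only [hq, add_comm i j]
    have : Balanced m i j ↔ Balanced m j i := ⟨Balanced.symm, Balanced.symm⟩
    simp only [this]
  have e3 : ∑ i ∈ Finset.range B, ∑ j ∈ Finset.range B, q i j * Lu j ≤ 61 * n * 2 ^ m := by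
    rw [Finset.sum_comm]
    refine le_trans (Finset.sum_le_sum fun j _ => ?_) (sum_level_entropy_le hl' m B)
    rw [← Finset.sum_mul]
    exact mul_le_mul_of_nonneg_right (sum_balanced_le m B j) (hL0 l' j)
  have e4 : 4 * a / 2 ^ m * ((5 * n) * (5 * n)) ≤ 400 * n * 2 ^ m := by
    rw [div_mul_eq_mul_div, div_le_iff₀ hθ]
    nlinarith
  have e5 := mul_le_mul_of_nonneg_left e1 (show 0 ≤ 4 * a / 2 ^ m by positivity)
  linarith

/-- A vector of levels that is `0` outside `Γ`. -/
def SupportedOn {n : ℕ} {β : Type*} [Zero β] (Γ : Finset (Fin n)) (x : Fin n → β) : Prop :=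
  ∀ v, v ∉ Γ → x v = 0

theorem sum_ratio_le {n : ℕ} {A : Matrix (Fin n) (Fin n) ℕ} {Γ : Finset (Fin n)} {Δ θ : ℝ}
    (hθ : 0 < θ) (hΔ : 0 ≤ Δ) (hdeg : ∀ v ∈ Γ, ∑ w, (A v w : ℝ) ≤ Δ) {l : Fin n → ℕ}
    (hl : IsDyadicVector l) (hΓ : SupportedOn Γ l) :
    ∑ v, ∑ w, dyadic (l v) ^ 2 / θ * (A v w : ℝ) ≤ 5 * n * (Δ / θ) := by
  have h1 : ∀ v, ∑ w, dyadic (l v) ^ 2 / θ * (A v w : ℝ) ≤ dyadic (l v) ^ 2 * (Δ / θ) := by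
    intro v
    rw [← Finset.mul_sum]
    by_cases hv : v ∈ Γ
    · calc dyadic (l v) ^ 2 / θ * ∑ w, (A v w : ℝ) ≤ dyadic (l v) ^ 2 / θ * Δ := by
            gcongr; exact hdeg v hv
        _ = _ := by ring
    · rw [hΓ v hv]; simp [dyadic]
  refine (Finset.sum_le_sum fun v _ => h1 v).trans ?_
  rw [← Finset.sum_mul]
  exact mul_le_mul_of_nonneg_right hl (by positivity)

theorem heavySum_le {n : ℕ} (hn : 5 ≤ n) {A : Matrix (Fin n) (Fin n) ℕ} (hs : A.IsSymm)
    {a : ℝ} (ha : 0 ≤ a) (hA : Discrepancy A a) {m : ℕ} (hm : n * a ≤ 4 * (2 ^ m) ^ 2)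
    {Γ : Finset (Fin n)} {C : ℝ} (hC : 0 ≤ C)
    (hdeg : ∀ v ∈ Γ, ∑ w, (A v w : ℝ) ≤ C * (n * a)) {l l' : Fin n → ℕ}
    (hl : IsDyadicVector l) (hl' : IsDyadicVector l') (hΓ : SupportedOn Γ l)
    (hΓ' : SupportedOn Γ l') :
    (upperSum fun v w => if dyadic (l v) * dyadic (l' w) ≤ 2 ^ m then 0 else
      dyadic (l v) * dyadic (l' w) * (A v w : ℝ)) ≤ (40 * C + 1132) * n * 2 ^ m := by
  classical
  have hθ : (0 : ℝ) < 2 ^ m := by positivity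
  set B := n + 4
  have hpt : ∀ v w, v < w → (if dyadic (l v) * dyadic (l' w) ≤ 2 ^ m then 0 else
      dyadic (l v) * dyadic (l' w) * (A v w : ℝ)) ≤
      dyadic (l v) ^ 2 / 2 ^ m * (A v w : ℝ) + dyadic (l' w) ^ 2 / 2 ^ m * (A v w : ℝ) +
      ∑ i ∈ Finset.range B, ∑ j ∈ Finset.range B,
        (if Balanced m i j then 2 ^ (i + j) *
          (if v ∈ level l i ∧ w ∈ level l' j then (A v w : ℝ) else 0) else 0) := by
    intro v w _
    have hsum0 : 0 ≤ ∑ i ∈ Finset.range B, ∑ j ∈ Finset.range B,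
        (if Balanced m i j then 2 ^ (i + j) *
          (if v ∈ level l i ∧ w ∈ level l' j then (A v w : ℝ) else 0) else 0) := by
      refine Finset.sum_nonneg fun i _ => Finset.sum_nonneg fun j _ => ?_
      split_ifs <;> positivity
    have hA0 : (0 : ℝ) ≤ A v w := Nat.cast_nonneg _
    have h1 : 0 ≤ dyadic (l v) ^ 2 / 2 ^ m * (A v w : ℝ) := by positivity
    have h2 : 0 ≤ dyadic (l' w) ^ 2 / 2 ^ m * (A v w : ℝ) := by positivity
    split_ifs with h
    · linarith
    push Not at h
    have hx := dyadic_nonneg (l v)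
    have hy := dyadic_nonneg (l' w)
    by_cases hc1 : 2 ^ m * dyadic (l' w) ≤ dyadic (l v)
    · have : dyadic (l v) * dyadic (l' w) ≤ dyadic (l v) ^ 2 / 2 ^ m := by
        rw [le_div_iff₀ hθ]; nlinarith
      have := mul_le_mul_of_nonneg_right this hA0
      linarith
    by_cases hc2 : 2 ^ m * dyadic (l v) ≤ dyadic (l' w)
    · have : dyadic (l v) * dyadic (l' w) ≤ dyadic (l' w) ^ 2 / 2 ^ m := by
        rw [le_div_iff₀ hθ]; nlinarith
      have := mul_le_mul_of_nonneg_right this hA0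
      linarith
    push Not at hc1 hc2
    obtain ⟨i, hi⟩ : ∃ i, l v = i + 1 := by
      rcases hv : l v with _ | i
      · rw [hv] at h; simp only [dyadic, zero_mul] at h; linarith
      · exact ⟨i, rfl⟩
    obtain ⟨j, hj⟩ : ∃ j, l' w = j + 1 := by
      rcases hw : l' w with _ | j
      · rw [hw] at h; simp only [dyadic, mul_zero] at h; linarith
      · exact ⟨j, rfl⟩
    have hiB : i < B := by have := hl.lt v; omega
    have hjB : j < B := by have := hl'.lt w; omega
    simp only [hi, hj, dyadic, ← pow_add] at h hc1 hc2 h1 h2 ⊢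
    have h12 : (1 : ℝ) < 2 := by norm_num
    rw [pow_lt_pow_iff_right₀ h12] at h hc1 hc2
    have hbal : Balanced m i j := ⟨h, by omega, by omega⟩
    have hv : v ∈ level l i := by simp [level, hi]
    have hw : w ∈ level l' j := by simp [level, hj]
    have h3 : (2 : ℝ) ^ (i + j) * (A v w : ℝ) ≤ ∑ i ∈ Finset.range B, ∑ j ∈ Finset.range B,
        (if Balanced m i j then 2 ^ (i + j) *
          (if v ∈ level l i ∧ w ∈ level l' j then (A v w : ℝ) else 0) else 0) := by
      have hnn : ∀ i j, 0 ≤ (if Balanced m i j then 2 ^ (i + j) *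
          (if v ∈ level l i ∧ w ∈ level l' j then (A v w : ℝ) else 0) else 0) := by
        intro i j; split_ifs <;> positivity
      refine le_trans ?_ (Finset.single_le_sum (fun i _ => Finset.sum_nonneg fun j _ => hnn i j)
        (Finset.mem_range.2 hiB))
      refine le_trans (le_of_eq ?_) (Finset.single_le_sum (fun j _ => hnn i j)
        (Finset.mem_range.2 hjB))
      rw [if_pos hbal, if_pos ⟨hv, hw⟩]
    linarith
  have hna : (0 : ℝ) ≤ n * a := by positivity
  refine (upperSum_mono hpt).trans ?_
  rw [upperSum_add, upperSum_add]
  have e1 : (upperSum fun v w => dyadic (l v) ^ 2 / 2 ^ m * (A v w : ℝ)) ≤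
      5 * n * (C * (n * a) / 2 ^ m) :=
    (upperSum_le_sum fun v w => by positivity).trans
      (sum_ratio_le hθ (by positivity) hdeg hl hΓ)
  have e2 : (upperSum fun v w => dyadic (l' w) ^ 2 / 2 ^ m * (A v w : ℝ)) ≤
      5 * n * (C * (n * a) / 2 ^ m) := by
    refine (upperSum_le_sum fun v w => by positivity).trans ?_
    rw [Finset.sum_comm]
    have := sum_ratio_le hθ (by positivity) hdeg hl' hΓ'
    refine le_trans (le_of_eq ?_) this
    refine Finset.sum_congr rfl fun w _ => Finset.sum_congr rfl fun v _ => ?_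
    rw [hs.apply]
  have e3 : (upperSum fun v w => ∑ i ∈ Finset.range B, ∑ j ∈ Finset.range B,
        (if Balanced m i j then 2 ^ (i + j) *
          (if v ∈ level l i ∧ w ∈ level l' j then (A v w : ℝ) else 0) else 0)) =
      ∑ i ∈ Finset.range B, ∑ j ∈ Finset.range B,
      (if Balanced m i j then 2 ^ (i + j) * crossSum A (level l i) (level l' j) else 0) := by
    have hsum : ∀ (s : Finset ℕ) (G : ℕ → Fin n → Fin n → ℝ),
        (upperSum fun v w => ∑ i ∈ s, G i v w) = ∑ i ∈ s, upperSum (G i) := by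
      intro s G
      induction s using Finset.induction_on with
      | empty => simp [upperSum]
      | insert i s hi ih =>
        simp only [Finset.sum_insert hi]
        rw [upperSum_add, ih]
    rw [hsum]
    refine Finset.sum_congr rfl fun i _ => ?_
    rw [hsum]
    refine Finset.sum_congr rfl fun j _ => ?_
    split_ifs
    · rw [crossSum, ← upperSum_const_mul]
    · simp [upperSum]
  have e4 := heavy_levels_le hn ha hA hm hl hl' B
  have e5 : 5 * n * (C * (n * a) / 2 ^ m) ≤ 20 * C * n * 2 ^ m := by
    rw [mul_div_assoc', div_le_iff₀ hθ]
    have : 0 ≤ 5 * n * C := by positivity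
    nlinarith [mul_le_mul_of_nonneg_left hm this]
  rw [e3]
  linarith

/-- The difference of the observation matrix and its mean, zero on the diagonal. -/
def deviation {n : ℕ} (A : Matrix (Fin n) (Fin n) ℕ) (R : Fin n → Fin n → ℝ) (v w : Fin n) : ℝ :=
  if v = w then 0 else (A v w : ℝ) - R v w

theorem abs_upperSum_dyadic_le {n : ℕ} (hn : 5 ≤ n) {A : Matrix (Fin n) (Fin n) ℕ}
    (hs : A.IsSymm) {R : Fin n → Fin n → ℝ} {a : ℝ} (hR0 : ∀ v w, 0 ≤ R v w)
    (hR : ∀ v w, R v w ≤ a) (hA : Discrepancy A a) {m : ℕ} (hm : n * a ≤ 4 * (2 ^ m) ^ 2)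
    (hlight : LightBound A R (2 ^ m)) {Γ : Finset (Fin n)} {C : ℝ} (hC : 0 ≤ C)
    (hdeg : ∀ v ∈ Γ, ∑ w, (A v w : ℝ) ≤ C * (n * a)) {l l' : Fin n → ℕ}
    (hl : IsDyadicVector l) (hl' : IsDyadicVector l') (hΓ : SupportedOn Γ l)
    (hΓ' : SupportedOn Γ l') :
    |upperSum fun v w => dyadic (l v) * dyadic (l' w) * ((A v w : ℝ) - R v w)| ≤
      (40 * C + 1346) * n * 2 ^ m := by
  have hθ : (0 : ℝ) < 2 ^ m := by positivity
  have hn' : (0 : ℝ) < n := by exact_mod_cast (by omega : 0 < n)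
  have ha : 0 ≤ a := (hR0 ⟨0, by omega⟩ ⟨0, by omega⟩).trans (hR _ _)
  have h1 := hlight l l' hl hl'
  have h2 := heavySum_le hn hs ha hA hm hC hdeg hl hl' hΓ hΓ'
  have h20 : 0 ≤ upperSum fun v w => if dyadic (l v) * dyadic (l' w) ≤ 2 ^ m then 0 else
      dyadic (l v) * dyadic (l' w) * (A v w : ℝ) := by
    refine upperSum_nonneg fun v w _ => ?_
    have := mul_nonneg (dyadic_nonneg (l v)) (dyadic_nonneg (l' w))
    split_ifs <;> positivity
  have h3 : (upperSum fun v w => if dyadic (l v) * dyadic (l' w) ≤ 2 ^ m then 0 else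
      dyadic (l v) * dyadic (l' w) * R v w) ≤ 100 * n * 2 ^ m := by
    have h4 : (upperSum fun v w => if dyadic (l v) * dyadic (l' w) ≤ 2 ^ m then 0 else
        dyadic (l v) * dyadic (l' w) * R v w) ≤
        ∑ v, ∑ w, dyadic (l v) ^ 2 * dyadic (l' w) ^ 2 * (a / 2 ^ m) := by
      refine (upperSum_mono fun v w _ => ?_).trans (upperSum_le_sum fun v w => by positivity)
      have h0 := mul_nonneg (dyadic_nonneg (l v)) (dyadic_nonneg (l' w))
      split_ifs with h
      · positivity
      · push Not at h
        rw [mul_div_assoc', le_div_iff₀ hθ]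
        calc dyadic (l v) * dyadic (l' w) * R v w * 2 ^ m
            ≤ dyadic (l v) * dyadic (l' w) * a * (dyadic (l v) * dyadic (l' w)) := by
              gcongr; exact hR v w
          _ = _ := by ring
    refine h4.trans ?_
    rw [Finset.sum_congr rfl fun v _ => (Finset.sum_mul _ _ _).symm, ← Finset.sum_mul,
      ← Finset.sum_mul_sum]
    have h5 : (∑ v, dyadic (l v) ^ 2) * ∑ w, dyadic (l' w) ^ 2 ≤ (5 * n) * (5 * n) :=
      mul_le_mul hl hl' (Finset.sum_nonneg fun _ _ => sq_nonneg _) (by positivity)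
    refine (mul_le_mul_of_nonneg_right h5 (by positivity)).trans ?_
    rw [mul_div_assoc', div_le_iff₀ hθ]
    nlinarith
  have h30 : 0 ≤ upperSum fun v w => if dyadic (l v) * dyadic (l' w) ≤ 2 ^ m then 0 else
      dyadic (l v) * dyadic (l' w) * R v w := by
    refine upperSum_nonneg fun v w _ => ?_
    have := mul_nonneg (mul_nonneg (dyadic_nonneg (l v)) (dyadic_nonneg (l' w))) (hR0 v w)
    split_ifs
    · rfl
    · exact this
  have hsplit : (upperSum fun v w => dyadic (l v) * dyadic (l' w) * ((A v w : ℝ) - R v w)) =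
      (upperSum fun v w => if dyadic (l v) * dyadic (l' w) ≤ 2 ^ m then
        dyadic (l v) * dyadic (l' w) * ((A v w : ℝ) - R v w) else 0) +
      ((upperSum fun v w => if dyadic (l v) * dyadic (l' w) ≤ 2 ^ m then 0 else
        dyadic (l v) * dyadic (l' w) * (A v w : ℝ)) -
      upperSum fun v w => if dyadic (l v) * dyadic (l' w) ≤ 2 ^ m then 0 else
        dyadic (l v) * dyadic (l' w) * R v w) := by
    rw [← upperSum_sub, ← upperSum_add]
    refine upperSum_congr fun v w _ => ?_
    split_ifs <;> ring
  rw [hsplit, abs_le]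
  obtain ⟨h5, h6⟩ := abs_le.1 h1
  have h7 : 0 ≤ 40 * C * n * 2 ^ m := by positivity
  have h8 : 0 ≤ (n : ℝ) * 2 ^ m := by positivity
  constructor <;> nlinarith

theorem sum_deviation_eq {n : ℕ} {A : Matrix (Fin n) (Fin n) ℕ} (hs : A.IsSymm)
    {R : Fin n → Fin n → ℝ} (hR : ∀ v w, R v w = R w v) (x y : Fin n → ℝ) :
    ∑ v, ∑ w, x v * deviation A R v w * y w =
      (upperSum fun v w => x v * y w * ((A v w : ℝ) - R v w)) +
        upperSum fun v w => y v * x w * ((A v w : ℝ) - R v w) := by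
  have h2 : (upperSum fun v w => y v * x w * ((A v w : ℝ) - R v w)) =
      ∑ v, ∑ w, if w < v then y w * x v * ((A v w : ℝ) - R v w) else 0 := by
    rw [upperSum, Finset.sum_comm]
    refine Finset.sum_congr rfl fun v _ => Finset.sum_congr rfl fun w _ => ?_
    rw [hs.apply, hR]
  rw [h2, upperSum, ← Finset.sum_add_distrib]
  refine Finset.sum_congr rfl fun v _ => ?_
  rw [← Finset.sum_add_distrib]
  refine Finset.sum_congr rfl fun w _ => ?_
  rw [deviation]
  rcases lt_trichotomy v w with h | h | h
  · simp only [h, h.ne, h.not_gt, if_true, if_false, add_zero]; ring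
  · simp [h]
  · simp only [h, h.ne', h.not_gt, if_true, if_false, zero_add]; ring

/-! ### Rounding to dyadic vectors -/

theorem exists_dyadic_near {r : ℝ} (hr : 0 ≤ r) : ∃ i j, dyadic i ≤ r ∧ r ≤ dyadic j ∧
    dyadic i ^ 2 ≤ 1 + 4 * r ^ 2 ∧ dyadic j ^ 2 ≤ 1 + 4 * r ^ 2 ∧ (r = 0 → i = 0 ∧ j = 0) := by
  rcases hr.eq_or_lt with rfl | hr
  · exact ⟨0, 0, by simp [dyadic]⟩
  rcases le_or_gt r 1 with h1 | h1
  · refine ⟨0, 1, ?_⟩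
    simp only [dyadic]
    refine ⟨hr.le, by simpa using h1, by nlinarith, by nlinarith, fun h => absurd h hr.ne'⟩
  · obtain ⟨k, hk1, hk2⟩ := exists_nat_pow_near h1.le (by norm_num : (1 : ℝ) < 2)
    refine ⟨k + 1, k + 2, hk1, hk2.le, ?_, ?_, fun h => absurd h hr.ne'⟩
    · simp only [dyadic]
      have : (0 : ℝ) < 2 ^ k := by positivity
      nlinarith
    · simp only [dyadic]
      have : (0 : ℝ) < 2 ^ k := by positivity
      rw [pow_succ (2 : ℝ) k]
      nlinarith

theorem exists_dyadicVector_ge {n : ℕ} {Γ : Finset (Fin n)} {x : Fin n → ℝ} (hx : ∀ v, 0 ≤ x v)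
    (hxn : ∑ v, x v ^ 2 ≤ n) (hΓ : SupportedOn Γ x) (c : Fin n → ℝ) :
    ∃ l : Fin n → ℕ, IsDyadicVector l ∧ SupportedOn Γ l ∧
      ∑ v, x v * c v ≤ ∑ v, dyadic (l v) * c v := by
  choose i j hi hj hi2 hj2 h0 using fun v => exists_dyadic_near (hx v)
  refine ⟨fun v => if 0 ≤ c v then j v else i v, ?_, ?_, ?_⟩
  · have h1 : ∀ v, dyadic (if 0 ≤ c v then j v else i v) ^ 2 ≤ 1 + 4 * x v ^ 2 := by
      intro v; split_ifs
      · exact hj2 v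
      · exact hi2 v
    refine (Finset.sum_le_sum fun v _ => h1 v).trans ?_
    rw [Finset.sum_add_distrib, ← Finset.mul_sum]
    simp only [Finset.sum_const, Finset.card_univ, Fintype.card_fin, nsmul_eq_mul, mul_one]
    linarith
  · intro v hv
    have := h0 v (hΓ v hv)
    simp only [this.1, this.2, ite_self]
  · refine Finset.sum_le_sum fun v _ => ?_
    simp only
    split_ifs with h
    · exact mul_le_mul_of_nonneg_right (hj v) h
    · exact mul_le_mul_of_nonpos_right (hi v) (not_le.1 h).le

theorem bilin_le_of_dyadic {n : ℕ} {Γ : Finset (Fin n)} {B : Fin n → Fin n → ℝ} {c : ℝ}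
    (h : ∀ l l' : Fin n → ℕ, IsDyadicVector l → IsDyadicVector l' → SupportedOn Γ l →
      SupportedOn Γ l' → ∑ v, ∑ w, dyadic (l v) * B v w * dyadic (l' w) ≤ c)
    {x y : Fin n → ℝ} (hx : ∀ v, 0 ≤ x v) (hy : ∀ v, 0 ≤ y v) (hxn : ∑ v, x v ^ 2 ≤ n)
    (hyn : ∑ v, y v ^ 2 ≤ n) (hxΓ : SupportedOn Γ x) (hyΓ : SupportedOn Γ y) :
    ∑ v, ∑ w, x v * B v w * y w ≤ c := by
  obtain ⟨l, hl, hlΓ, h1⟩ := exists_dyadicVector_ge hx hxn hxΓ fun v => ∑ w, B v w * y w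
  obtain ⟨l', hl', hlΓ', h2⟩ := exists_dyadicVector_ge hy hyn hyΓ
    fun w => ∑ v, dyadic (l v) * B v w
  have e1 : ∑ v, ∑ w, x v * B v w * y w = ∑ v, x v * ∑ w, B v w * y w := by
    simp only [Finset.mul_sum, mul_assoc]
  have e2 : ∑ v, dyadic (l v) * ∑ w, B v w * y w = ∑ w, y w * ∑ v, dyadic (l v) * B v w := by
    simp only [Finset.mul_sum]
    rw [Finset.sum_comm]
    exact Finset.sum_congr rfl fun w _ => Finset.sum_congr rfl fun v _ => by ring
  have e3 : ∑ w, dyadic (l' w) * ∑ v, dyadic (l v) * B v w =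
      ∑ v, ∑ w, dyadic (l v) * B v w * dyadic (l' w) := by
    simp only [Finset.mul_sum]
    rw [Finset.sum_comm]
    exact Finset.sum_congr rfl fun w _ => Finset.sum_congr rfl fun v _ => by ring
  rw [e1]
  refine h1.trans ?_
  rw [e2]
  refine h2.trans ?_
  rw [e3]
  exact h l l' hl hl' hlΓ hlΓ'

/-- The bilinear form of `B` has norm at most `ν` on the vectors supported on `Γ`. -/
def NormBound {n : ℕ} (Γ : Finset (Fin n)) (B : Fin n → Fin n → ℝ) (ν : ℝ) : Prop :=
  ∀ x y : Fin n → ℝ, SupportedOn Γ x → SupportedOn Γ y →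
    |∑ v, ∑ w, x v * B v w * y w| ≤ ν * √(∑ v, x v ^ 2) * √(∑ v, y v ^ 2)

theorem normBound_of_dyadic {n : ℕ} (hn : 0 < n) {Γ : Finset (Fin n)} {B : Fin n → Fin n → ℝ}
    {c : ℝ} (h : ∀ l l' : Fin n → ℕ, IsDyadicVector l → IsDyadicVector l' → SupportedOn Γ l →
      SupportedOn Γ l' → |∑ v, ∑ w, dyadic (l v) * B v w * dyadic (l' w)| ≤ c * n) :
    NormBound Γ B (4 * c) := by
  have hn' : (0 : ℝ) < n := by exact_mod_cast hn
  have hneg : ∀ x y : Fin n → ℝ, ∑ v, ∑ w, x v * (-B v w) * y w =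
      -∑ v, ∑ w, x v * B v w * y w := by
    intro x y; simp only [mul_neg, neg_mul, Finset.sum_neg_distrib]
  have hpos : ∀ x y : Fin n → ℝ, (∀ v, 0 ≤ x v) → (∀ v, 0 ≤ y v) → ∑ v, x v ^ 2 ≤ n →
      ∑ v, y v ^ 2 ≤ n → SupportedOn Γ x → SupportedOn Γ y →
      |∑ v, ∑ w, x v * B v w * y w| ≤ c * n := by
    intro x y hx hy hxn hyn hxΓ hyΓ
    refine abs_le'.2 ⟨?_, ?_⟩
    · exact bilin_le_of_dyadic (fun l l' h1 h2 h3 h4 => (le_abs_self _).trans (h l l' h1 h2 h3 h4))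
        hx hy hxn hyn hxΓ hyΓ
    · rw [← hneg]
      refine bilin_le_of_dyadic (fun l l' h1 h2 h3 h4 => ?_) hx hy hxn hyn hxΓ hyΓ
      rw [hneg]
      exact (neg_le_abs _).trans (h l l' h1 h2 h3 h4)
  have hunit : ∀ x y : Fin n → ℝ, ∑ v, x v ^ 2 ≤ n → ∑ v, y v ^ 2 ≤ n → SupportedOn Γ x →
      SupportedOn Γ y → |∑ v, ∑ w, x v * B v w * y w| ≤ 4 * (c * n) := by
    intro x y hxn hyn hxΓ hyΓ
    have hp : ∀ z : Fin n → ℝ, ∑ v, z v ^ 2 ≤ n → SupportedOn Γ z →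
        ∑ v, max (z v) 0 ^ 2 ≤ (n : ℝ) ∧ SupportedOn Γ fun v => max (z v) 0 := by
      intro z hz hΓ
      refine ⟨(Finset.sum_le_sum fun v _ => ?_).trans hz, fun v hv => by simp [hΓ v hv]⟩
      rcases le_total (z v) 0 with h | h
      · rw [max_eq_right h]; nlinarith [sq_nonneg (z v)]
      · rw [max_eq_left h]
    have hxm : ∑ v, (-x v) ^ 2 ≤ (n : ℝ) := by simpa using hxn
    have hym : ∑ v, (-y v) ^ 2 ≤ (n : ℝ) := by simpa using hyn
    have hxmΓ : SupportedOn Γ fun v => -x v := fun v hv => by simp [hxΓ v hv]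
    have hymΓ : SupportedOn Γ fun v => -y v := fun v hv => by simp [hyΓ v hv]
    have m0 : ∀ z : Fin n → ℝ, ∀ v, 0 ≤ max (z v) 0 := fun z v => le_max_right _ _
    have h1 := hpos _ _ (m0 x) (m0 y) (hp x hxn hxΓ).1 (hp y hyn hyΓ).1 (hp x hxn hxΓ).2
      (hp y hyn hyΓ).2
    have h2 := hpos _ _ (m0 x) (m0 fun v => -y v) (hp x hxn hxΓ).1 (hp _ hym hymΓ).1
      (hp x hxn hxΓ).2 (hp _ hym hymΓ).2
    have h3 := hpos _ _ (m0 fun v => -x v) (m0 y) (hp _ hxm hxmΓ).1 (hp y hyn hyΓ).1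
      (hp _ hxm hxmΓ).2 (hp y hyn hyΓ).2
    have h4 := hpos _ _ (m0 fun v => -x v) (m0 fun v => -y v) (hp _ hxm hxmΓ).1
      (hp _ hym hymΓ).1 (hp _ hxm hxmΓ).2 (hp _ hym hymΓ).2
    have hd : ∀ r : ℝ, r = max r 0 - max (-r) 0 := by
      intro r
      rcases le_total r 0 with h | h
      · rw [max_eq_right h, max_eq_left (by linarith)]; ring
      · rw [max_eq_left h, max_eq_right (by linarith)]; ring
    have e : ∑ v, ∑ w, x v * B v w * y w =
        ((∑ v, ∑ w, max (x v) 0 * B v w * max (y w) 0) -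
          ∑ v, ∑ w, max (x v) 0 * B v w * max (-y w) 0) -
        ((∑ v, ∑ w, max (-x v) 0 * B v w * max (y w) 0) -
          ∑ v, ∑ w, max (-x v) 0 * B v w * max (-y w) 0) := by
      simp only [← Finset.sum_sub_distrib]
      refine Finset.sum_congr rfl fun v _ => Finset.sum_congr rfl fun w _ => ?_
      conv_lhs => rw [hd (x v), hd (y w)]
      ring
    rw [e, abs_le]
    rw [abs_le] at h1 h2 h3 h4
    constructor <;> linarith [h1.1, h1.2, h2.1, h2.2, h3.1, h3.2, h4.1, h4.2]
  intro x y hxΓ hyΓ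
  have hzero : ∀ z : Fin n → ℝ, √(∑ v, z v ^ 2) = 0 → ∀ v, z v = 0 := by
    intro z hz v
    rw [Real.sqrt_eq_zero (Finset.sum_nonneg fun v _ => sq_nonneg _)] at hz
    exact pow_eq_zero_iff (two_ne_zero) |>.1
      ((Finset.sum_eq_zero_iff_of_nonneg fun v _ => sq_nonneg _).1 hz v (Finset.mem_univ v))
  rcases eq_or_ne (√(∑ v, x v ^ 2)) 0 with hx0 | hx0
  · rw [hx0]; simp [hzero x hx0]
  rcases eq_or_ne (√(∑ v, y v ^ 2)) 0 with hy0 | hy0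
  · rw [hy0]; simp [hzero y hy0]
  set X := √(∑ v, x v ^ 2) with hX
  set Y := √(∑ v, y v ^ 2) with hY
  have hXp : 0 < X := lt_of_le_of_ne (Real.sqrt_nonneg _) hx0.symm
  have hYp : 0 < Y := lt_of_le_of_ne (Real.sqrt_nonneg _) hy0.symm
  have hX2 : ∑ v, x v ^ 2 = X ^ 2 := (Real.sq_sqrt (Finset.sum_nonneg fun v _ => sq_nonneg _)).symm
  have hY2 : ∑ v, y v ^ 2 = Y ^ 2 := (Real.sq_sqrt (Finset.sum_nonneg fun v _ => sq_nonneg _)).symm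
  have hsn : 0 < √(n : ℝ) := Real.sqrt_pos.2 hn'
  have hsn2 : √(n : ℝ) ^ 2 = n := Real.sq_sqrt hn'.le
  have hnorm : ∀ (z : Fin n → ℝ) (Z : ℝ), 0 < Z → ∑ v, z v ^ 2 = Z ^ 2 →
      ∑ v, (√(n : ℝ) / Z * z v) ^ 2 ≤ (n : ℝ) := by
    intro z Z hZ hz
    simp only [mul_pow]
    rw [← Finset.mul_sum, hz, div_pow, hsn2]
    field_simp
    rfl
  have h1 := hunit (fun v => √(n : ℝ) / X * x v) (fun v => √(n : ℝ) / Y * y v)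
    (hnorm x X hXp hX2) (hnorm y Y hYp hY2) (fun v hv => by simp [hxΓ v hv])
    (fun v hv => by simp [hyΓ v hv])
  have e : ∑ v, ∑ w, √(n : ℝ) / X * x v * B v w * (√(n : ℝ) / Y * y w) =
      n / (X * Y) * ∑ v, ∑ w, x v * B v w * y w := by
    simp only [Finset.mul_sum]
    refine Finset.sum_congr rfl fun v _ => Finset.sum_congr rfl fun w _ => ?_
    have : (n : ℝ) / (X * Y) = √(n : ℝ) ^ 2 / (X * Y) := by rw [hsn2]
    rw [this]
    field_simp
  rw [e, abs_mul, abs_of_pos (by positivity), div_mul_eq_mul_div,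
    div_le_iff₀ (by positivity)] at h1
  have h2 : (n : ℝ) * |∑ v, ∑ w, x v * B v w * y w| ≤ n * (4 * c * X * Y) := by linarith
  exact le_of_mul_le_mul_left h2 hn'

theorem normBound_deviation {n : ℕ} (hn : 5 ≤ n) {A : Matrix (Fin n) (Fin n) ℕ}
    (hs : A.IsSymm) {R : Fin n → Fin n → ℝ} {a : ℝ} (hR0 : ∀ v w, 0 ≤ R v w)
    (hR : ∀ v w, R v w ≤ a) (hRs : ∀ v w, R v w = R w v) (hA : Discrepancy A a) {m : ℕ}
    (hm : n * a ≤ 4 * (2 ^ m) ^ 2)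
    (hlight : LightBound A R (2 ^ m)) {Γ : Finset (Fin n)} {C : ℝ} (hC : 0 ≤ C)
    (hdeg : ∀ v ∈ Γ, ∑ w, (A v w : ℝ) ≤ C * (n * a)) :
    NormBound Γ (deviation A R) (8 * (40 * C + 1346) * 2 ^ m) := by
  have h := normBound_of_dyadic (Γ := Γ) (B := deviation A R)
    (c := 2 * (40 * C + 1346) * 2 ^ m) (by omega) fun l l' hl hl' hΓ hΓ' => by
      rw [sum_deviation_eq hs hRs]
      refine (abs_add_le _ _).trans ?_
      have h1 := abs_upperSum_dyadic_le hn hs hR0 hR hA hm hlight hC hdeg hl hl' hΓ hΓ'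
      have h2 := abs_upperSum_dyadic_le hn hs hR0 hR hA hm hlight hC hdeg hl' hl hΓ' hΓ
      linarith
  have e : 4 * (2 * (40 * C + 1346) * 2 ^ m) = 8 * (40 * C + 1346) * 2 ^ m := by ring
  rwa [e] at h

/-! ### Degrees and trimming -/

theorem sum_clusterSize {n K : ℕ} (τ : Fin n → Fin K) : ∑ l, (clusterSize τ l : ℝ) = n := by
  classical
  have h := Finset.card_eq_sum_card_fiberwise (s := (Finset.univ : Finset (Fin n)))
    (t := (Finset.univ : Finset (Fin K))) (f := τ) (fun v _ => Finset.mem_univ (τ v))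
  rw [Finset.card_univ, Fintype.card_fin] at h
  simp only [clusterSize]
  exact_mod_cast h.symm

theorem sum_clusterDegree {n K : ℕ} (A : Matrix (Fin n) (Fin n) ℕ) (τ : Fin n → Fin K)
    (v : Fin n) : ∑ l, clusterDegree A τ v l = ∑ w, (A v w : ℝ) := by
  classical
  simp only [clusterDegree]
  exact Finset.sum_fiberwise _ _ _

theorem clusterMean_le {n K : ℕ} (τ : Fin n → Fin K) {a b : ℝ} (hab : b ≤ a) (v : Fin n)
    (l : Fin K) : clusterMean τ a b v l ≤ clusterSize τ l * a := by
  unfold clusterMean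
  gcongr
  split_ifs <;> linarith

theorem degree_le_of_not_deviates {n K : ℕ} {A : Matrix (Fin n) (Fin n) ℕ} {τ : Fin n → Fin K}
    {a b : ℝ} (hb : 0 ≤ b) (hab : b ≤ a) {v : Fin n} (hv : ¬ Deviates A τ a b v) :
    ∑ w, (A v w : ℝ) ≤ 7 / 5 * (n * a) := by
  have h : ∀ l, clusterDegree A τ v l ≤ clusterSize τ l * (7 / 5 * a) := by
    intro l
    have h1 : |clusterDegree A τ v l - clusterMean τ a b v l| ≤
        2 / 5 * clusterSize τ l * (a - b) := by
      by_contra h; exact hv ⟨l, not_le.1 h⟩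
    have h2 := clusterMean_le τ hab v l
    have h3 := (abs_le.1 h1).2
    have h4 : (0 : ℝ) ≤ clusterSize τ l := Nat.cast_nonneg _
    nlinarith
  rw [← sum_clusterDegree A τ v]
  refine (Finset.sum_le_sum fun l _ => h l).trans (le_of_eq ?_)
  rw [← Finset.sum_mul, sum_clusterSize]
  ring

open Classical in
/-- The set of the nodes that deviate. -/
def deviating {n K : ℕ} (A : Matrix (Fin n) (Fin n) ℕ) (τ : Fin n → Fin K) (a b : ℝ) :
    Finset (Fin n) := Finset.univ.filter (Deviates A τ a b)

theorem le_total {n K : ℕ} (hK : 0 < K) {A : Matrix (Fin n) (Fin n) ℕ} {τ : Fin n → Fin K}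
    {a b : ℝ} (hb : 0 ≤ b) (hab : b ≤ a)
    (hdev : ((deviating A τ a b).card : ℝ) ≤ n / (20 * K)) :
    n * (n * a) / (2 * K) ≤ total A := by
  classical
  have ha : 0 ≤ a := hb.trans hab
  have hK' : (0 : ℝ) < K := by exact_mod_cast hK
  have h1 : ∀ v ∉ deviating A τ a b, 3 / 5 * a * clusterSize τ (τ v) ≤ ∑ w, (A v w : ℝ) := by
    intro v hv
    have hv' : ¬ Deviates A τ a b v := fun h => hv (by simp [deviating, h])
    have h2 : |clusterDegree A τ v (τ v) - clusterMean τ a b v (τ v)| ≤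
        2 / 5 * clusterSize τ (τ v) * (a - b) := by
      by_contra h; exact hv' ⟨τ v, not_le.1 h⟩
    have h3 := (abs_le.1 h2).1
    have h4 : clusterDegree A τ v (τ v) ≤ ∑ w, (A v w : ℝ) :=
      Finset.sum_le_sum_of_subset_of_nonneg (Finset.subset_univ _) fun w _ _ => Nat.cast_nonneg _
    have h5 : clusterMean τ a b v (τ v) = clusterSize τ (τ v) * a := by simp [clusterMean]
    have h6 : (0 : ℝ) ≤ clusterSize τ (τ v) := Nat.cast_nonneg _
    rw [h5] at h3
    nlinarith
  have h2 : ∀ v, 3 / 5 * a * clusterSize τ (τ v) -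
      (if v ∈ deviating A τ a b then 3 / 5 * a * n else 0) ≤ ∑ w, (A v w : ℝ) := by
    intro v
    split_ifs with h
    · have h6 : (clusterSize τ (τ v) : ℝ) ≤ n := by
        have := Finset.card_le_univ (Finset.univ.filter fun w => τ w = τ v)
        rw [Fintype.card_fin] at this
        unfold clusterSize
        exact_mod_cast this
      have h7 : (0 : ℝ) ≤ ∑ w, (A v w : ℝ) := Finset.sum_nonneg fun w _ => Nat.cast_nonneg _
      have := mul_le_mul_of_nonneg_left h6 (show 0 ≤ 3 / 5 * a by positivity)
      linarith
    · rw [sub_zero]; exact h1 v h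
  have h3 : ∑ v, (clusterSize τ (τ v) : ℝ) = ∑ l, (clusterSize τ l : ℝ) ^ 2 := by
    rw [← Finset.sum_fiberwise Finset.univ τ]
    refine Finset.sum_congr rfl fun l _ => ?_
    rw [Finset.sum_congr rfl (g := fun _ => (clusterSize τ l : ℝ))]
    · rw [Finset.sum_const, nsmul_eq_mul, sq, clusterSize]
    · intro v hv; rw [(Finset.mem_filter.1 hv).2]
  have h4 : (n : ℝ) ^ 2 ≤ K * ∑ l, (clusterSize τ l : ℝ) ^ 2 := by
    have := sq_sum_le_card_mul_sum_sq (s := (Finset.univ : Finset (Fin K)))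
      (f := fun l => (clusterSize τ l : ℝ))
    rwa [sum_clusterSize, Finset.card_univ, Fintype.card_fin] at this
  have h5 := Finset.sum_le_sum fun v (_ : v ∈ Finset.univ) => h2 v
  rw [Finset.sum_sub_distrib, ← Finset.mul_sum, h3, Finset.sum_ite_mem, Finset.univ_inter,
    Finset.sum_const, nsmul_eq_mul] at h5
  refine le_trans ?_ h5
  have hn : (0 : ℝ) ≤ n := Nat.cast_nonneg n
  have h6 : (n : ℝ) ^ 2 / K ≤ ∑ l, (clusterSize τ l : ℝ) ^ 2 := by
    rw [div_le_iff₀ hK']; linarith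
  have h7 := mul_le_mul_of_nonneg_left h6 (show 0 ≤ 3 / 5 * a by positivity)
  have h8 := mul_le_mul_of_nonneg_right hdev (show 0 ≤ 3 / 5 * a * n by positivity)
  have h9 : (n : ℝ) * (n * a) / (2 * K) = 1 / 2 * (a * n ^ 2 / K) := by field_simp
  have h10 : (n : ℝ) / (20 * K) * (3 / 5 * a * n) = 3 / 100 * (a * n ^ 2 / K) := by
    field_simp; ring
  have h11 : 3 / 5 * a * ((n : ℝ) ^ 2 / K) = 3 / 5 * (a * n ^ 2 / K) := by ring
  have h12 : 0 ≤ a * (n : ℝ) ^ 2 / K := by positivity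
  rw [h9]
  linarith

theorem two_mul_crossSum_self {n : ℕ} {A : Matrix (Fin n) (Fin n) ℕ} (hs : A.IsSymm)
    (hd : ∀ v, A v v = 0) (W : Finset (Fin n)) :
    2 * crossSum A W W = ∑ v ∈ W, ∑ w ∈ W, (A v w : ℝ) := by
  classical
  have h1 : crossSum A W W =
      ∑ v, ∑ w, if w < v then (if v ∈ W ∧ w ∈ W then (A v w : ℝ) else 0) else 0 := by
    rw [crossSum, upperSum, Finset.sum_comm]
    refine Finset.sum_congr rfl fun v _ => Finset.sum_congr rfl fun w _ => ?_
    simp only [hs.apply, and_comm (a := w ∈ W)]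
  have h2 : ∑ v ∈ W, ∑ w ∈ W, (A v w : ℝ) =
      ∑ v, ∑ w, if v ∈ W ∧ w ∈ W then (A v w : ℝ) else 0 := by
    have h3 : ∀ v, (∑ w, if v ∈ W ∧ w ∈ W then (A v w : ℝ) else 0) =
        if v ∈ W then ∑ w ∈ W, (A v w : ℝ) else 0 := by
      intro v
      by_cases hv : v ∈ W
      · simp only [hv, true_and, if_true]
        rw [Finset.sum_ite_mem, Finset.univ_inter]
      · simp [hv]
    simp only [h3]
    rw [Finset.sum_ite_mem, Finset.univ_inter]
  rw [two_mul]
  nth_rw 2 [h1]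
  rw [h2, crossSum, upperSum, ← Finset.sum_add_distrib]
  refine Finset.sum_congr rfl fun v _ => ?_
  rw [← Finset.sum_add_distrib]
  refine Finset.sum_congr rfl fun w _ => ?_
  rcases lt_trichotomy v w with h | h | h
  · simp [h, h.not_gt]
  · simp [h, hd]
  · simp [h, h.not_gt]

theorem total_le {n : ℕ} (hn : 0 < n) {A : Matrix (Fin n) (Fin n) ℕ} (hs : A.IsSymm)
    (hd : ∀ v, A v v = 0) {a : ℝ} (hA : Discrepancy A a) (hna : 24 ≤ n * a) :
    total A ≤ 9 * n * (n * a) := by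
  have : Nonempty (Fin n) := ⟨⟨0, hn⟩⟩
  have hn' : (0 : ℝ) < n := by exact_mod_cast hn
  have h := hA Finset.univ Finset.univ Finset.univ_nonempty Finset.univ_nonempty 0 (Nat.zero_le _)
  have h1 := two_mul_crossSum_self hs hd Finset.univ
  have hlog := Real.log_two_gt_d9
  rw [Finset.card_univ, Fintype.card_fin, setEntropy, div_self hn'.ne', Real.log_one] at h
  norm_num at h
  have h2 : total A = 2 * crossSum A Finset.univ Finset.univ := h1.symm
  have hX : 0 ≤ crossSum A Finset.univ Finset.univ := by
    refine upperSum_nonneg fun v w _ => ?_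
    split_ifs <;> positivity
  rw [h2]
  nlinarith

theorem not_deviates_subset_kept {n K : ℕ} (hK : 0 < K) {A : Matrix (Fin n) (Fin n) ℕ}
    {τ : Fin n → Fin K} {a b : ℝ} (hb : 0 ≤ b) (hab : b ≤ a)
    (hdev : ((deviating A τ a b).card : ℝ) ≤ n / (20 * K)) {v : Fin n}
    (hv : v ∉ deviating A τ a b) : v ∈ kept K A := by
  classical
  have ha : 0 ≤ a := hb.trans hab
  have hn : (0 : ℝ) < n := by exact_mod_cast (Fin.pos v)
  have hK' : (0 : ℝ) < K := by exact_mod_cast hK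
  have hv' : ¬ Deviates A τ a b v := fun h => hv (by simp [deviating, h])
  have h1 := degree_le_of_not_deviates hb hab hv'
  have h2 := le_total hK hb hab hdev
  simp only [kept, Finset.mem_filter, Finset.mem_univ, true_and]
  refine h1.trans ?_
  have h3 : 5 * K * (n * (n * a) / (2 * K) / n) ≤ 5 * K * (total A / n) := by gcongr
  refine le_trans ?_ h3
  have h4 : 5 * K * (n * (n * a) / (2 * K) / n) = 5 / 2 * (n * a) := by field_simp
  rw [h4]
  have : 0 ≤ n * a := by positivity
  linarith

theorem kept_degree_le {n K : ℕ} {A : Matrix (Fin n) (Fin n) ℕ} {a : ℝ}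
    (htot : total A ≤ 9 * n * (n * a)) {v : Fin n} (hv : v ∈ kept K A) :
    ∑ w, (A v w : ℝ) ≤ 45 * K * (n * a) := by
  classical
  have hn : (0 : ℝ) < n := by exact_mod_cast (Fin.pos v)
  simp only [kept, Finset.mem_filter, Finset.mem_univ, true_and] at hv
  refine hv.trans ?_
  have h3 : 5 * K * (total A / n) ≤ 5 * K * (9 * n * (n * a) / n) := by gcongr
  refine h3.trans (le_of_eq ?_)
  field_simp
  ring

/-! ### Closure of the set of deviating nodes -/

theorem exists_pow_two_near_sqrt {n : ℕ} {y : ℝ} (hy4 : 4 ≤ y) (hyn : y ≤ n) :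
    ∃ k : ℕ, k ≤ n ∧ ∀ z x r Θ : ℝ, 0 < z → 0 ≤ x → x ^ 2 * y ≤ 8 * r ^ 2 → 1 ≤ r →
      100 * r ≤ Θ → ¬ ((k + 1) * Real.log 2 * (Θ * z / 2) ≤
        z * (x * 2 ^ (k + 1) + 6 * (1 + Real.log y))) := by
  have hy1 : 1 ≤ √y := Real.one_le_sqrt.2 (by linarith)
  obtain ⟨k, hk1, hk2⟩ := exists_nat_pow_near hy1 (by norm_num : (1 : ℝ) < 2)
  have hsq : √y ^ 2 = y := Real.sq_sqrt (by linarith)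
  refine ⟨k, ?_, ?_⟩
  · have h1 : ((k : ℕ) : ℝ) < 2 ^ k := by exact_mod_cast Nat.lt_two_pow_self
    have h2 : √y ≤ y := by nlinarith
    have h4 : (k : ℝ) ≤ n := by linarith
    exact_mod_cast h4
  intro z x r Θ hz hx hxy hr hΘ h
  have hlogy : 1 ≤ Real.log y := by
    have h1 : Real.log 4 ≤ Real.log y := Real.log_le_log (by norm_num) hy4
    rw [show (4 : ℝ) = 2 ^ 2 by norm_num, Real.log_pow] at h1
    have := Real.log_two_gt_d9
    push_cast at h1; linarith
  have hklog : Real.log y / 2 ≤ (k + 1) * Real.log 2 := by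
    have h1 : Real.log √y ≤ Real.log (2 ^ (k + 1)) :=
      Real.log_le_log (Real.sqrt_pos.2 (by linarith)) hk2.le
    rw [Real.log_sqrt (by linarith), Real.log_pow] at h1
    push_cast at h1; exact h1
  have hxk : x * 2 ^ (k + 1) ≤ 6 * r := by
    have h1 : x * √y ≤ 3 * r := by
      refine le_of_sq_le_sq ?_ (by linarith)
      rw [mul_pow, hsq, mul_pow]
      nlinarith
    have h2 := mul_le_mul_of_nonneg_left hk1 hx
    rw [pow_succ]
    linarith
  have h2 : (k + 1) * Real.log 2 * (Θ / 2) ≤ x * 2 ^ (k + 1) + 6 * (1 + Real.log y) := by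
    refine le_of_mul_le_mul_left ?_ hz
    linarith
  have h3 : Real.log y / 2 * (100 * r / 2) ≤ (k + 1) * Real.log 2 * (Θ / 2) := by gcongr
  have h4 : 0 ≤ (r - 1) * (Real.log y - 1) := mul_nonneg (by linarith) (by linarith)
  linarith

open Classical in
/-- A small set can be enlarged to a small set to which no other node has many connections. -/
theorem exists_closed_superset {n : ℕ} {A : Matrix (Fin n) (Fin n) ℕ} (hs : A.IsSymm)
    (hd : ∀ v, A v v = 0) {a β Θ : ℝ} (ha : 0 ≤ a) (hA : Discrepancy A a)
    (hβn : 8 * β ≤ n) (haβ : a * β ≤ 4) (hna : 1 ≤ n * a) (hΘ : 100 * √(n * a) ≤ Θ)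
    {D : Finset (Fin n)} (hD : (D.card : ℝ) ≤ β / 2) :
    ∃ Z : Finset (Fin n), D ⊆ Z ∧ (Z.card : ℝ) ≤ β ∧
      ∀ v ∉ Z, ∑ w ∈ Z, (A v w : ℝ) ≤ Θ := by
  have hβ0 : 0 ≤ β := by
    have : (0 : ℝ) ≤ D.card := Nat.cast_nonneg _
    linarith
  have hr1 : 1 ≤ √(n * a) := Real.one_le_sqrt.2 hna
  have hΘ0 : 0 < Θ := by linarith
  let E : Finset (Fin n) → ℝ := fun W => ∑ v ∈ W, ∑ w ∈ W, (A v w : ℝ)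
  let 𝒲 : Finset (Finset (Fin n)) := Finset.univ.filter fun W =>
    D ⊆ W ∧ (W.card : ℝ) ≤ β ∧ 2 * Θ * (W.card - D.card) ≤ E W
  have hDW : D ∈ 𝒲 := by
    simp only [𝒲, Finset.mem_filter, Finset.mem_univ, true_and]
    refine ⟨Finset.Subset.refl _, by linarith, ?_⟩
    rw [sub_self, mul_zero]
    exact Finset.sum_nonneg fun v _ => Finset.sum_nonneg fun w _ => Nat.cast_nonneg _
  obtain ⟨Z, hZ, hmax⟩ := Finset.exists_max_image 𝒲 Finset.card ⟨D, hDW⟩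
  simp only [𝒲, Finset.mem_filter, Finset.mem_univ, true_and] at hZ hmax
  obtain ⟨hDZ, hZβ, hZE⟩ := hZ
  refine ⟨Z, hDZ, hZβ, fun v hv => ?_⟩
  by_contra! hlt
  set W := insert v Z with hW
  have hWc : (W.card : ℝ) = Z.card + 1 := by
    rw [hW, Finset.card_insert_of_notMem hv]; push_cast; rfl
  have hEW : E W = E Z + 2 * ∑ w ∈ Z, (A v w : ℝ) := by
    simp only [E, hW]
    rw [Finset.sum_insert hv, Finset.sum_insert hv, hd, Finset.sum_congr rfl fun u _ =>
      Finset.sum_insert hv, Finset.sum_add_distrib]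
    rw [Finset.sum_congr rfl (fun u _ => by rw [← hs.apply v u] : ∀ u ∈ Z, (A u v : ℝ) = A v u)]
    push_cast; ring
  have hWE : 2 * Θ * (W.card - D.card) ≤ E W := by
    rw [hEW, hWc]; nlinarith
  have hWβ : β < W.card := by
    by_contra! h
    have := hmax W ⟨hDZ.trans (Finset.subset_insert _ _), h, hWE⟩
    rw [hW, Finset.card_insert_of_notMem hv] at this
    omega
  have hZne : Z.Nonempty := by
    by_contra h
    rw [Finset.not_nonempty_iff_eq_empty] at h
    rw [h, Finset.sum_empty] at hlt
    linarith
  have hZ1 : (1 : ℝ) ≤ Z.card := by exact_mod_cast hZne.card_pos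
  have hW2 : (W.card : ℝ) ≤ 2 * β := by linarith
  have hWne : W.Nonempty := ⟨v, Finset.mem_insert_self _ _⟩
  obtain ⟨z, hz⟩ : ∃ z : ℝ, z = W.card := ⟨_, rfl⟩
  have hz0 : 0 < z := by rw [hz]; exact_mod_cast hWne.card_pos
  have hnz : 4 * z ≤ n := by rw [hz]; linarith
  have hn0 : (0 : ℝ) < n := by linarith
  obtain ⟨y, hy⟩ : ∃ y : ℝ, y = n / z := ⟨_, rfl⟩
  have hy4 : 4 ≤ y := by rw [hy, le_div_iff₀ hz0]; exact hnz
  have hz1 : 1 ≤ z := by rw [hz]; exact_mod_cast hWne.card_pos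
  have hyn : y ≤ n := by rw [hy]; exact div_le_self hn0.le hz1
  obtain ⟨k, hkn, hk⟩ := exists_pow_two_near_sqrt hy4 hyn
  have hdisc := hA W W hWne hWne k hkn
  have hcross : Θ * z / 2 ≤ crossSum A W W := by
    have h1 := two_mul_crossSum_self hs hd W
    have h2 : E W = 2 * crossSum A W W := h1.symm
    have h3 : (D.card : ℝ) ≤ z / 2 := by rw [hz]; linarith
    rw [h2, ← hz] at hWE
    have h4 := mul_le_mul_of_nonneg_left h3 hΘ0.le
    linarith
  rw [setEntropy, ← hz, ← hy] at hdisc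
  have haz : a * z ≤ 8 := by
    rw [hz]
    have := mul_le_mul_of_nonneg_left hW2 ha
    linarith
  refine hk z (a * z) (√(n * a)) Θ hz0 (by positivity) ?_ hr1 hΘ ?_
  · rw [Real.sq_sqrt (by linarith), hy]
    have : (a * z) ^ 2 * (n / z) = a * z * (n * a) := by field_simp
    rw [this]
    have := mul_le_mul_of_nonneg_right haz (show 0 ≤ n * a by linarith)
    linarith
  · refine le_trans (mul_le_mul_of_nonneg_left hcross ?_) (hdisc.trans (le_of_eq (by ring)))
    have := Real.log_two_gt_d9
    positivity

theorem NormBound.mono {n : ℕ} {Γ Γ' : Finset (Fin n)} {B : Fin n → Fin n → ℝ} {ν : ℝ}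
    (h : NormBound Γ B ν) (hsub : Γ' ⊆ Γ) : NormBound Γ' B ν :=
  fun x y hx hy => h x y (fun v hv => hx v fun h => hv (hsub h)) fun v hv => hy v fun h => hv (hsub h)

theorem NormBound.sum_sq_le {n : ℕ} {Γ : Finset (Fin n)} {B : Fin n → Fin n → ℝ} {ν : ℝ}
    (h : NormBound Γ B ν) {y : Fin n → ℝ} (hy : SupportedOn Γ y) :
    ∑ v ∈ Γ, (∑ w, B v w * y w) ^ 2 ≤ ν ^ 2 * ∑ w, y w ^ 2 := by
  classical
  set x : Fin n → ℝ := fun v => if v ∈ Γ then ∑ w, B v w * y w else 0 with hx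
  have hxs : ∑ v, x v ^ 2 = ∑ v ∈ Γ, (∑ w, B v w * y w) ^ 2 := by
    rw [← Finset.sum_filter_add_sum_filter_not Finset.univ (fun v => v ∈ Γ)]
    rw [Finset.sum_eq_zero (s := Finset.univ.filter fun v => ¬ v ∈ Γ), add_zero]
    · refine Finset.sum_congr (by ext; simp) fun v hv => ?_
      simp only [hx]; rw [if_pos hv]
    · intro v hv
      simp [hx, (Finset.mem_filter.1 hv).2]
  have hbil : ∑ v, ∑ w, x v * B v w * y w = ∑ v, x v ^ 2 := by
    refine Finset.sum_congr rfl fun v _ => ?_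
    simp only [mul_assoc]
    rw [← Finset.mul_sum]
    simp only [hx]
    split_ifs <;> ring
  have h1 := h x y (fun v hv => by simp [hx, hv]) hy
  rw [hbil, abs_of_nonneg (Finset.sum_nonneg fun v _ => sq_nonneg _)] at h1
  rw [← hxs]
  set X := ∑ v, x v ^ 2
  set Y := ∑ w, y w ^ 2
  have hX : 0 ≤ X := Finset.sum_nonneg fun v _ => sq_nonneg _
  have hY : 0 ≤ Y := Finset.sum_nonneg fun v _ => sq_nonneg _
  have hX2 := Real.sq_sqrt hX
  have hY2 := Real.sq_sqrt hY
  rcases (Real.sqrt_nonneg X).eq_or_lt with h0 | h0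
  · have hX0 : X = 0 := by rw [← hX2, ← h0]; norm_num
    rw [hX0]; positivity
  · have h2 : √X ≤ ν * √Y := by
      have : √X * √X ≤ ν * √Y * √X := by rw [← sq, hX2]; linarith
      exact le_of_mul_le_mul_right this h0
    calc X = √X ^ 2 := hX2.symm
      _ ≤ (ν * √Y) ^ 2 := pow_le_pow_left₀ h0.le h2 2
      _ = ν ^ 2 * Y := by rw [mul_pow, hY2]

/-! ### The improvement step -/

/-- The difference of the number of positive observations between a node and a set and its mean,
if the node itself is counted in the set. -/
def rowDeviation {n : ℕ} (A : Matrix (Fin n) (Fin n) ℕ) (R : Fin n → Fin n → ℝ)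
    (X : Finset (Fin n)) (v : Fin n) : ℝ := ∑ w ∈ X, ((A v w : ℝ) - R v w)

open Classical in
/-- The nodes to which two labellings give different labels. -/
def errors {n K : ℕ} (τ label : Fin n → Fin K) : Finset (Fin n) :=
  Finset.univ.filter fun v => label v ≠ τ v

open Classical in
/-- The nodes with a given label. -/
def labelSet {n K : ℕ} (label : Fin n → Fin K) (k : Fin K) : Finset (Fin n) :=
  Finset.univ.filter fun w => label w = k

theorem sum_eq_sub_add {n : ℕ} (S V : Finset (Fin n)) (f : Fin n → ℝ) :
    ∑ w ∈ S, f w = ∑ w ∈ V, f w - ∑ w ∈ V \ S, f w + ∑ w ∈ S \ V, f w := by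
  rw [← Finset.sum_inter_add_sum_sdiff S V f, ← Finset.sum_inter_add_sum_sdiff V S f, Finset.inter_comm]
  ring

open Classical in
theorem exists_rowDeviation_of_best {n K : ℕ} {A : Matrix (Fin n) (Fin n) ℕ}
    {τ label : Fin n → Fin K} {a b α : ℝ} (hab : b < a) (hα : 0 < α)
    (hsize : ∀ l, α * n ≤ clusterSize τ l)
    (herr : 100 * ((errors τ label).card : ℝ) ≤ α * n) {v : Fin n}
    (hv : ¬ Deviates A τ a b v) {k : Fin K} (hk : k ∈ best A label v) (hkv : k ≠ τ v) :
    ∃ l, α * n * (a - b) / 100 <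
        |rowDeviation A (rate τ a b) (labelSet τ l \ labelSet label l) v| ∨
      α * n * (a - b) / 100 <
        |rowDeviation A (rate τ a b) (labelSet label l \ labelSet τ l) v| := by
  by_contra! hno
  have hn : (0 : ℝ) < n := by exact_mod_cast Fin.pos v
  have hd : 0 < a - b := sub_pos.2 hab
  set e : ℝ := ((errors τ label).card : ℝ) with he
  have hcard : ∀ l, ((labelSet τ l).card : ℝ) = clusterSize τ l := fun l => rfl
  have hsub1 : ∀ l, labelSet τ l \ labelSet label l ⊆ errors τ label := by
    intro l w hw
    simp only [labelSet, errors, Finset.mem_sdiff, Finset.mem_filter, Finset.mem_univ,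
      true_and] at hw ⊢
    rw [hw.1]; exact hw.2
  have hsub2 : ∀ l, labelSet label l \ labelSet τ l ⊆ errors τ label := by
    intro l w hw
    simp only [labelSet, errors, Finset.mem_sdiff, Finset.mem_filter, Finset.mem_univ,
      true_and] at hw ⊢
    rw [hw.1]; exact fun h => hw.2 h.symm
  have hs1 : ∀ l, (clusterSize τ l : ℝ) - e ≤ (labelSet label l).card := by
    intro l
    have h1 := Finset.card_le_card_sdiff_add_card (s := labelSet τ l) (t := labelSet label l)
    have h2 := Finset.card_le_card (hsub1 l)
    have h3 : (clusterSize τ l : ℝ) ≤ (labelSet τ l \ labelSet label l).card +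
        (labelSet label l).card := by rw [← hcard]; exact_mod_cast h1
    have h4 : ((labelSet τ l \ labelSet label l).card : ℝ) ≤ e := by rw [he]; exact_mod_cast h2
    linarith
  have hN : ∀ l, |rowDeviation A (rate τ a b) (labelSet label l) v| ≤
      42 / 100 * clusterSize τ l * (a - b) := by
    intro l
    have h1 : rowDeviation A (rate τ a b) (labelSet label l) v =
        rowDeviation A (rate τ a b) (labelSet τ l) v -
        rowDeviation A (rate τ a b) (labelSet τ l \ labelSet label l) v +
        rowDeviation A (rate τ a b) (labelSet label l \ labelSet τ l) v :=
      sum_eq_sub_add _ _ _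
    have h2 : |rowDeviation A (rate τ a b) (labelSet τ l) v| ≤
        2 / 5 * clusterSize τ l * (a - b) := by
      have : rowDeviation A (rate τ a b) (labelSet τ l) v =
          clusterDegree A τ v l - clusterMean τ a b v l := by
        rw [clusterMean_eq, clusterDegree, rowDeviation, Finset.sum_sub_distrib]; rfl
      rw [this]
      by_contra h; exact hv ⟨l, not_le.1 h⟩
    have h3 := mul_le_mul_of_nonneg_right (hsize l) hd.le
    obtain ⟨h4, h5⟩ := hno l
    rw [h1]
    rw [abs_le] at h2 h4 h5 ⊢
    constructor <;> linarith [h2.1, h2.2, h4.1, h4.2, h5.1, h5.2]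
  have hM : ∀ l, ∑ w ∈ labelSet label l, rate τ a b v w =
      b * (labelSet label l).card +
        (a - b) * ((labelSet label l).filter fun w => τ v = τ w).card := by
    intro l
    rw [Finset.card_filter, Finset.card_eq_sum_ones]
    push_cast
    rw [Finset.mul_sum, Finset.mul_sum, ← Finset.sum_add_distrib]
    refine Finset.sum_congr rfl fun w _ => ?_
    rw [rate]; split_ifs <;> ring
  have hA : ∀ l, ∑ w ∈ labelSet label l, (A v w : ℝ) =
      ∑ w ∈ labelSet label l, rate τ a b v w +
        rowDeviation A (rate τ a b) (labelSet label l) v := by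
    intro l; rw [rowDeviation, Finset.sum_sub_distrib]; ring
  have hpos : ∀ l, (0 : ℝ) < (labelSet label l).card := by
    intro l
    have h1 := hs1 l
    have h2 := hsize l
    have h3 : 0 < α * n := by positivity
    linarith
  have hscore : ∀ l, score A label v l =
      (∑ w ∈ labelSet label l, (A v w : ℝ)) / (labelSet label l).card := fun l => rfl
  have hhigh : b + (a - b) / 2 < score A label v (τ v) := by
    rw [hscore, lt_div_iff₀ (hpos _), hA, hM]
    have h1 : ((labelSet label (τ v)).card : ℝ) - e ≤
        ((labelSet label (τ v)).filter fun w => τ v = τ w).card := by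
      have h2 : labelSet label (τ v) ⊆
          ((labelSet label (τ v)).filter fun w => τ v = τ w) ∪ errors τ label := by
        intro w hw
        simp only [labelSet, errors, Finset.mem_filter, Finset.mem_univ, true_and,
          Finset.mem_union] at hw ⊢
        by_cases h : τ v = τ w
        · exact Or.inl ⟨hw, h⟩
        · exact Or.inr (by rw [hw]; exact h)
      have h3 := (Finset.card_le_card h2).trans (Finset.card_union_le _ _)
      have h4 : ((labelSet label (τ v)).card : ℝ) ≤
        ((labelSet label (τ v)).filter fun w => τ v = τ w).card + e := by rw [he]; exact_mod_cast h3
      linarith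
    have h2 := mul_le_mul_of_nonneg_left h1 hd.le
    have h3 := (abs_le.1 (hN (τ v))).1
    have h4 := mul_le_mul_of_nonneg_left (hs1 (τ v)) hd.le
    have h5 := mul_le_mul_of_nonneg_left (hsize (τ v)) hd.le
    have h6 := mul_le_mul_of_nonneg_left herr hd.le
    have h7 : 0 < (a - b) * (α * n) := by positivity
    linarith
  have hlow : score A label v k < b + (a - b) / 2 := by
    rw [hscore, div_lt_iff₀ (hpos _), hA, hM]
    have h1 : (((labelSet label k).filter fun w => τ v = τ w).card : ℝ) ≤ e := by
      have h2 : ((labelSet label k).filter fun w => τ v = τ w) ⊆ errors τ label := by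
        intro w hw
        simp only [labelSet, errors, Finset.mem_filter, Finset.mem_univ, true_and] at hw ⊢
        rw [hw.1, ← hw.2]; exact hkv
      rw [he]; exact_mod_cast Finset.card_le_card h2
    have h2 := mul_le_mul_of_nonneg_left h1 hd.le
    have h3 := (abs_le.1 (hN k)).2
    have h4 := mul_le_mul_of_nonneg_left (hs1 k) hd.le
    have h5 := mul_le_mul_of_nonneg_left (hsize k) hd.le
    have h6 := mul_le_mul_of_nonneg_left herr hd.le
    have h7 : 0 < (a - b) * (α * n) := by positivity
    linarith
  have hbest := (Finset.mem_filter.1 hk).2 (τ v)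
  linarith

open Classical in
theorem card_large_rowDeviation_le {n K : ℕ} {A : Matrix (Fin n) (Fin n) ℕ}
    (hd : ∀ v, A v v = 0) {τ : Fin n → Fin K} {a b ν Θ ω : ℝ} (hb : 0 ≤ b) (hab : b ≤ a)
    {Z : Finset (Fin n)} (hν : NormBound Zᶜ (deviation A (rate τ a b)) ν)
    (hZ : ∀ v ∉ Z, ∑ w ∈ Z, (A v w : ℝ) ≤ Θ) (hω : 0 < ω)
    (hsmall : Θ + a * Z.card + a ≤ ω / 2) (X : Finset (Fin n)) :
    ((Zᶜ.filter fun v => ω < |rowDeviation A (rate τ a b) X v|).card : ℝ) ≤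
      4 * ν ^ 2 / ω ^ 2 * (X ∩ Zᶜ).card := by
  have ha : 0 ≤ a := hb.trans hab
  set y : Fin n → ℝ := fun w => if w ∈ X ∩ Zᶜ then 1 else 0 with hy
  have hsq : ∑ w, y w ^ 2 = (X ∩ Zᶜ).card := by
    simp only [hy, ite_pow, one_pow, ne_eq, OfNat.ofNat_ne_zero, not_false_eq_true, zero_pow]
    rw [Finset.sum_ite_mem, Finset.univ_inter]; simp
  have h1 := hν.sum_sq_le (y := y) fun v hv => if_neg fun h => hv (Finset.mem_inter.1 h).2
  rw [hsq] at h1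
  have h2 : ∀ v ∈ Zᶜ.filter (fun v => ω < |rowDeviation A (rate τ a b) X v|),
      ω ^ 2 / 4 ≤ (∑ w, deviation A (rate τ a b) v w * y w) ^ 2 := by
    intro v hv
    obtain ⟨hvZ, hlt⟩ := Finset.mem_filter.1 hv
    have hvZ' : v ∉ Z := Finset.mem_compl.1 hvZ
    have e1 : ∑ w, deviation A (rate τ a b) v w * y w =
        ∑ w ∈ X ∩ Zᶜ, deviation A (rate τ a b) v w := by
      simp only [hy, mul_ite, mul_one, mul_zero]
      rw [Finset.sum_ite_mem, Finset.univ_inter]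
    have e2 : rowDeviation A (rate τ a b) X v =
        (∑ w ∈ X ∩ Zᶜ, ((A v w : ℝ) - rate τ a b v w)) +
          ∑ w ∈ X ∩ Z, ((A v w : ℝ) - rate τ a b v w) := by
      rw [rowDeviation, ← Finset.sum_inter_add_sum_sdiff X Z, Finset.sdiff_eq_inter_compl, add_comm]
    have e3 : |(∑ w ∈ X ∩ Zᶜ, ((A v w : ℝ) - rate τ a b v w)) -
        ∑ w ∈ X ∩ Zᶜ, deviation A (rate τ a b) v w| ≤ a := by
      rw [← Finset.sum_sub_distrib]
      have e4 : ∀ w, (A v w : ℝ) - rate τ a b v w - deviation A (rate τ a b) v w =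
          if v = w then -a else 0 := by
        intro w
        rw [deviation]
        split_ifs with h
        · subst h; simp [hd, rate]
        · ring
      rw [Finset.sum_congr rfl fun w _ => e4 w, Finset.sum_ite_eq]
      split_ifs
      · rw [abs_neg, abs_of_nonneg ha]
      · simpa using ha
    have e5 : |∑ w ∈ X ∩ Z, ((A v w : ℝ) - rate τ a b v w)| ≤ Θ + a * Z.card := by
      rw [Finset.sum_sub_distrib]
      have h3 : ∑ w ∈ X ∩ Z, (A v w : ℝ) ≤ Θ :=
        (Finset.sum_le_sum_of_subset_of_nonneg Finset.inter_subset_right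
          fun w _ _ => Nat.cast_nonneg _).trans (hZ v hvZ')
      have h4 : (0 : ℝ) ≤ ∑ w ∈ X ∩ Z, (A v w : ℝ) :=
        Finset.sum_nonneg fun w _ => Nat.cast_nonneg _
      have h5 : ∑ w ∈ X ∩ Z, rate τ a b v w ≤ a * Z.card := by
        refine (Finset.sum_le_sum fun w _ => rate_le τ hab v w).trans ?_
        rw [Finset.sum_const, nsmul_eq_mul, mul_comm]
        have : ((X ∩ Z).card : ℝ) ≤ Z.card := by
          exact_mod_cast Finset.card_le_card Finset.inter_subset_right
        exact mul_le_mul_of_nonneg_left this ha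
      have h6 : 0 ≤ ∑ w ∈ X ∩ Z, rate τ a b v w :=
        Finset.sum_nonneg fun w _ => rate_nonneg τ hb hab v w
      rw [abs_le]; constructor <;> linarith
    rw [e1, show ω ^ 2 / 4 = (ω / 2) ^ 2 by ring, ← sq_abs (∑ w ∈ X ∩ Zᶜ, _)]
    refine pow_le_pow_left₀ (by positivity) ?_ 2
    rw [e2] at hlt
    have h3 := abs_add_le (∑ w ∈ X ∩ Zᶜ, ((A v w : ℝ) - rate τ a b v w))
      (∑ w ∈ X ∩ Z, ((A v w : ℝ) - rate τ a b v w))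
    have h4 := abs_sub_abs_le_abs_sub (∑ w ∈ X ∩ Zᶜ, ((A v w : ℝ) - rate τ a b v w))
      (∑ w ∈ X ∩ Zᶜ, deviation A (rate τ a b) v w)
    linarith
  have h3 := Finset.sum_le_sum h2
  rw [Finset.sum_const, nsmul_eq_mul] at h3
  have h4 := h3.trans ((Finset.sum_le_sum_of_subset_of_nonneg (Finset.filter_subset _ _)
    fun v _ _ => sq_nonneg _).trans h1)
  rw [div_mul_eq_mul_div, le_div_iff₀ (by positivity)]
  linarith

/-- The properties of the observations that make the improvement step work. -/
structure GoodOutside {n K : ℕ} (A : Matrix (Fin n) (Fin n) ℕ) (τ : Fin n → Fin K) (a b α : ℝ)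
    (Z : Finset (Fin n)) : Prop where
  pos : 0 < α
  nonneg : 0 ≤ b
  lt : b < a
  size : ∀ l, α * n ≤ clusterSize τ l
  diag : ∀ v, A v v = 0
  typical : ∀ v ∉ Z, ¬ Deviates A τ a b v
  small : 200 * (Z.card : ℝ) ≤ α * n
  sparse : ∃ Θ, (∀ v ∉ Z, ∑ w ∈ Z, (A v w : ℝ) ≤ Θ) ∧
    Θ + a * Z.card + a ≤ α * n * (a - b) / 100 / 2
  norm : ∃ ν, NormBound Zᶜ (deviation A (rate τ a b)) ν ∧
    64 * K * ν ^ 2 ≤ (α * n * (a - b) / 100) ^ 2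

open Classical in
theorem GoodOutside.errors_improve_le {n K : ℕ} {A : Matrix (Fin n) (Fin n) ℕ}
    {τ : Fin n → Fin K} {a b α : ℝ} {Z : Finset (Fin n)} (h : GoodOutside A τ a b α Z)
    {label label' : Fin n → Fin K}
    (herr : 200 * ((errors τ label ∩ Zᶜ).card : ℝ) ≤ α * n)
    (hbest : ∀ v, label' v ∈ best A label v) :
    ((errors τ label' ∩ Zᶜ).card : ℝ) ≤ (errors τ label ∩ Zᶜ).card / 8 := by
  obtain ⟨Θ, hΘ, hsmall⟩ := h.sparse
  obtain ⟨ν, hν, hν2⟩ := h.norm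
  rcases Nat.eq_zero_or_pos n with rfl | hn
  · rw [Finset.eq_empty_of_isEmpty (errors τ label' ∩ Zᶜ)]; simp; positivity
  have hn' : (0 : ℝ) < n := by exact_mod_cast hn
  set ω := α * n * (a - b) / 100 with hω
  have hωp : 0 < ω := by
    have := h.pos
    have := sub_pos.2 h.lt
    positivity
  have htot : 100 * ((errors τ label).card : ℝ) ≤ α * n := by
    have h1 : ((errors τ label).card : ℝ) ≤ (errors τ label ∩ Zᶜ).card + Z.card := by
      have h2 : errors τ label ⊆ (errors τ label ∩ Zᶜ) ∪ Z := by
        intro v hv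
        by_cases hz : v ∈ Z
        · exact Finset.mem_union_right _ hz
        · exact Finset.mem_union_left _ (Finset.mem_inter.2 ⟨hv, Finset.mem_compl.2 hz⟩)
      exact_mod_cast (Finset.card_le_card h2).trans (Finset.card_union_le _ _)
    have := h.small
    linarith
  let X : Fin K × Bool → Finset (Fin n) := fun x =>
    if x.2 then labelSet τ x.1 \ labelSet label x.1 else labelSet label x.1 \ labelSet τ x.1
  have hX : ∀ x, X x ⊆ errors τ label := by
    rintro ⟨l, _ | _⟩ w hw
    · simp only [X, Bool.false_eq_true, if_false, labelSet, errors, Finset.mem_sdiff,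
        Finset.mem_filter, Finset.mem_univ, true_and] at hw ⊢
      rw [hw.1]; exact fun h => hw.2 h.symm
    · simp only [X, if_true, labelSet, errors, Finset.mem_sdiff,
        Finset.mem_filter, Finset.mem_univ, true_and] at hw ⊢
      rw [hw.1]; exact hw.2
  have hsub : errors τ label' ∩ Zᶜ ⊆ (Finset.univ : Finset (Fin K × Bool)).biUnion fun x =>
      Zᶜ.filter fun v => ω < |rowDeviation A (rate τ a b) (X x) v| := by
    intro v hv
    obtain ⟨hv1, hv2⟩ := Finset.mem_inter.1 hv
    have hv3 : label' v ≠ τ v := (Finset.mem_filter.1 hv1).2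
    obtain ⟨l, hl | hl⟩ := exists_rowDeviation_of_best h.lt h.pos h.size htot
      (h.typical v (Finset.mem_compl.1 hv2)) (hbest v) hv3
    · exact Finset.mem_biUnion.2 ⟨(l, true), Finset.mem_univ _, Finset.mem_filter.2
        ⟨hv2, by simpa [X] using hl⟩⟩
    · exact Finset.mem_biUnion.2 ⟨(l, false), Finset.mem_univ _, Finset.mem_filter.2
        ⟨hv2, by simpa [X] using hl⟩⟩
  have h1 : ((errors τ label' ∩ Zᶜ).card : ℝ) ≤ ∑ x : Fin K × Bool,
      ((Zᶜ.filter fun v => ω < |rowDeviation A (rate τ a b) (X x) v|).card : ℝ) := by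
    exact_mod_cast (Finset.card_le_card hsub).trans Finset.card_biUnion_le
  have h2 : ∀ x : Fin K × Bool,
      ((Zᶜ.filter fun v => ω < |rowDeviation A (rate τ a b) (X x) v|).card : ℝ) ≤
      4 * ν ^ 2 / ω ^ 2 * (errors τ label ∩ Zᶜ).card := by
    intro x
    refine (card_large_rowDeviation_le h.diag h.nonneg h.lt.le hν hΘ hωp hsmall (X x)).trans ?_
    have : ((X x ∩ Zᶜ).card : ℝ) ≤ (errors τ label ∩ Zᶜ).card := by
      exact_mod_cast Finset.card_le_card (Finset.inter_subset_inter_right (hX x))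
    gcongr
  refine h1.trans ((Finset.sum_le_sum fun x _ => h2 x).trans ?_)
  rw [Finset.sum_const, nsmul_eq_mul, Finset.card_univ, Fintype.card_prod, Fintype.card_fin,
    Fintype.card_bool, ← mul_assoc]
  have h3 : ((K * 2 : ℕ) : ℝ) * (4 * ν ^ 2 / ω ^ 2) ≤ 1 / 8 := by
    push_cast
    rw [mul_div_assoc', div_le_div_iff₀ (by positivity) (by norm_num)]
    linarith
  have := mul_le_mul_of_nonneg_right h3 (Nat.cast_nonneg (errors τ label ∩ Zᶜ).card)
  linarith

open Classical in
theorem GoodOutside.errors_of_mem_support {n K : ℕ} [NeZero K] {A : Matrix (Fin n) (Fin n) ℕ}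
    {τ : Fin n → Fin K} {a b α : ℝ} {Z : Finset (Fin n)} (h : GoodOutside A τ a b α Z) (t : ℕ) :
    ∀ label : Fin n → Fin K, 200 * ((errors τ label ∩ Zᶜ).card : ℝ) ≤ α * n →
      ∀ out ∈ (improve A t label).support,
        ((errors τ out ∩ Zᶜ).card : ℝ) ≤ (errors τ label ∩ Zᶜ).card / 8 ^ t := by
  induction t with
  | zero =>
    intro label _ out hout
    rw [improve, PMF.mem_support_pure_iff] at hout
    rw [hout]; simp
  | succ t ih =>
    intro label herr out hout
    rw [improve, PMF.mem_support_bind_iff] at hout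
    obtain ⟨label', h1, h2⟩ := hout
    rw [improveRound, PMF.mem_support_uniformOfFinset_iff, Fintype.mem_piFinset] at h1
    have h3 := h.errors_improve_le herr h1
    have h4 : (0 : ℝ) ≤ (errors τ label ∩ Zᶜ).card := Nat.cast_nonneg _
    refine (ih label' (by linarith) out h2).trans ?_
    rw [pow_succ', ← div_div]
    gcongr

theorem lt_eight_pow_floor_log {n : ℕ} (hn : 8 ≤ n) : (n : ℝ) < 8 ^ ⌊Real.log n⌋₊ := by
  have hn' : (8 : ℝ) ≤ n := by exact_mod_cast hn
  have h1 := Nat.lt_floor_add_one (Real.log n)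
  set t := ⌊Real.log n⌋₊
  have h5 : Real.exp 2 ≤ 8 := by
    have : Real.exp 2 = Real.exp 1 ^ 2 := by rw [← Real.exp_nat_mul]; norm_num
    rw [this]; nlinarith [Real.exp_one_lt_d9, Real.exp_pos 1]
  have h2 : Real.exp (2 * t) ≤ 8 ^ t := by
    rw [mul_comm, Real.exp_nat_mul]
    exact pow_le_pow_left₀ (Real.exp_pos _).le h5 t
  refine lt_of_lt_of_le ?_ h2
  have h3 : Real.exp (2 * Real.log n) = n ^ 2 := by
    rw [two_mul, Real.exp_add, Real.exp_log (by linarith), sq]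
  have h4 : Real.exp (2 * Real.log n) < Real.exp (2 * t) * Real.exp 2 := by
    rw [← Real.exp_add]; apply Real.exp_lt_exp.2; linarith
  rw [h3] at h4
  nlinarith [Real.exp_pos (2 * (t : ℝ))]

/-- After the improvement step only nodes in `Z` are misclassified. -/
theorem GoodOutside.misclassified_le {n K : ℕ} [NeZero K] (hn : 8 ≤ n)
    {A : Matrix (Fin n) (Fin n) ℕ} {τ : Fin n → Fin K} {a b α : ℝ} {Z : Finset (Fin n)}
    (h : GoodOutside A τ a b α Z) {label out : Fin n → Fin K}
    (herr : 200 * ((errors τ label).card : ℝ) ≤ α * n)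
    (hout : out ∈ (improve A ⌊Real.log n⌋₊ label).support) : errors τ out ⊆ Z := by
  classical
  have h0 : ((errors τ label ∩ Zᶜ).card : ℝ) ≤ (errors τ label).card := by
    exact_mod_cast Finset.card_le_card Finset.inter_subset_left
  have h1 := h.errors_of_mem_support ⌊Real.log n⌋₊ label (by linarith) out hout
  have h2 : ((errors τ label).card : ℝ) ≤ n := by
    have := Finset.card_le_univ (errors τ label)
    rw [Fintype.card_fin] at this
    exact_mod_cast this
  have h3 : ((errors τ out ∩ Zᶜ).card : ℝ) < 1 := by
    refine h1.trans_lt ?_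
    rw [div_lt_one (by positivity)]
    have := lt_eight_pow_floor_log hn
    linarith
  have h4 : (errors τ out ∩ Zᶜ).card = 0 := by
    have : (errors τ out ∩ Zᶜ).card < 1 := by exact_mod_cast h3
    omega
  intro v hv
  by_contra hz
  have : v ∈ errors τ out ∩ Zᶜ := Finset.mem_inter.2 ⟨hv, Finset.mem_compl.2 hz⟩
  rw [Finset.card_eq_zero.1 h4] at this
  simp at this

/-! ### Eigenvectors of a perturbed block matrix -/

theorem quadratic_form_le {ι : Type} [Fintype ι] {B : Matrix ι ι ℝ}
    (u : OrthonormalBasis ι ℝ (EuclideanSpace ℝ ι)) (ev : ι → ℝ) (i₁ i₂ : ι)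
    (hu : ∀ i, B.mulVec (u i).ofLp = ev i • (u i).ofLp) (hmax : ∀ c, c ≠ i₁ → ev c ≤ ev i₂)
    (z : ι → ℝ) (hz : ∑ v, u i₁ v * z v = 0) :
    ∑ v, z v * B.mulVec z v ≤ ev i₂ * ∑ v, z v ^ 2 := by
  classical
  set Z : EuclideanSpace ℝ ι := WithLp.toLp 2 z with hZ
  have hinner : ∀ x y : EuclideanSpace ℝ ι, inner ℝ x y = ∑ v, x v * y v := by
    intro x y
    rw [PiLp.inner_apply]
    exact Finset.sum_congr rfl fun v _ => by simp [mul_comm]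
  have h1 : ∑ v, z v * B.mulVec z v = inner ℝ Z (Matrix.toEuclideanLin B Z) := by
    rw [hinner]; rfl
  have hTu : ∀ i, Matrix.toEuclideanLin B (u i) = ev i • u i := by
    intro i
    rw [Matrix.toLpLin_apply, hu i]; rfl
  have h2 : inner ℝ Z (Matrix.toEuclideanLin B Z) = ∑ i, ev i * inner ℝ (u i) Z ^ 2 := by
    conv_lhs => rw [← u.sum_repr' Z]
    rw [map_sum, inner_sum]
    refine Finset.sum_congr rfl fun i _ => ?_
    rw [map_smul, hTu, inner_smul_right, inner_smul_right, u.sum_repr' Z, real_inner_comm Z]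
    ring
  have h3 : ∑ v, z v ^ 2 = ∑ i, inner ℝ (u i) Z ^ 2 := by
    have h4 : ∑ v, z v ^ 2 = inner ℝ Z Z := by
      rw [hinner]; exact Finset.sum_congr rfl fun v _ => by rw [hZ]; simp [sq]
    rw [h4, ← u.sum_inner_mul_inner Z Z]
    exact Finset.sum_congr rfl fun i _ => by rw [real_inner_comm Z, sq]
  rw [h1, h2, h3, Finset.mul_sum]
  refine Finset.sum_le_sum fun i _ => ?_
  by_cases hi : i = i₁
  · have : inner ℝ (u i) Z = 0 := by rw [hi, hinner]; exact hz
    rw [this]; simp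
  · exact mul_le_mul_of_nonneg_right (hmax i hi) (sq_nonneg _)

section Blocks

variable {ι : Type} [Fintype ι] {K : ℕ}

open Classical in
/-- The mean of a function on the cluster `k`. -/
def blockMean (τ : ι → Fin K) (x : ι → ℝ) (k : Fin K) : ℝ :=
  (∑ v ∈ Finset.univ.filter (fun v => τ v = k), x v) /
    ((Finset.univ.filter fun v => τ v = k).card : ℝ)

/-- The difference of a function and its means on the clusters. -/
def blockResidual (τ : ι → Fin K) (x : ι → ℝ) (v : ι) : ℝ := x v - blockMean τ x (τ v)

open Classical in
theorem sum_blockResidual_mul (τ : ι → Fin K) (x : ι → ℝ) (h : Fin K → ℝ) :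
    ∑ v, blockResidual τ x v * h (τ v) = 0 := by
  rw [← Finset.sum_fiberwise Finset.univ τ]
  refine Finset.sum_eq_zero fun k _ => ?_
  rw [Finset.sum_congr rfl (g := fun v => (x v - blockMean τ x k) * h k)]
  · rw [← Finset.sum_mul, Finset.sum_sub_distrib, Finset.sum_const, nsmul_eq_mul, blockMean]
    rcases Finset.eq_empty_or_nonempty (Finset.univ.filter fun v => τ v = k) with he | hne
    · rw [he]; simp
    · have : ((Finset.univ.filter fun v => τ v = k).card : ℝ) ≠ 0 := by
        exact_mod_cast hne.card_pos.ne'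
      rw [mul_div_cancel₀ _ this, sub_self, zero_mul]
  · intro v hv
    rw [blockResidual, (Finset.mem_filter.1 hv).2]

theorem sum_blockResidual_mul_self (τ : ι → Fin K) (x : ι → ℝ) :
    ∑ v, blockResidual τ x v * x v = ∑ v, blockResidual τ x v ^ 2 := by
  have h := sum_blockResidual_mul τ x (blockMean τ x)
  rw [← add_zero (∑ v, blockResidual τ x v ^ 2), ← h, ← Finset.sum_add_distrib]
  refine Finset.sum_congr rfl fun v _ => ?_
  rw [blockResidual]; ring

open Classical in
/-- `B` is the sum of a block matrix and of a matrix of norm at most `ν`, except that `a` is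
subtracted on the diagonal. -/
structure IsPerturbedBlock (B : Matrix ι ι ℝ) (N : ι → ι → ℝ) (τ : ι → Fin K) (a b ν : ℝ) :
    Prop where
  eq : ∀ v w, B v w = (if τ v = τ w then a else b) + N v w - if v = w then a else 0
  norm : ∀ x y : ι → ℝ, |∑ v, ∑ w, x v * N v w * y w| ≤ ν * √(∑ v, x v ^ 2) * √(∑ v, y v ^ 2)

open Classical in
theorem IsPerturbedBlock.mulVec {B : Matrix ι ι ℝ} {N : ι → ι → ℝ} {τ : ι → Fin K} {a b ν : ℝ}
    (h : IsPerturbedBlock B N τ a b ν) (x : ι → ℝ) (v : ι) :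
    B.mulVec x v = (∑ w, (if τ v = τ w then a else b) * x w) + ∑ w, N v w * x w - a * x v := by
  rw [Matrix.mulVec, dotProduct, ← Finset.sum_add_distrib]
  have : a * x v = ∑ w, (if v = w then a else 0) * x w := by
    simp [ite_mul, Finset.sum_ite_eq]
  rw [this, ← Finset.sum_sub_distrib]
  refine Finset.sum_congr rfl fun w _ => ?_
  rw [h.eq]; ring

open Classical in
theorem IsPerturbedBlock.sum_blockResidual_mulVec {B : Matrix ι ι ℝ} {N : ι → ι → ℝ}
    {τ : ι → Fin K} {a b ν : ℝ} (h : IsPerturbedBlock B N τ a b ν) (x y : ι → ℝ) :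
    ∑ v, blockResidual τ x v * B.mulVec y v =
      (∑ v, ∑ w, blockResidual τ x v * N v w * y w) - a * ∑ v, blockResidual τ x v * y v := by
  have h1 := sum_blockResidual_mul τ x fun k => ∑ w, (if k = τ w then a else b) * y w
  have h2 : ∑ v, blockResidual τ x v * B.mulVec y v =
      (∑ v, blockResidual τ x v * ∑ w, (if τ v = τ w then a else b) * y w) +
      ((∑ v, ∑ w, blockResidual τ x v * N v w * y w) - a * ∑ v, blockResidual τ x v * y v) := by
    rw [Finset.mul_sum, ← Finset.sum_sub_distrib, ← Finset.sum_add_distrib]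
    refine Finset.sum_congr rfl fun v _ => ?_
    rw [h.mulVec]
    simp only [mul_assoc]
    rw [← Finset.mul_sum]
    ring
  rw [h2, h1, zero_add]

theorem IsPerturbedBlock.blockResidual_eigenvector {B : Matrix ι ι ℝ} {N : ι → ι → ℝ}
    {τ : ι → Fin K} {a b ν : ℝ} (h : IsPerturbedBlock B N τ a b ν) {x : ι → ℝ} {ev κ : ℝ}
    (hx : B.mulVec x = ev • x) (hκ : 0 < κ) (hev : κ ≤ |ev + a|) :
    ∑ v, blockResidual τ x v ^ 2 ≤ (ν / κ) ^ 2 * ∑ v, x v ^ 2 := by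
  set r := blockResidual τ x with hr
  have h1 := h.sum_blockResidual_mulVec x x
  have h2 : ∑ v, r v * B.mulVec x v = ev * ∑ v, r v ^ 2 := by
    rw [hx, ← sum_blockResidual_mul_self, Finset.mul_sum]
    refine Finset.sum_congr rfl fun v _ => ?_
    simp only [Pi.smul_apply, smul_eq_mul]; ring
  have h3 := h.norm r x
  rw [h2, sum_blockResidual_mul_self] at h1
  have hR : 0 ≤ ∑ v, r v ^ 2 := Finset.sum_nonneg fun v _ => sq_nonneg _
  have hX : 0 ≤ ∑ v, x v ^ 2 := Finset.sum_nonneg fun v _ => sq_nonneg _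
  have h4 : (ev + a) * ∑ v, r v ^ 2 = ∑ v, ∑ w, r v * N v w * x w := by linarith
  rw [← h4, abs_mul, abs_of_nonneg hR] at h3
  have h5 : κ * ∑ v, r v ^ 2 ≤ ν * √(∑ v, r v ^ 2) * √(∑ v, x v ^ 2) :=
    (mul_le_mul_of_nonneg_right hev hR).trans h3
  have h6 := Real.sq_sqrt hR
  rcases (Real.sqrt_nonneg (∑ v, r v ^ 2)).eq_or_lt with h0 | h0
  · rw [← h6, ← h0]
    have : (0 : ℝ) ^ 2 = 0 := by norm_num
    rw [this]; positivity
  · have h7 : √(∑ v, r v ^ 2) ≤ ν / κ * √(∑ v, x v ^ 2) := by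
      rw [div_mul_eq_mul_div, le_div_iff₀ hκ]
      refine le_of_mul_le_mul_right ?_ h0
      calc √(∑ v, r v ^ 2) * κ * √(∑ v, r v ^ 2) = κ * √(∑ v, r v ^ 2) ^ 2 := by ring
        _ ≤ ν * √(∑ v, r v ^ 2) * √(∑ v, x v ^ 2) := by rw [h6]; exact h5
        _ = _ := by ring
    calc ∑ v, r v ^ 2 = √(∑ v, r v ^ 2) ^ 2 := h6.symm
      _ ≤ (ν / κ * √(∑ v, x v ^ 2)) ^ 2 := pow_le_pow_left₀ h0.le h7 2
      _ = _ := by rw [mul_pow, Real.sq_sqrt hX]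

open Classical in
/-- The number of nodes of a cluster. -/
def blockSize (τ : ι → Fin K) (k : Fin K) : ℝ := ((Finset.univ.filter fun v => τ v = k).card : ℝ)

open Classical in
theorem sum_comp_block (τ : ι → Fin K) (c : Fin K → ℝ) :
    ∑ v, c (τ v) = ∑ k, blockSize τ k * c k := by
  rw [← Finset.sum_fiberwise Finset.univ τ]
  refine Finset.sum_congr rfl fun k _ => ?_
  rw [Finset.sum_congr rfl (g := fun _ => c k)]
  · rw [Finset.sum_const, nsmul_eq_mul, blockSize]
  · intro v hv; rw [(Finset.mem_filter.1 hv).2]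

open Classical in
/-- The block matrix is bounded below on the functions that are constant on the clusters. -/
theorem block_mulVec_form (τ : ι → Fin K) (a b : ℝ) (c : Fin K → ℝ) (v : ι) :
    ∑ w, (if τ v = τ w then a else b) * c (τ w) =
      b * (∑ k, blockSize τ k * c k) + (a - b) * (blockSize τ (τ v) * c (τ v)) := by
  rw [sum_comp_block τ fun k => (if τ v = k then a else b) * c k, Finset.mul_sum]
  have h : (a - b) * (blockSize τ (τ v) * c (τ v)) =
      ∑ k, if τ v = k then (a - b) * (blockSize τ k * c k) else 0 := by
    rw [Finset.sum_ite_eq]; simp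
  rw [h, ← Finset.sum_add_distrib]
  refine Finset.sum_congr rfl fun k _ => ?_
  split_ifs <;> ring

theorem block_form_ge (τ : ι → Fin K) {a b μ : ℝ} (hb : 0 ≤ b) (hab : b ≤ a)
    (hμ : ∀ k, μ ≤ blockSize τ k) (c : Fin K → ℝ) :
    (a - b) * μ * ∑ v, c (τ v) ^ 2 ≤
      ∑ v, c (τ v) * ∑ w, (if τ v = τ w then a else b) * c (τ w) := by
  simp only [block_mulVec_form]
  rw [sum_comp_block τ fun k => c k ^ 2, sum_comp_block τ fun k => c k *
    (b * (∑ k, blockSize τ k * c k) + (a - b) * (blockSize τ k * c k))]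
  have h1 : ∑ k, blockSize τ k * (c k *
      (b * (∑ k, blockSize τ k * c k) + (a - b) * (blockSize τ k * c k))) =
      b * (∑ k, blockSize τ k * c k) ^ 2 + (a - b) * ∑ k, blockSize τ k * (blockSize τ k * c k ^ 2) := by
    obtain ⟨Q, hQ⟩ : ∃ Q, Q = ∑ k, blockSize τ k * c k := ⟨_, rfl⟩
    rw [← hQ]
    have h0 : ∀ k, blockSize τ k * (c k * (b * Q + (a - b) * (blockSize τ k * c k))) =
        (b * Q) * (blockSize τ k * c k) + (a - b) * (blockSize τ k * (blockSize τ k * c k ^ 2)) :=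
      fun k => by ring
    rw [Finset.sum_congr rfl fun k _ => h0 k, Finset.sum_add_distrib, ← Finset.mul_sum,
      ← Finset.mul_sum, ← hQ]
    ring
  rw [h1]
  have h2 : μ * ∑ k, blockSize τ k * c k ^ 2 ≤ ∑ k, blockSize τ k * (blockSize τ k * c k ^ 2) := by
    rw [Finset.mul_sum]
    refine Finset.sum_le_sum fun k _ => mul_le_mul_of_nonneg_right (hμ k) ?_
    exact mul_nonneg (Nat.cast_nonneg _) (sq_nonneg _)
  have h3 := mul_le_mul_of_nonneg_left h2 (sub_nonneg.2 hab)
  have h4 : 0 ≤ b * (∑ k, blockSize τ k * c k) ^ 2 := by positivity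
  linarith

theorem IsPerturbedBlock.form_ge {B : Matrix ι ι ℝ} {N : ι → ι → ℝ} {τ : ι → Fin K}
    {a b ν μ : ℝ} (h : IsPerturbedBlock B N τ a b ν) (hb : 0 ≤ b) (hab : b ≤ a)
    (hμ : ∀ k, μ ≤ blockSize τ k) (c : Fin K → ℝ) :
    ((a - b) * μ - ν - a) * ∑ v, c (τ v) ^ 2 ≤
      ∑ v, c (τ v) * B.mulVec (fun v => c (τ v)) v := by
  classical
  have h2 := block_form_ge τ hb hab hμ c
  set z : ι → ℝ := fun v => c (τ v) with hz
  have h3 : ∑ v, z v * B.mulVec z v =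
      (∑ v, c (τ v) * ∑ w, (if τ v = τ w then a else b) * c (τ w)) +
        (∑ v, ∑ w, z v * N v w * z w) - a * ∑ v, z v ^ 2 := by
    rw [Finset.mul_sum, ← Finset.sum_add_distrib, ← Finset.sum_sub_distrib]
    refine Finset.sum_congr rfl fun v _ => ?_
    rw [h.mulVec]
    simp only [mul_assoc]
    rw [← Finset.mul_sum]
    ring
  have h4 := (abs_le.1 (h.norm z z)).1
  rw [mul_assoc, ← sq, Real.sq_sqrt (Finset.sum_nonneg fun v _ => sq_nonneg _)] at h4
  change _ ≤ ∑ v, z v * B.mulVec z v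
  rw [h3]
  linarith

end Blocks

/-! ### Two clusters -/

section TwoClusters

variable {ι : Type} [Fintype ι]

theorem IsPerturbedBlock.second_eigenvalue_ge {B : Matrix ι ι ℝ} {N : ι → ι → ℝ}
    {τ : ι → Fin 2} {a b ν μ : ℝ} (h : IsPerturbedBlock B N τ a b ν) (hb : 0 ≤ b) (hab : b ≤ a)
    (hμ0 : 0 < μ) (hμ : ∀ k, μ ≤ blockSize τ k)
    (u : OrthonormalBasis ι ℝ (EuclideanSpace ℝ ι)) (ev : ι → ℝ) (i₁ i₂ : ι)
    (hu : ∀ i, B.mulVec (u i).ofLp = ev i • (u i).ofLp) (hmax : ∀ c, c ≠ i₁ → ev c ≤ ev i₂) :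
    (a - b) * μ - ν ≤ ev i₂ + a := by
  classical
  have hm : ∀ k, 0 < blockSize τ k := fun k => hμ0.trans_le (hμ k)
  obtain ⟨c, hc0, hc⟩ : ∃ c : Fin 2 → ℝ, (∃ k, c k ≠ 0) ∧ ∑ v, u i₁ v * c (τ v) = 0 := by
    let S : Fin 2 → ℝ := fun k => ∑ v ∈ Finset.univ.filter (fun v => τ v = k), u i₁ v
    have hS : ∀ c : Fin 2 → ℝ, ∑ v, u i₁ v * c (τ v) = S 0 * c 0 + S 1 * c 1 := by
      intro c
      rw [← Finset.sum_fiberwise Finset.univ τ, Fin.sum_univ_two]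
      congr 1 <;>
      · simp only [S]
        rw [Finset.sum_mul]
        exact Finset.sum_congr rfl fun v hv => by rw [(Finset.mem_filter.1 hv).2]
    by_cases h0 : S 0 = 0
    · exact ⟨![1, 0], ⟨0, by simp⟩, by rw [hS]; simp [h0]⟩
    · exact ⟨![S 1, -S 0], ⟨1, by simpa using h0⟩, by rw [hS]; simp; ring⟩
  have h1 := quadratic_form_le u ev i₁ i₂ hu hmax (fun v => c (τ v)) hc
  have h2 := h.form_ge hb hab hμ c
  have hpos : 0 < ∑ v, c (τ v) ^ 2 := by
    rw [sum_comp_block τ fun k => c k ^ 2]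
    obtain ⟨k, hk⟩ := hc0
    exact Finset.sum_pos' (fun k _ => mul_nonneg (hm k).le (sq_nonneg _))
      ⟨k, Finset.mem_univ _, mul_pos (hm k) (by positivity)⟩
  have h3 := le_of_mul_le_mul_right (h2.trans h1) hpos
  linarith

open Classical in
theorem centered_sq_ge (u : OrthonormalBasis ι ℝ (EuclideanSpace ℝ ι)) {i₁ i₂ : ι} (h : i₁ ≠ i₂) :
    1 ≤ ∑ v, centered (u i₁) (u i₂) v ^ 2 := by
  obtain ⟨y, hy⟩ : ∃ y : EuclideanSpace ℝ ι,
    y = if 0 < (∑ v, u i₁ v) * (∑ v, u i₂ v) then -u i₂ else u i₂ := ⟨_, rfl⟩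
  have hN : (0 : ℝ) < Fintype.card ι := by
    have : Nonempty ι := ⟨i₁⟩
    exact_mod_cast Fintype.card_pos
  have hinner : ∀ x y : EuclideanSpace ℝ ι, inner ℝ x y = ∑ v, x v * y v := by
    intro x y
    rw [PiLp.inner_apply]
    exact Finset.sum_congr rfl fun v _ => by simp [mul_comm]
  have h11 : ∑ v, u i₁ v * u i₁ v = 1 := by
    rw [← hinner, real_inner_self_eq_norm_sq, u.norm_eq_one]; norm_num
  have h22 : ∑ v, u i₂ v * u i₂ v = 1 := by
    rw [← hinner, real_inner_self_eq_norm_sq, u.norm_eq_one]; norm_num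
  have h12 : ∑ v, u i₁ v * u i₂ v = 0 := by
    rw [← hinner]; exact u.inner_eq_zero h
  set s₁ := ∑ v, u i₁ v with hs₁
  set s₂ := ∑ v, u i₂ v with hs₂
  have hy1 : ∑ v, u i₁ v * y v = 0 := by
    rw [hy]; split_ifs
    · simp [h12]
    · exact h12
  have hy2 : ∑ v, y v * y v = 1 := by
    rw [hy]; split_ifs
    · simpa using h22
    · exact h22
  have hys : s₁ * (∑ v, y v) ≤ 0 ∧ (∑ v, y v) ^ 2 = s₂ ^ 2 := by
    rw [hy]; split_ifs with h0
    · simp only [PiLp.neg_apply, Finset.sum_neg_distrib, ← hs₂]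
      exact ⟨by linarith, by ring⟩
    · exact ⟨not_lt.1 h0, rfl⟩
  have hbessel : s₁ ^ 2 + s₂ ^ 2 ≤ Fintype.card ι := by
    set e : EuclideanSpace ℝ ι := WithLp.toLp 2 fun _ => 1 with he
    have h1 : ∑ i, ‖inner ℝ (u i) e‖ ^ 2 = ‖e‖ ^ 2 := u.sum_sq_norm_inner_right e
    have h2 : ‖e‖ ^ 2 = Fintype.card ι := by
      rw [EuclideanSpace.real_norm_sq_eq, he]; simp
    have h3 : ∑ i ∈ {i₁, i₂}, ‖inner ℝ (u i) e‖ ^ 2 ≤ ∑ i, ‖inner ℝ (u i) e‖ ^ 2 :=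
      Finset.sum_le_sum_of_subset_of_nonneg (Finset.subset_univ _) fun i _ _ => sq_nonneg _
    rw [Finset.sum_pair h, h1, h2, Real.norm_eq_abs, Real.norm_eq_abs, sq_abs, sq_abs, hinner,
      hinner] at h3
    simpa [he] using h3
  set s := ∑ w, (u i₁ w + y w) with hs
  have hs' : s = s₁ + ∑ v, y v := Finset.sum_add_distrib
  have hcen : ∀ v, centered (u i₁) (u i₂) v = (u i₁ v + y v) - 1 / Fintype.card ι * s := by
    intro v; rw [hs, hy]; rfl
  have hsum : ∑ v, centered (u i₁) (u i₂) v ^ 2 = 2 - s ^ 2 / Fintype.card ι := by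
    have h1 : ∀ v, centered (u i₁) (u i₂) v ^ 2 = u i₁ v * u i₁ v + 2 * (u i₁ v * y v) + y v * y v
        - 2 * (1 / Fintype.card ι * s) * (u i₁ v + y v) + (1 / Fintype.card ι * s) ^ 2 := by
      intro v; rw [hcen]; ring
    rw [Finset.sum_congr rfl fun v _ => h1 v, Finset.sum_add_distrib, Finset.sum_sub_distrib,
      Finset.sum_add_distrib, Finset.sum_add_distrib, ← Finset.mul_sum, ← Finset.mul_sum, h11, hy1,
      hy2, ← hs, Finset.sum_const, Finset.card_univ, nsmul_eq_mul]
    field_simp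
    ring
  rw [hsum]
  have h5 : s ^ 2 ≤ Fintype.card ι := by
    rw [hs']
    nlinarith [hys.1, hys.2]
  have h6 : s ^ 2 / Fintype.card ι ≤ 1 := (div_le_one hN).2 h5
  linarith

open Classical in
/-- The nodes on the wrong side. -/
def wrongSide (τ : ι → Fin 2) (x : ι → ℝ) (σ : Equiv.Perm (Fin 2)) : Finset ι :=
  Finset.univ.filter fun v => ¬ ((σ (τ v) = 0 ∧ 0 < x v) ∨ (σ (τ v) = 1 ∧ x v < 0))

theorem exists_perm_wrongSide_le {τ : ι → Fin 2} {x : ι → ℝ} {μ ε : ℝ} (hμ0 : 0 < μ)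
    (hμ : ∀ k, μ ≤ blockSize τ k) (hx0 : ∑ v, x v = 0) (hx1 : 1 ≤ ∑ v, x v ^ 2)
    (hε : ∑ v, blockResidual τ x v ^ 2 ≤ ε) (hε2 : ε ≤ 1 / 2) :
    ∃ σ : Equiv.Perm (Fin 2),
      ((wrongSide τ x σ).card : ℝ) * (μ / (2 * (Fintype.card ι : ℝ) ^ 2)) ≤ ε := by
  classical
  have hm : ∀ k, 0 < blockSize τ k := fun k => hμ0.trans_le (hμ k)
  set g := blockMean τ x with hg
  set r := blockResidual τ x with hr
  have hxv : ∀ v, x v = g (τ v) + r v := fun v => by rw [hr, blockResidual]; ring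
  have hN : blockSize τ 0 + blockSize τ 1 = Fintype.card ι := by
    have := sum_comp_block τ fun _ => 1
    simpa [Fin.sum_univ_two] using this.symm
  have h0 : blockSize τ 0 * g 0 + blockSize τ 1 * g 1 = 0 := by
    have h1 := sum_blockResidual_mul τ x fun _ => 1
    simp only [mul_one] at h1
    have h2 : ∑ v, x v = ∑ v, g (τ v) + ∑ v, r v := by
      rw [← Finset.sum_add_distrib]; exact Finset.sum_congr rfl fun v _ => hxv v
    rw [h1, hx0, add_zero, sum_comp_block τ g, Fin.sum_univ_two] at h2
    exact h2.symm
  have h1 : 1 / 2 ≤ blockSize τ 0 * g 0 ^ 2 + blockSize τ 1 * g 1 ^ 2 := by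
    have h2 : ∑ v, x v ^ 2 = ∑ v, g (τ v) ^ 2 + ∑ v, r v ^ 2 := by
      have h3 := sum_blockResidual_mul τ x g
      have h4 : ∑ v, x v ^ 2 = ∑ v, g (τ v) ^ 2 + ∑ v, r v ^ 2 + 2 * ∑ v, r v * g (τ v) := by
        rw [Finset.mul_sum, ← Finset.sum_add_distrib, ← Finset.sum_add_distrib]
        exact Finset.sum_congr rfl fun v _ => by rw [hxv]; ring
      rw [h4, h3]; ring
    rw [sum_comp_block τ fun k => g k ^ 2, Fin.sum_univ_two] at h2
    linarith
  have hNpos : (0 : ℝ) < Fintype.card ι := by rw [← hN]; linarith [hm 0, hm 1]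
  have hlow : ∀ k, μ / (2 * (Fintype.card ι : ℝ) ^ 2) ≤ g k ^ 2 := by
    have key : ∀ m m' c c' : ℝ, 0 < m → 0 < m' → m * c + m' * c' = 0 →
        1 / 2 ≤ m * c ^ 2 + m' * c' ^ 2 → μ ≤ m' → m + m' = Fintype.card ι →
        μ / (2 * (Fintype.card ι : ℝ) ^ 2) ≤ c ^ 2 := by
      intro m m' c c' hm hm' h0 h1 hμ hN
      rw [← hN, div_le_iff₀ (by positivity)]
      have h2 : m' * (m * c ^ 2 + m' * c' ^ 2) = m * (m + m') * c ^ 2 := by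
        have : m' * c' = -(m * c) := by linarith
        calc m' * (m * c ^ 2 + m' * c' ^ 2) = m * m' * c ^ 2 + (m' * c') ^ 2 := by ring
          _ = _ := by rw [this]; ring
      have h3 : m' / 2 ≤ m * (m + m') * c ^ 2 := by rw [← h2]; nlinarith
      have h4 : m * (m + m') * c ^ 2 ≤ (m + m') * (m + m') * c ^ 2 := by gcongr; linarith
      nlinarith
    exact Fin.forall_fin_two.2
      ⟨key (blockSize τ 0) (blockSize τ 1) (g 0) (g 1) (hm 0) (hm 1) h0 h1 (hμ 1) hN,
        key (blockSize τ 1) (blockSize τ 0) (g 1) (g 0) (hm 1) (hm 0) (by linarith) (by linarith)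
          (hμ 0) (by linarith)⟩
  have hδ : 0 < μ / (2 * (Fintype.card ι : ℝ) ^ 2) := by positivity
  have hfin : ∀ σ : Equiv.Perm (Fin 2), (∀ k, (σ k = 0 ∧ 0 < g k) ∨ (σ k = 1 ∧ g k < 0)) →
      ((wrongSide τ x σ).card : ℝ) * (μ / (2 * (Fintype.card ι : ℝ) ^ 2)) ≤ ε := by
    intro σ hσ
    refine le_trans ?_ hε
    have h2 : ∀ v ∈ wrongSide τ x σ, μ / (2 * (Fintype.card ι : ℝ) ^ 2) ≤ r v ^ 2 := by
      intro v hv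
      have hv' := (Finset.mem_filter.1 hv).2
      refine (hlow (τ v)).trans ?_
      rcases hσ (τ v) with ⟨h3, h4⟩ | ⟨h3, h4⟩
      · have h5 : x v ≤ 0 := by
          by_contra h6; exact hv' (Or.inl ⟨h3, not_le.1 h6⟩)
        rw [hxv] at h5
        nlinarith
      · have h5 : 0 ≤ x v := by
          by_contra h6; exact hv' (Or.inr ⟨h3, not_le.1 h6⟩)
        rw [hxv] at h5
        nlinarith
    have h3 := Finset.sum_le_sum h2
    rw [Finset.sum_const, nsmul_eq_mul] at h3
    exact h3.trans (Finset.sum_le_sum_of_subset_of_nonneg (Finset.subset_univ _)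
      fun v _ _ => sq_nonneg _)
  have hg0 : g 0 ≠ 0 := by
    intro h; have := hlow 0; rw [h] at this; norm_num at this; linarith
  rcases lt_or_gt_of_ne hg0 with h | h
  · refine ⟨Equiv.swap 0 1, hfin _ fun k => ?_⟩
    have hg1 : 0 < g 1 := by
      by_contra h'; have := mul_pos_of_neg_of_neg h h; nlinarith [hm 0, hm 1, mul_neg_of_pos_of_neg (hm 0) h, mul_nonneg (hm 1).le (neg_nonneg.2 (not_lt.1 h'))]
    fin_cases k
    · exact Or.inr ⟨by simp, h⟩
    · exact Or.inl ⟨by simp, hg1⟩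
  · refine ⟨1, hfin _ fun k => ?_⟩
    have hg1 : g 1 < 0 := by
      by_contra h'
      have h3 := mul_pos (hm 0) h
      have h4 := mul_nonneg (hm 1).le (not_lt.1 h')
      linarith
    fin_cases k
    · exact Or.inl ⟨rfl, h⟩
    · exact Or.inr ⟨rfl, hg1⟩

theorem IsPerturbedBlock.exists_perm_wrongSide_le {B : Matrix ι ι ℝ} {N : ι → ι → ℝ}
    {τ : ι → Fin 2} {a b ν μ : ℝ} (h : IsPerturbedBlock B N τ a b ν) (hb : 0 ≤ b) (hab : b < a)
    (hμ0 : 0 < μ) (hμ : ∀ k, μ ≤ blockSize τ k) (hν0 : 0 ≤ ν) (hν : 6 * ν ≤ (a - b) * μ)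
    {x₁ x₂ : EuclideanSpace ℝ ι} (hx : IsTopEigenpair B x₁ x₂) :
    ∃ σ : Equiv.Perm (Fin 2), ((wrongSide τ (centered x₁ x₂) σ).card : ℝ) *
      (μ / (2 * (Fintype.card ι : ℝ) ^ 2)) ≤ 16 * (ν / ((a - b) * μ)) ^ 2 := by
  classical
  obtain ⟨u, ev, i₁, i₂, hu, hne, h21, hmax, rfl, rfl⟩ := hx
  have hsep : 0 < (a - b) * μ := mul_pos (sub_pos.2 hab) hμ0
  have hev2 := h.second_eigenvalue_ge hb hab.le hμ0 hμ u ev i₁ i₂ hu hmax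
  have hκ : 0 < (a - b) * μ / 2 := by positivity
  have hnorm : ∀ i, ∑ v, (u i).ofLp v ^ 2 = 1 := by
    intro i
    rw [← EuclideanSpace.real_norm_sq_eq, u.norm_eq_one]; norm_num
  have hr1 := h.blockResidual_eigenvector (hu i₁) hκ
    ((show (a - b) * μ / 2 ≤ _ by linarith).trans (le_abs_self _))
  have hr2 := h.blockResidual_eigenvector (hu i₂) hκ
    ((show (a - b) * μ / 2 ≤ _ by linarith).trans (le_abs_self _))
  rw [hnorm, mul_one] at hr1 hr2
  have hN : (0 : ℝ) < Fintype.card ι := by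
    have : Nonempty ι := ⟨i₁⟩
    exact_mod_cast Fintype.card_pos
  have hm : ∀ k, 0 < blockSize τ k := fun k => hμ0.trans_le (hμ k)
  refine SpectralPartition.exists_perm_wrongSide_le hμ0 hμ ?_ (centered_sq_ge u hne) ?_ ?_
  · simp only [centered]
    rw [Finset.sum_sub_distrib, Finset.sum_const, Finset.card_univ, nsmul_eq_mul, ← mul_assoc,
      mul_one_div_cancel hN.ne', one_mul, sub_self]
  · obtain ⟨σ, hσ, hres⟩ : ∃ σ : ℝ, σ ^ 2 = 1 ∧ ∀ v, blockResidual τ (centered (u i₁) (u i₂)) v =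
        blockResidual τ (u i₁).ofLp v + σ * blockResidual τ (u i₂).ofLp v := by
      have hlin : ∀ (σ t : ℝ) (v : ι),
          blockResidual τ (fun v => u i₁ v + σ * u i₂ v - t) v =
          blockResidual τ (u i₁).ofLp v + σ * blockResidual τ (u i₂).ofLp v := by
        intro σ t v
        have hmk := (hm (τ v)).ne'
        simp only [blockResidual, blockMean]
        rw [Finset.sum_sub_distrib, Finset.sum_add_distrib, ← Finset.mul_sum, Finset.sum_const,
          nsmul_eq_mul]
        rw [blockSize] at hmk
        field_simp
        ring
      by_cases h0 : 0 < (∑ v, u i₁ v) * (∑ v, u i₂ v)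
      · refine ⟨-1, by norm_num, fun v => ?_⟩
        rw [← hlin (-1) (1 / Fintype.card ι * ∑ w, (u i₁ w + (-u i₂) w))]
        congr 1
        funext w
        simp only [centered, if_pos h0, PiLp.neg_apply]
        ring
      · refine ⟨1, by norm_num, fun v => ?_⟩
        rw [← hlin 1 (1 / Fintype.card ι * ∑ w, (u i₁ w + u i₂ w))]
        congr 1
        funext w
        simp only [centered, if_neg h0]
        ring
    have hle : ∀ v, blockResidual τ (centered (u i₁) (u i₂)) v ^ 2 ≤
        2 * blockResidual τ (u i₁).ofLp v ^ 2 + 2 * blockResidual τ (u i₂).ofLp v ^ 2 := by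
      intro v
      rw [hres]
      nlinarith [sq_nonneg (blockResidual τ (u i₁).ofLp v - σ * blockResidual τ (u i₂).ofLp v)]
    refine (Finset.sum_le_sum fun v _ => hle v).trans ?_
    rw [Finset.sum_add_distrib, ← Finset.mul_sum, ← Finset.mul_sum]
    have : 16 * (ν / ((a - b) * μ)) ^ 2 = 4 * (ν / ((a - b) * μ / 2)) ^ 2 := by
      field_simp; ring
    rw [this]
    linarith
  · have h1 : ν / ((a - b) * μ) ≤ 1 / 6 := by
      rw [div_le_div_iff₀ hsep (by norm_num)]; linarith
    have h2 : 0 ≤ ν / ((a - b) * μ) := by positivity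
    nlinarith

end TwoClusters

/-! ### The trimmed matrix as a perturbed block matrix -/

open Classical in
theorem sum_extend {n : ℕ} (Γ : Finset (Fin n)) (x : Γ → ℝ) (f : Fin n → ℝ → ℝ)
    (hf : ∀ v, f v 0 = 0) :
    ∑ v, f v (if h : v ∈ Γ then x ⟨v, h⟩ else 0) = ∑ v : Γ, f v (x v) := by
  rw [← Finset.sum_subset (Finset.subset_univ Γ), ← Finset.sum_coe_sort Γ]
  · refine Finset.sum_congr rfl fun v _ => ?_
    rw [dif_pos v.2]
  · intro v _ hv
    rw [dif_neg hv, hf]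

theorem isPerturbedBlock_trimmed {n K : ℕ} {A : Matrix (Fin n) (Fin n) ℕ} {τ : Fin n → Fin K}
    {a b ν : ℝ} (hd : ∀ v, A v v = 0) (h : NormBound (kept K A) (deviation A (rate τ a b)) ν) :
    IsPerturbedBlock (trimmed K A) (fun v w => deviation A (rate τ a b) v w)
      (fun v : kept K A => τ v) a b ν where
  eq v w := by
    rw [trimmed, deviation, rate]
    by_cases hvw : v = w
    · subst hvw; simp [hd]
    · have : (v : Fin n) ≠ w := fun h => hvw (Subtype.ext h)
      rw [if_neg this, if_neg hvw]; ring
  norm x y := by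
    classical
    have h1 := h (fun v => if h : v ∈ kept K A then x ⟨v, h⟩ else 0)
      (fun v => if h : v ∈ kept K A then y ⟨v, h⟩ else 0)
      (fun v hv => dif_neg hv) (fun v hv => dif_neg hv)
    rw [sum_extend _ x (fun v t => t ^ 2) (by simp), sum_extend _ y (fun v t => t ^ 2) (by simp),
      sum_extend _ x (fun v t => ∑ w, t * deviation A (rate τ a b) v w *
        (if h : w ∈ kept K A then y ⟨w, h⟩ else 0)) (by simp)] at h1
    rw [Finset.sum_congr rfl fun v _ => sum_extend (kept K A) y
      (fun w t => x v * deviation A (rate τ a b) v w * t) (by simp)] at h1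
    exact h1

theorem blockSize_restrict {n K : ℕ} (τ : Fin n → Fin K) (Γ : Finset (Fin n)) (k : Fin K) :
    (clusterSize τ k : ℝ) - (Γᶜ.card : ℝ) ≤ blockSize (fun v : Γ => τ v) k := by
  classical
  have h1 : (blockSize (fun v : Γ => τ v) k) = ((Γ.filter fun v => τ v = k).card : ℝ) := by
    rw [blockSize, ← Finset.card_map (Function.Embedding.subtype (· ∈ Γ))]
    congr 2
    ext v
    simp only [Finset.mem_map, Finset.mem_filter, Finset.mem_univ, true_and,
      Function.Embedding.coe_subtype, Subtype.exists, exists_and_left]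
    constructor
    · rintro ⟨w, h1, h2, rfl⟩; exact ⟨h2, h1⟩
    · rintro ⟨h1, h2⟩; exact ⟨v, h2, h1, rfl⟩
  have h2 : (Finset.univ.filter fun v => τ v = k) ⊆ (Γ.filter fun v => τ v = k) ∪ Γᶜ := by
    intro v hv
    by_cases h : v ∈ Γ
    · exact Finset.mem_union_left _ (Finset.mem_filter.2 ⟨h, (Finset.mem_filter.1 hv).2⟩)
    · exact Finset.mem_union_right _ (Finset.mem_compl.2 h)
  have h3 := (Finset.card_le_card h2).trans (Finset.card_union_le _ _)
  have h4 : (clusterSize τ k : ℝ) ≤ ((Γ.filter fun v => τ v = k).card : ℝ) + (Γᶜ.card : ℝ) := by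
    have h5 : clusterSize τ k = (Finset.univ.filter fun v => τ v = k).card := by
      rw [clusterSize]
    rw [h5]
    exact_mod_cast h3
  rw [h1]; linarith

open Classical in
/-- With two clusters, the spectral step makes few errors. -/
theorem exists_perm_errors_le_of_signPartition {n : ℕ} (hn : 0 < n)
    {A : Matrix (Fin n) (Fin n) ℕ} {τ : Fin n → Fin 2} {a b ν α : ℝ} (hd : ∀ v, A v v = 0)
    (hb : 0 ≤ b) (hab : b < a) (hα : 0 < α) (hsize : ∀ k, α * n ≤ clusterSize τ k)
    (h : NormBound (kept 2 A) (deviation A (rate τ a b)) ν) (hν0 : 0 ≤ ν)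
    (hν : 12 * ν ≤ α * (n * (a - b))) (hΓ : 2 * ((kept 2 A)ᶜ.card : ℝ) ≤ α * n)
    {x₁ x₂ : EuclideanSpace ℝ (kept 2 A)} (hx : IsTopEigenpair (trimmed 2 A) x₁ x₂)
    {label : Fin n → Fin 2} (hlabel : label ∈ (signPartition (centered x₁ x₂)).support) :
    ∃ σ : Equiv.Perm (Fin 2), ((errors (σ ∘ τ) label).card : ℝ) ≤
      n * (256 / α ^ 3 * (ν / (n * (a - b))) ^ 2) + ((kept 2 A)ᶜ.card : ℝ) := by
  have hn' : (0 : ℝ) < n := by exact_mod_cast hn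
  have hP := isPerturbedBlock_trimmed (K := 2) hd h
  have hμ : ∀ k, α * n / 2 ≤ blockSize (fun v : kept 2 A => τ v) k := fun k => by
    have := blockSize_restrict τ (kept 2 A) k
    have := hsize k
    linarith
  obtain ⟨σ, hσ⟩ := hP.exists_perm_wrongSide_le hb hab (by positivity) hμ hν0 (by nlinarith) hx
  refine ⟨σ, ?_⟩
  rw [signPartition, PMF.mem_support_uniformOfFinset_iff, Fintype.mem_piFinset] at hlabel
  have hsub : errors (σ ∘ τ) label ⊆
      (wrongSide (fun v : kept 2 A => τ v) (centered x₁ x₂) σ).map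
        (Function.Embedding.subtype (· ∈ kept 2 A)) ∪ (kept 2 A)ᶜ := by
    intro v hv
    by_cases hvΓ : v ∈ kept 2 A
    · refine Finset.mem_union_left _ (Finset.mem_map.2 ⟨⟨v, hvΓ⟩, ?_, rfl⟩)
      refine Finset.mem_filter.2 ⟨Finset.mem_univ _, ?_⟩
      have hne : label v ≠ σ (τ v) := (Finset.mem_filter.1 hv).2
      have hl := hlabel v
      rw [sides, dif_pos hvΓ] at hl
      rintro (⟨h1, h2⟩ | ⟨h1, h2⟩)
      · rw [if_pos h2, Finset.mem_singleton] at hl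
        exact hne (hl.trans h1.symm)
      · rw [if_neg (not_lt.2 h2.le), if_pos h2, Finset.mem_singleton] at hl
        exact hne (hl.trans h1.symm)
    · exact Finset.mem_union_right _ (Finset.mem_compl.2 hvΓ)
  have h1 := (Finset.card_le_card hsub).trans (Finset.card_union_le _ _)
  rw [Finset.card_map] at h1
  have h2 : ((errors (σ ∘ τ) label).card : ℝ) ≤
      (wrongSide (fun v : kept 2 A => τ v) (centered x₁ x₂) σ).card + ((kept 2 A)ᶜ.card : ℝ) := by
    exact_mod_cast h1
  refine h2.trans (add_le_add_left ?_ _)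
  set W := ((wrongSide (fun v : kept 2 A => τ v) (centered x₁ x₂) σ).card : ℝ)
  have hc0 : (0 : ℝ) < (Fintype.card (kept 2 A) : ℝ) := by
    obtain ⟨u, ev, i, -⟩ := hx
    exact_mod_cast Fintype.card_pos_iff.2 ⟨i⟩
  have hc : (Fintype.card (kept 2 A) : ℝ) ≤ n := by
    have := Finset.card_le_univ (kept 2 A)
    rw [Fintype.card_fin] at this
    rw [Fintype.card_coe]
    exact_mod_cast this
  have h3 : W * (α / (4 * n)) ≤ 16 * (ν / ((a - b) * (α * n / 2))) ^ 2 := by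
    refine le_trans (mul_le_mul_of_nonneg_left ?_ (Nat.cast_nonneg _)) hσ
    rw [div_le_div_iff₀ (by positivity) (by positivity)]
    have : (Fintype.card (kept 2 A) : ℝ) ^ 2 ≤ n ^ 2 := by gcongr
    nlinarith
  have hd' := sub_pos.2 hab
  have h4 : 16 * (ν / ((a - b) * (α * n / 2))) ^ 2 =
      n * (256 / α ^ 3 * (ν / (n * (a - b))) ^ 2) * (α / (4 * n)) := by
    field_simp; ring
  rw [h4] at h3
  exact le_of_mul_le_mul_right h3 (by positivity)

/-! ### Singular vectors of the trimmed matrix -/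

section Orthonormal

variable {ι : Type} [Fintype ι]

theorem sum_mul_eq_ite (u : OrthonormalBasis ι ℝ (EuclideanSpace ℝ ι)) [DecidableEq ι] (i j : ι) :
    ∑ v, u i v * u j v = if i = j then 1 else 0 := by
  have := orthonormal_iff_ite.1 u.orthonormal i j
  rw [← this, PiLp.inner_apply]
  exact Finset.sum_congr rfl fun v _ => by simp [mul_comm]

theorem sum_sq_coeff (u : OrthonormalBasis ι ℝ (EuclideanSpace ℝ ι)) (z : ι → ℝ) :
    ∑ i, (∑ v, u i v * z v) ^ 2 = ∑ v, z v ^ 2 := by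
  have h1 := u.sum_sq_norm_inner_right (WithLp.toLp 2 z)
  rw [EuclideanSpace.real_norm_sq_eq] at h1
  rw [show ∑ v, z v ^ 2 = ∑ v, (WithLp.toLp 2 z : EuclideanSpace ℝ ι) v ^ 2 from rfl, ← h1]
  refine Finset.sum_congr rfl fun i _ => ?_
  rw [Real.norm_eq_abs, sq_abs, PiLp.inner_apply]
  congr 1
  exact Finset.sum_congr rfl fun v _ => by simp [mul_comm]

theorem norm_sum_smul_sq (u : OrthonormalBasis ι ℝ (EuclideanSpace ℝ ι)) (S : Finset ι)
    (t : ι → ℝ) : ‖∑ i ∈ S, t i • u i‖ ^ 2 = ∑ i ∈ S, t i ^ 2 := by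
  rw [← real_inner_self_eq_norm_sq, u.orthonormal.inner_sum]
  exact Finset.sum_congr rfl fun i _ => by simp [sq]

/-- `u` and `w` are bases of singular vectors of a symmetric matrix, with singular values `s`. -/
structure IsSymmSVD (B : Matrix ι ι ℝ) (u w : OrthonormalBasis ι ℝ (EuclideanSpace ℝ ι))
    (s : ι → ℝ) : Prop where
  symm : ∀ v w, B v w = B w v
  nonneg : ∀ i, 0 ≤ s i
  eq : ∀ a b, B a b = ∑ i, s i * u i a * w i b

variable {B : Matrix ι ι ℝ} {u w : OrthonormalBasis ι ℝ (EuclideanSpace ℝ ι)} {s : ι → ℝ}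

theorem IsSymmSVD.mulVec_right (h : IsSymmSVD B u w s) (i : ι) :
    B.mulVec (w i).ofLp = s i • (u i).ofLp := by
  classical
  funext x
  simp only [Matrix.mulVec, dotProduct, Pi.smul_apply, smul_eq_mul]
  have h1 : ∀ y, B x y * w i y = ∑ j, s j * u j x * (w j y * w i y) := by
    intro y; rw [h.eq, Finset.sum_mul]; exact Finset.sum_congr rfl fun j _ => by ring
  rw [Finset.sum_congr rfl fun y _ => h1 y, Finset.sum_comm]
  simp only [← Finset.mul_sum, sum_mul_eq_ite]
  simp

theorem IsSymmSVD.mulVec_left (h : IsSymmSVD B u w s) (i : ι) :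
    B.mulVec (u i).ofLp = s i • (w i).ofLp := by
  refine IsSymmSVD.mulVec_right (u := w) (w := u) ⟨h.symm, h.nonneg, fun a b => ?_⟩ i
  rw [h.symm, h.eq]
  exact Finset.sum_congr rfl fun j _ => by ring

/-- The quadratic form of the matrix is at most `κ` on the vectors that are orthogonal to the right
singular vectors with singular value larger than `κ`. -/
theorem IsSymmSVD.form_le (h : IsSymmSVD B u w s) {κ : ℝ} (hκ : 0 ≤ κ) (z : ι → ℝ)
    (hz : ∀ i, κ < s i → ∑ v, w i v * z v = 0) :
    ∑ v, z v * B.mulVec z v ≤ κ * ∑ v, z v ^ 2 := by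
  have h1 : ∑ v, z v * B.mulVec z v =
      ∑ i, s i * ((∑ v, u i v * z v) * (∑ v, w i v * z v)) := by
    have h2 : ∀ x, z x * B.mulVec z x =
        ∑ i, ∑ y, s i * ((u i x * z x) * (w i y * z y)) := by
      intro x
      rw [Finset.sum_comm, Matrix.mulVec, dotProduct, Finset.mul_sum]
      refine Finset.sum_congr rfl fun y _ => ?_
      rw [h.eq, Finset.sum_mul, Finset.mul_sum]
      exact Finset.sum_congr rfl fun i _ => by ring
    rw [Finset.sum_congr rfl fun x _ => h2 x, Finset.sum_comm]
    refine Finset.sum_congr rfl fun i _ => ?_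
    rw [Finset.sum_mul_sum, Finset.mul_sum]
    exact Finset.sum_congr rfl fun x _ => (Finset.mul_sum _ _ _).symm
  have h2 : ∀ i, s i * ((∑ v, u i v * z v) * (∑ v, w i v * z v)) ≤
      κ * (((∑ v, u i v * z v) ^ 2 + (∑ v, w i v * z v) ^ 2) / 2) := by
    intro i
    rcases lt_or_ge κ (s i) with hi | hi
    · rw [hz i hi, mul_zero, mul_zero]; positivity
    · refine (mul_le_mul_of_nonneg_left ?_ (h.nonneg i)).trans
        (mul_le_mul_of_nonneg_right hi (by positivity))
      nlinarith [sq_nonneg ((∑ v, u i v * z v) - ∑ v, w i v * z v)]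
  rw [h1]
  refine (Finset.sum_le_sum fun i _ => h2 i).trans_eq ?_
  rw [← Finset.mul_sum, ← Finset.sum_div, Finset.sum_add_distrib, sum_sq_coeff, sum_sq_coeff]
  ring

end Orthonormal

section TrimmedSVD

variable {n K : ℕ} {A : Matrix (Fin n) (Fin n) ℕ}

theorem trimmedPadded_symm (hs : A.IsSymm) (v w : Fin n) :
    trimmedPadded K A v w = trimmedPadded K A w v := by
  rw [trimmedPadded, trimmedPadded, hs.apply v w]
  simp only [and_comm]

theorem trimmedPadded_eq_zero {v : Fin n} (hv : v ∉ kept K A) (w : Fin n) :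
    trimmedPadded K A v w = 0 := if_neg fun h => hv h.1

theorem trimmedPadded_mulVec (x : Fin n → ℝ) (v : kept K A) :
    (trimmedPadded K A).mulVec x v = (trimmed K A).mulVec (fun w => x w) v := by
  classical
  simp only [Matrix.mulVec, dotProduct]
  rw [← Finset.sum_subset (Finset.subset_univ (kept K A)), ← Finset.sum_coe_sort (kept K A)]
  · refine Finset.sum_congr rfl fun w _ => ?_
    rw [trimmedPadded, if_pos ⟨v.2, w.2⟩, trimmed]
  · intro w _ hw
    rw [trimmedPadded, if_neg fun h => hw h.2, zero_mul]

variable {u w : OrthonormalBasis (Fin n) ℝ (EuclideanSpace ℝ (Fin n))} {s : Fin n → ℝ}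

/-- The first singular values are large. -/
theorem singular_value_ge (h : IsSymmSVD (trimmedPadded K A) u w s) (hs : Antitone s)
    {N : kept K A → kept K A → ℝ} {τ : Fin n → Fin K} {a b ν μ : ℝ}
    (hP : IsPerturbedBlock (trimmed K A) N (fun v : kept K A => τ v) a b ν) (hb : 0 ≤ b)
    (hab : b ≤ a) (hμ0 : 0 < μ) (hμ : ∀ k, μ ≤ blockSize (fun v : kept K A => τ v) k)
    {i : Fin n} (hi : (i : ℕ) < K) : (a - b) * μ - ν - a ≤ s i := by
  classical
  obtain ⟨c, hc0, hc⟩ : ∃ c : Fin K → ℝ, c ≠ 0 ∧ ∀ j : Fin i,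
      ∑ v, w ⟨j, j.2.trans i.2⟩ v * (if v ∈ kept K A then c (τ v) else 0) = 0 := by
    let f : (Fin K → ℝ) →ₗ[ℝ] (Fin i → ℝ) :=
      { toFun := fun c j => ∑ v, w ⟨j, j.2.trans i.2⟩ v * (if v ∈ kept K A then c (τ v) else 0)
        map_add' := fun c d => by
          funext j
          simp only [Pi.add_apply, ← Finset.sum_add_distrib]
          refine Finset.sum_congr rfl fun v _ => ?_
          split_ifs <;> ring
        map_smul' := fun t c => by
          funext j
          simp only [Pi.smul_apply, smul_eq_mul, RingHom.id_apply, Finset.mul_sum]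
          refine Finset.sum_congr rfl fun v _ => ?_
          split_ifs <;> ring }
    have hker := LinearMap.ker_ne_bot_of_finrank_lt (f := f) (by simpa using hi)
    obtain ⟨c, hc, hc0⟩ := (Submodule.ne_bot_iff _).1 hker
    exact ⟨c, hc0, fun j => congrFun (LinearMap.mem_ker.1 hc) j⟩
  set z : Fin n → ℝ := fun v => if v ∈ kept K A then c (τ v) else 0 with hz
  have h1 := h.form_le (h.nonneg i) z fun j hj => by
    have : j < i := by
      by_contra hji
      exact absurd (hs (not_lt.1 hji)) (not_le.2 hj)
    exact hc ⟨j, this⟩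
  have h2 := hP.form_ge hb hab hμ c
  have h3 : ∑ v, z v ^ 2 = ∑ v : kept K A, c (τ v) ^ 2 := by
    rw [← Finset.sum_subset (Finset.subset_univ (kept K A)), ← Finset.sum_coe_sort (kept K A)]
    · exact Finset.sum_congr rfl fun v _ => by rw [hz]; simp only [v.2, if_true]
    · intro v _ hv; simp [hz, hv]
  have h4 : ∑ v, z v * (trimmedPadded K A).mulVec z v =
      ∑ v : kept K A, c (τ v) * (trimmed K A).mulVec (fun v => c (τ v)) v := by
    rw [← Finset.sum_subset (Finset.subset_univ (kept K A)), ← Finset.sum_coe_sort (kept K A)]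
    · refine Finset.sum_congr rfl fun v _ => ?_
      rw [trimmedPadded_mulVec]
      have h5 : ∀ v : kept K A, z v = c (τ v) := fun v => by simp only [hz, v.2, if_true]
      rw [h5, funext h5]
    · intro v _ hv; simp [hz, hv]
  rw [h3, h4] at h1
  have hpos : 0 < ∑ v : kept K A, c (τ v) ^ 2 := by
    rw [sum_comp_block (fun v : kept K A => τ v) fun k => c k ^ 2]
    obtain ⟨k, hk⟩ := Function.ne_iff.1 hc0
    have hm : ∀ k, 0 < blockSize (fun v : kept K A => τ v) k := fun k => hμ0.trans_le (hμ k)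
    have hk' : c k ≠ 0 := hk
    exact Finset.sum_pos' (fun k _ => mul_nonneg (hm k).le (sq_nonneg _))
      ⟨k, Finset.mem_univ _, mul_pos (hm k) (by positivity)⟩
  exact le_of_mul_le_mul_right (h2.trans h1) hpos

theorem singular_vector_support (h : IsSymmSVD (trimmedPadded K A) u w s) {i : Fin n}
    (hi : 0 < s i) {v : Fin n} (hv : v ∉ kept K A) : u i v = 0 ∧ w i v = 0 := by
  have hz : ∀ x : Fin n → ℝ, (trimmedPadded K A).mulVec x v = 0 := by
    intro x
    rw [Matrix.mulVec, dotProduct]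
    exact Finset.sum_eq_zero fun w _ => by rw [trimmedPadded_eq_zero hv, zero_mul]
  have h1 := congrFun (h.mulVec_right i) v
  have h2 := congrFun (h.mulVec_left i) v
  rw [hz, Pi.smul_apply, smul_eq_mul] at h1 h2
  exact ⟨(mul_eq_zero.1 h1.symm).resolve_left hi.ne', (mul_eq_zero.1 h2.symm).resolve_left hi.ne'⟩

/-- The first singular vectors are almost constant on the clusters. -/
theorem sum_blockResidual_singular_vector_le (h : IsSymmSVD (trimmedPadded K A) u w s)
    {N : kept K A → kept K A → ℝ} {τ : Fin n → Fin K} {a b ν κ : ℝ}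
    (hP : IsPerturbedBlock (trimmed K A) N (fun v : kept K A => τ v) a b ν) (ha : 0 ≤ a)
    (hκ : 0 < κ) {i : Fin n} (hi : κ + a ≤ s i) :
    ∑ v, blockResidual (fun v : kept K A => τ v) (fun v => u i v) v ^ 2 ≤ 2 * (ν / κ) ^ 2 := by
  classical
  have hle : ∀ x : EuclideanSpace ℝ (Fin n), ‖x‖ = 1 → ∑ v : kept K A, x v ^ 2 ≤ 1 := by
    intro x hx
    rw [Finset.sum_coe_sort (kept K A) fun v => x v ^ 2]
    refine (Finset.sum_le_sum_of_subset_of_nonneg (Finset.subset_univ _)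
      fun v _ _ => sq_nonneg _).trans ?_
    rw [← EuclideanSpace.real_norm_sq_eq, hx]; norm_num
  have heig : ∀ e : ℝ, e ^ 2 = 1 →
      (trimmed K A).mulVec (fun v => u i v + e * w i v) =
        (e * s i) • fun v : kept K A => u i v + e * w i v := by
    intro e he
    funext v
    rw [← trimmedPadded_mulVec (fun v => u i v + e * w i v) v]
    have h1 := congrFun (h.mulVec_right i) v
    have h2 := congrFun (h.mulVec_left i) v
    have h3 : (fun v => u i v + e * w i v) = (u i).ofLp + e • (w i).ofLp := rfl
    rw [h3, Matrix.mulVec_add, Matrix.mulVec_smul, Pi.add_apply, Pi.smul_apply, h1, h2]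
    simp only [Pi.smul_apply, smul_eq_mul]
    linear_combination (-(s i * w i v)) * he
  have h1 := hP.blockResidual_eigenvector (heig 1 (by norm_num)) hκ
    ((show κ ≤ _ by linarith).trans (le_abs_self _))
  have h2 := hP.blockResidual_eigenvector (heig (-1) (by norm_num)) hκ
    ((show κ ≤ _ by linarith).trans (neg_le_abs _))
  have hlin : ∀ v, blockResidual (fun v : kept K A => τ v) (fun v => u i v) v =
      (blockResidual (fun v : kept K A => τ v) (fun v => u i v + 1 * w i v) v +
      blockResidual (fun v : kept K A => τ v) (fun v => u i v + -1 * w i v) v) / 2 := by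
    intro v
    simp only [blockResidual, blockMean, Finset.sum_add_distrib, ← Finset.mul_sum]
    ring
  have h3 : ∑ v, blockResidual (fun v : kept K A => τ v) (fun v => u i v) v ^ 2 ≤
      (∑ v, blockResidual (fun v : kept K A => τ v) (fun v => u i v + 1 * w i v) v ^ 2 +
      ∑ v, blockResidual (fun v : kept K A => τ v) (fun v => u i v + -1 * w i v) v ^ 2) / 2 := by
    rw [← Finset.sum_add_distrib, Finset.sum_div]
    refine Finset.sum_le_sum fun v _ => ?_
    rw [hlin]
    nlinarith [sq_nonneg (blockResidual (fun v : kept K A => τ v) (fun v => u i v + 1 * w i v) v -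
      blockResidual (fun v : kept K A => τ v) (fun v => u i v + -1 * w i v) v)]
  have h4 : (∑ v : kept K A, (u i v + 1 * w i v) ^ 2) + ∑ v : kept K A, (u i v + -1 * w i v) ^ 2 =
      2 * ∑ v : kept K A, u i v ^ 2 + 2 * ∑ v : kept K A, w i v ^ 2 := by
    rw [Finset.mul_sum, Finset.mul_sum, ← Finset.sum_add_distrib, ← Finset.sum_add_distrib]
    exact Finset.sum_congr rfl fun v _ => by ring
  have h5 := hle (u i) (u.norm_eq_one i)
  have h6 := hle (w i) (w.norm_eq_one i)
  have h7 : 0 ≤ (ν / κ) ^ 2 := sq_nonneg _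
  have h8 : (ν / κ) ^ 2 * ((∑ v : kept K A, (u i v + 1 * w i v) ^ 2) +
      ∑ v : kept K A, (u i v + -1 * w i v) ^ 2) ≤ (ν / κ) ^ 2 * 4 := by
    rw [h4]
    exact mul_le_mul_of_nonneg_left (by linarith) h7
  linarith

end TrimmedSVD

/-! ### The columns of the low rank approximation are clustered -/

/-- The points `x v`, `v ∈ Γ`, are close to the center of their cluster, and the centers are
separated; the other points are zero. -/
structure IsClustered {n K : ℕ} {E : Type} [NormedAddCommGroup E] (x : Fin n → E)
    (Γ : Finset (Fin n)) (τ : Fin n → Fin K) (c : Fin K → E) (S H L : ℝ) : Prop where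
  zero : ∀ v ∉ Γ, x v = 0
  error : ∑ v ∈ Γ, ‖x v - c (τ v)‖ ^ 2 ≤ S
  center : ∀ k, ‖c k‖ ^ 2 ≤ H
  sep : ∀ k l, k ≠ l → L ≤ ‖c k - c l‖ ^ 2

theorem blockSize_nonneg {ι : Type} [Fintype ι] {K : ℕ} (τ : ι → Fin K) (k : Fin K) :
    0 ≤ blockSize τ k := Nat.cast_nonneg _

section Coefficients

variable {n K : ℕ} {Γ : Finset (Fin n)}

/-- The inner product with the normalized indicator of a cluster. -/
def clusterCoeff (Γ : Finset (Fin n)) (τ : Fin n → Fin K) (x : Fin n → ℝ) (k : Fin K) : ℝ :=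
  √(blockSize (fun v : Γ => τ v) k) * blockMean (fun v : Γ => τ v) (fun v => x v) k

open Classical in
/-- The normalized indicator of the kept nodes of a cluster. -/
def clusterVector (Γ : Finset (Fin n)) (τ : Fin n → Fin K) (k : Fin K) (v : Fin n) : ℝ :=
  if v ∈ Γ ∧ τ v = k then (√(blockSize (fun v : Γ => τ v) k))⁻¹ else 0

open Classical in
theorem sum_filter_coe (Γ : Finset (Fin n)) (τ : Fin n → Fin K) (x : Fin n → ℝ) (k : Fin K) :
    ∑ v ∈ Finset.univ.filter (fun v : Γ => τ v = k), x v =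
      ∑ v, if v ∈ Γ ∧ τ v = k then x v else 0 := by
  rw [Finset.sum_filter, Finset.sum_coe_sort Γ fun v => if τ v = k then x v else 0,
    ← Finset.sum_filter, ← Finset.sum_filter]
  refine Finset.sum_congr ?_ fun _ _ => rfl
  ext v; simp

theorem sum_filter_eq_blockSize_mul {ι : Type} [Fintype ι] [DecidableEq (Fin K)] {τ : ι → Fin K}
    {k : Fin K} (hm : 0 < blockSize τ k) (x : ι → ℝ) :
    ∑ v ∈ Finset.univ.filter (fun v => τ v = k), x v = blockSize τ k * blockMean τ x k := by
  rw [blockMean]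
  rw [blockSize] at hm ⊢
  field_simp
  congr!

theorem sum_mul_clusterVector {τ : Fin n → Fin K} {k : Fin K}
    (hm : 0 < blockSize (fun v : Γ => τ v) k) (x : Fin n → ℝ) :
    ∑ v, x v * clusterVector Γ τ k v = clusterCoeff Γ τ x k := by
  classical
  have h1 : ∑ v, x v * clusterVector Γ τ k v =
      (√(blockSize (fun v : Γ => τ v) k))⁻¹ * ∑ v, if v ∈ Γ ∧ τ v = k then x v else 0 := by
    rw [Finset.mul_sum]
    refine Finset.sum_congr rfl fun v _ => ?_
    rw [clusterVector]; split_ifs <;> ring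
  have h2 := sum_filter_coe Γ τ x k
  rw [h1, ← h2, sum_filter_eq_blockSize_mul (τ := fun v : Γ => τ v) hm, clusterCoeff, ← mul_assoc]
  congr 1
  rw [inv_mul_eq_div, Real.div_sqrt]

theorem sum_clusterVector_mul {τ : Fin n → Fin K} (hm : ∀ k, 0 < blockSize (fun v : Γ => τ v) k)
    (k l : Fin K) : ∑ v, clusterVector Γ τ k v * clusterVector Γ τ l v = if k = l then 1 else 0 := by
  classical
  rw [sum_mul_clusterVector (hm l), clusterCoeff, blockMean,
    sum_filter_coe Γ τ (clusterVector Γ τ k) l]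
  split_ifs with h
  · subst h
    have h1 : ∑ v, (if v ∈ Γ ∧ τ v = k then clusterVector Γ τ k v else 0) =
        (√(blockSize (fun v : Γ => τ v) k))⁻¹ * ∑ v, if v ∈ Γ ∧ τ v = k then 1 else 0 := by
      rw [Finset.mul_sum]
      refine Finset.sum_congr rfl fun v _ => ?_
      rw [clusterVector]; split_ifs <;> ring
    have h2 := sum_filter_coe Γ τ (fun _ => 1) k
    rw [h1, ← h2, sum_filter_eq_blockSize_mul (τ := fun v : Γ => τ v) (hm k)]
    have h3 : blockMean (fun v : Γ => τ v) (fun _ => 1) k = 1 := by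
      have h4 := hm k
      rw [blockSize] at h4
      rw [blockMean, Finset.sum_const, nsmul_eq_mul, mul_one, div_self h4.ne']
    have h5 := Real.sqrt_pos.2 (hm k)
    have h6 := Real.sq_sqrt (hm k).le
    change √(blockSize (fun v : Γ => τ v) k) * ((√(blockSize (fun v : Γ => τ v) k))⁻¹ *
      (blockSize (fun v : Γ => τ v) k * blockMean (fun v : Γ => τ v) (fun _ => 1) k) /
        blockSize (fun v : Γ => τ v) k) = 1
    rw [h3]
    have := (hm k).ne'
    field_simp
  · rw [Finset.sum_eq_zero, zero_div, mul_zero]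
    intro v _
    split_ifs with h1
    · rw [clusterVector, if_neg]; rintro ⟨-, h2⟩; exact h (h2.symm.trans h1.2)
    · rfl

theorem sum_clusterCoeff_sq (τ : Fin n → Fin K) (x : Fin n → ℝ) :
    ∑ k, clusterCoeff Γ τ x k ^ 2 = ∑ v : Γ, x v ^ 2 -
      ∑ v, blockResidual (fun v : Γ => τ v) (fun v => x v) v ^ 2 := by
  have h1 : ∑ k, clusterCoeff Γ τ x k ^ 2 =
      ∑ v : Γ, blockMean (fun v : Γ => τ v) (fun v => x v) (τ v) ^ 2 := by
    rw [sum_comp_block (fun v : Γ => τ v)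
      fun k => blockMean (fun v : Γ => τ v) (fun v => x v) k ^ 2]
    refine Finset.sum_congr rfl fun k _ => ?_
    rw [clusterCoeff, mul_pow, Real.sq_sqrt (blockSize_nonneg _ _)]
  have h2 := sum_blockResidual_mul (fun v : Γ => τ v) (fun v => x v)
    (blockMean (fun v : Γ => τ v) (fun v => x v))
  have h3 : ∀ v : Γ, x v = blockMean (fun v : Γ => τ v) (fun v => x v) (τ v) +
      blockResidual (fun v : Γ => τ v) (fun v => x v) v := fun v => by rw [blockResidual]; ring
  have h4 : ∑ v : Γ, x v ^ 2 = ∑ v : Γ, blockMean (fun v : Γ => τ v) (fun v => x v) (τ v) ^ 2 +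
      ∑ v, blockResidual (fun v : Γ => τ v) (fun v => x v) v ^ 2 +
      2 * ∑ v, blockResidual (fun v : Γ => τ v) (fun v => x v) v *
        blockMean (fun v : Γ => τ v) (fun v => x v) (τ v) := by
    rw [Finset.mul_sum, ← Finset.sum_add_distrib, ← Finset.sum_add_distrib]
    refine Finset.sum_congr rfl fun v _ => ?_
    rw [blockResidual]; ring
  rw [h1, h4, h2]; ring

end Coefficients

/-- An almost orthonormal family: if `f k` are orthonormal and the coefficients of `f k` on the
first `K` vectors of an orthonormal basis have almost full mass, so has each combination of two of
them. -/
theorem sum_sq_comb_ge {n K : ℕ} (u : OrthonormalBasis (Fin n) ℝ (EuclideanSpace ℝ (Fin n)))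
    {f : Fin K → Fin n → ℝ} (hf : ∀ k l, ∑ v, f k v * f l v = if k = l then 1 else 0)
    {S : Finset (Fin n)} (hS : S.card = K) {ε : ℝ}
    (hε : ∀ i ∈ S, 1 - ε ≤ ∑ k, (∑ v, u i v * f k v) ^ 2) {k l : Fin K} (hkl : k ≠ l)
    (x y : ℝ) : (1 - 2 * (K * ε)) * (x ^ 2 + y ^ 2) ≤
      ∑ i ∈ S, (x * (∑ v, u i v * f k v) - y * (∑ v, u i v * f l v)) ^ 2 := by
  classical
  have h1 : ∀ k, ∑ i, (∑ v, u i v * f k v) ^ 2 = 1 := by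
    intro k
    rw [sum_sq_coeff]
    simpa [sq] using hf k k
  have hall : ∑ i, (x * (∑ v, u i v * f k v) - y * (∑ v, u i v * f l v)) ^ 2 = x ^ 2 + y ^ 2 := by
    have h2 : ∀ i, x * (∑ v, u i v * f k v) - y * (∑ v, u i v * f l v) =
        ∑ v, u i v * (x * f k v - y * f l v) := by
      intro i
      rw [Finset.mul_sum, Finset.mul_sum, ← Finset.sum_sub_distrib]
      exact Finset.sum_congr rfl fun v _ => by ring
    rw [Finset.sum_congr rfl fun i _ => by rw [h2 i], sum_sq_coeff]
    have h3 : ∀ v, (x * f k v - y * f l v) ^ 2 =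
        x ^ 2 * (f k v * f k v) + y ^ 2 * (f l v * f l v) - 2 * x * y * (f k v * f l v) := by
      intro v; ring
    rw [Finset.sum_congr rfl fun v _ => h3 v, Finset.sum_sub_distrib, Finset.sum_add_distrib,
      ← Finset.mul_sum, ← Finset.mul_sum, ← Finset.mul_sum, hf, hf, hf, if_pos rfl, if_pos rfl,
      if_neg hkl]
    ring
  have hout : ∑ i ∈ Sᶜ, ∑ k, (∑ v, u i v * f k v) ^ 2 ≤ K * ε := by
    have h2 : ∑ i, ∑ k, (∑ v, u i v * f k v) ^ 2 = K := by
      rw [Finset.sum_comm, Finset.sum_congr rfl fun k _ => h1 k]; simp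
    have h3 := Finset.sum_le_sum hε
    rw [Finset.sum_const, hS, nsmul_eq_mul] at h3
    rw [← Finset.sum_add_sum_compl S] at h2
    linarith
  have hrest : ∑ i ∈ Sᶜ, (x * (∑ v, u i v * f k v) - y * (∑ v, u i v * f l v)) ^ 2 ≤
      2 * (K * ε) * (x ^ 2 + y ^ 2) := by
    have h2 : ∀ i ∈ Sᶜ, (x * (∑ v, u i v * f k v) - y * (∑ v, u i v * f l v)) ^ 2 ≤
        2 * (x ^ 2 + y ^ 2) * ∑ k, (∑ v, u i v * f k v) ^ 2 := by
      intro i _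
      have h3 : ∀ k, (∑ v, u i v * f k v) ^ 2 ≤ ∑ k, (∑ v, u i v * f k v) ^ 2 := fun k =>
        Finset.single_le_sum (f := fun k => (∑ v, u i v * f k v) ^ 2) (fun k _ => sq_nonneg _)
          (Finset.mem_univ k)
      have h4 := mul_le_mul_of_nonneg_left (h3 k) (sq_nonneg x)
      have h5 := mul_le_mul_of_nonneg_left (h3 l) (sq_nonneg y)
      nlinarith [sq_nonneg (x * (∑ v, u i v * f k v) + y * (∑ v, u i v * f l v))]
    have h3 := Finset.sum_le_sum h2
    rw [← Finset.mul_sum] at h3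
    nlinarith [sq_nonneg x, sq_nonneg y]
  rw [← Finset.sum_add_sum_compl S] at hall
  linarith

open Classical in
theorem sum_block_mul {ι : Type} [Fintype ι] {K : ℕ} (τ : ι → Fin K) (a b : ℝ) {k : Fin K}
    (hm : 0 < blockSize τ k) (x : ι → ℝ) :
    ∑ w, (if k = τ w then a else b) * x w =
      b * (∑ w, x w) + (a - b) * (blockSize τ k * blockMean τ x k) := by
  rw [← sum_filter_eq_blockSize_mul hm, Finset.sum_filter, Finset.mul_sum, Finset.mul_sum,
    ← Finset.sum_add_distrib]
  refine Finset.sum_congr rfl fun w _ => ?_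
  by_cases h : τ w = k
  · rw [if_pos h, if_pos h.symm]; ring
  · rw [if_neg h, if_neg (Ne.symm h)]; ring

open Classical in
/-- The center around which the columns of a cluster of the trimmed matrix lie, in the coordinates
given by the left singular vectors. -/
def centerCoeff {n K : ℕ} (Γ : Finset (Fin n)) (τ : Fin n → Fin K) (a b : ℝ) (x : Fin n → ℝ)
    (k : Fin K) : ℝ :=
  (∑ w : Γ, (if k = τ w then a else b) * x w) - a * blockMean (fun v : Γ => τ v) (fun v => x v) k

theorem centerCoeff_sub {n K : ℕ} {Γ : Finset (Fin n)} {τ : Fin n → Fin K} (a b : ℝ)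
    (hm : ∀ k, 0 < blockSize (fun v : Γ => τ v) k) (x : Fin n → ℝ) (k l : Fin K) :
    centerCoeff Γ τ a b x k - centerCoeff Γ τ a b x l =
      ((a - b) * blockSize (fun v : Γ => τ v) k - a) / √(blockSize (fun v : Γ => τ v) k) *
        clusterCoeff Γ τ x k -
      ((a - b) * blockSize (fun v : Γ => τ v) l - a) / √(blockSize (fun v : Γ => τ v) l) *
        clusterCoeff Γ τ x l := by
  rw [centerCoeff, centerCoeff, sum_block_mul (fun v : Γ => τ v) a b (hm k) fun v => x v,
    sum_block_mul (fun v : Γ => τ v) a b (hm l) fun v => x v, clusterCoeff, clusterCoeff]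
  have hk := (Real.sqrt_pos.2 (hm k)).ne'
  have hl := (Real.sqrt_pos.2 (hm l)).ne'
  field_simp
  ring

open Classical in
theorem sum_centerCoeff_sq_le {n K : ℕ} {Γ : Finset (Fin n)} {τ : Fin n → Fin K} {a b : ℝ}
    (hb : 0 ≤ b) (hab : b ≤ a) {k : Fin K} (hm : 1 ≤ blockSize (fun v : Γ => τ v) k)
    (u : OrthonormalBasis (Fin n) ℝ (EuclideanSpace ℝ (Fin n))) (S : Finset (Fin n)) :
    ∑ i ∈ S, centerCoeff Γ τ a b (u i).ofLp k ^ 2 ≤ a ^ 2 * n := by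
  have ha : 0 ≤ a := hb.trans hab
  set m := blockSize (fun v : Γ => τ v) k with hmdef
  have hm0 : 0 < m := by linarith
  set g : Fin n → ℝ := fun v => if v ∈ Γ then (if k = τ v then a - a / m else b) else 0 with hg
  have h1 : ∀ x : Fin n → ℝ, centerCoeff Γ τ a b x k = ∑ v, x v * g v := by
    intro x
    have h2 : blockMean (fun v : Γ => τ v) (fun v => x v) k =
        (∑ w : Γ, if τ w = k then x w else 0) / m := by
      rw [eq_div_iff hm0.ne', mul_comm, hmdef, ← sum_filter_eq_blockSize_mul hm0,
        Finset.sum_filter]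
    rw [centerCoeff, h2, ← Finset.sum_subset (Finset.subset_univ Γ), ← Finset.sum_coe_sort Γ,
      Finset.sum_div, Finset.mul_sum, ← Finset.sum_sub_distrib]
    · refine Finset.sum_congr rfl fun v _ => ?_
      simp only [hg, v.2, if_true]
      by_cases h : τ v = k
      · rw [if_pos h, if_pos h.symm, if_pos h.symm]; ring
      · rw [if_neg h, if_neg (Ne.symm h), if_neg (Ne.symm h)]; ring
    · intro v _ hv; simp [hg, hv]
  have h2 : ∀ v, g v ^ 2 ≤ a ^ 2 := by
    intro v
    have h3 : a / m ≤ a := div_le_self ha hm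
    have h4 : 0 ≤ a / m := by positivity
    refine sq_le_sq' ?_ ?_ <;> simp only [hg] <;> split_ifs <;> linarith
  refine (Finset.sum_le_sum_of_subset_of_nonneg (Finset.subset_univ S)
    fun v _ _ => sq_nonneg _).trans ?_
  rw [Finset.sum_congr rfl fun i _ => by rw [h1], sum_sq_coeff]
  refine (Finset.sum_le_sum fun v _ => h2 v).trans ?_
  rw [Finset.sum_const, Finset.card_univ, Fintype.card_fin, nsmul_eq_mul, mul_comm]

theorem card_le_of_blockSize_pos {n K : ℕ} {Γ : Finset (Fin n)} {τ : Fin n → Fin K}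
    (hm : ∀ k, 0 < blockSize (fun v : Γ => τ v) k) : K ≤ n := by
  classical
  have h1 : Function.Surjective τ := by
    intro k
    have h2 := hm k
    rw [blockSize, Nat.cast_pos, Finset.card_pos] at h2
    obtain ⟨v, hv⟩ := h2
    exact ⟨v, (Finset.mem_filter.1 hv).2⟩
  simpa using Fintype.card_le_of_surjective τ h1

open Classical in
/-- The columns of the rank `K` approximation of the trimmed matrix are clustered. -/
theorem exists_isClustered_column {n K : ℕ} {A : Matrix (Fin n) (Fin n) ℕ} (hs : A.IsSymm)
    (hd : ∀ v, A v v = 0) {τ : Fin n → Fin K} {a b ν μ : ℝ} (hb : 0 ≤ b) (hab : b < a)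
    (hμ0 : 0 < μ) (hμ : ∀ k, μ ≤ blockSize (fun v : kept K A => τ v) k)
    (hN : NormBound (kept K A) (deviation A (rate τ a b)) ν) (hν0 : 0 ≤ ν)
    (hsep : 2 * ν + 4 * a ≤ (a - b) * μ) (hν : 32 * K * ν ^ 2 ≤ ((a - b) * μ) ^ 2)
    {Ahat : Matrix (Fin n) (Fin n) ℝ} (h : IsRankApprox K (trimmedPadded K A) Ahat) :
    ∃ c : Fin K → EuclideanSpace ℝ (Fin n), IsClustered (column Ahat) (kept K A) τ c
      (6 * K * ν ^ 2) (a ^ 2 * n) (μ * (a - b) ^ 2 / 4) := by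
  obtain ⟨u, w, s, hanti, hs0, hB, hA⟩ := h
  have hsvd : IsSymmSVD (trimmedPadded K A) u w s := ⟨trimmedPadded_symm hs, hs0, hB⟩
  have hP := isPerturbedBlock_trimmed (K := K) hd hN
  have ha : 0 ≤ a := hb.trans hab.le
  have hd' : 0 < a - b := sub_pos.2 hab
  have hm : ∀ k, 0 < blockSize (fun v : kept K A => τ v) k := fun k => hμ0.trans_le (hμ k)
  set Γ := kept K A with hΓ
  set m : Fin K → ℝ := fun k => blockSize (fun v : Γ => τ v) k with hmdef
  set S := Finset.univ.filter (fun i : Fin n => (i : ℕ) < K) with hS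
  have hScard : S.card = K := by
    have h1 := card_le_of_blockSize_pos hm
    have h2 : S = (Finset.univ : Finset (Fin K)).map (Fin.castLEEmb h1) := by
      ext i
      simp only [hS, Finset.mem_filter, Finset.mem_univ, true_and, Finset.mem_map]
      constructor
      · intro hi; exact ⟨⟨i, hi⟩, rfl⟩
      · rintro ⟨j, rfl⟩; exact j.2
    rw [h2, Finset.card_map, Finset.card_univ, Fintype.card_fin]
  set κ := (a - b) * μ / 2 with hκ
  have hκ0 : 0 < κ := by positivity
  have hsi : ∀ i ∈ S, κ + a ≤ s i := by
    intro i hi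
    have := singular_value_ge hsvd hanti hP hb hab.le hμ0 hμ (Finset.mem_filter.1 hi).2
    linarith
  have hres : ∀ i ∈ S, ∑ v, blockResidual (fun v : Γ => τ v) (fun v => u i v) v ^ 2 ≤
      2 * (ν / κ) ^ 2 := fun i hi =>
    sum_blockResidual_singular_vector_le hsvd hP ha hκ0 (hsi i hi)
  have hsupp : ∀ i ∈ S, ∀ v, v ∉ Γ → u i v = 0 ∧ w i v = 0 := fun i hi v hv =>
    singular_vector_support hsvd (by linarith [hsi i hi]) hv
  have hcol : ∀ v, column Ahat v = ∑ i ∈ S, (s i * w i v) • u i := by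
    intro v
    ext x
    rw [column]
    simp only [hA]
    rw [WithLp.ofLp_sum, Finset.sum_apply]
    refine Finset.sum_congr rfl fun i _ => ?_
    simp only [PiLp.smul_apply, smul_eq_mul]
    ring
  refine ⟨fun k => ∑ i ∈ S, centerCoeff Γ τ a b (u i).ofLp k • u i, ?_, ?_, ?_, ?_⟩
  · intro v hv
    rw [hcol]
    exact Finset.sum_eq_zero fun i hi => by rw [(hsupp i hi v hv).2, mul_zero, zero_smul]
  · have herr : ∀ v : Γ, ‖column Ahat v - ∑ i ∈ S, centerCoeff Γ τ a b (u i).ofLp (τ v) • u i‖ ^ 2 ≤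
        ∑ i ∈ S, (2 * (∑ x, deviation A (rate τ a b) v x * u i x) ^ 2 +
          2 * a ^ 2 * blockResidual (fun v : Γ => τ v) (fun v => u i v) v ^ 2) := by
      intro v
      rw [hcol, ← Finset.sum_sub_distrib]
      simp only [← sub_smul]
      rw [norm_sum_smul_sq]
      refine Finset.sum_le_sum fun i hi => ?_
      have h1 : s i * w i v = (trimmed K A).mulVec (fun x => u i x) v := by
        rw [← trimmedPadded_mulVec (u i).ofLp v, hsvd.mulVec_left]; rfl
      have h2 : ∑ x : Γ, deviation A (rate τ a b) v x * u i x =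
          ∑ x, deviation A (rate τ a b) v x * u i x := by
        rw [Finset.sum_coe_sort Γ fun x => deviation A (rate τ a b) v x * u i x]
        refine Finset.sum_subset (Finset.subset_univ Γ) fun x _ hx => ?_
        rw [(hsupp i hi x hx).1, mul_zero]
      have h3 : s i * w i v - centerCoeff Γ τ a b (u i).ofLp (τ v) =
          (∑ x, deviation A (rate τ a b) v x * u i x) -
            a * blockResidual (fun v : Γ => τ v) (fun v => u i v) v := by
        rw [h1, hP.mulVec, h2, centerCoeff, blockResidual]
        ring
      rw [h3]
      nlinarith [sq_nonneg ((∑ x, deviation A (rate τ a b) v x * u i x) +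
            a * blockResidual (fun v : Γ => τ v) (fun v => u i v) v)]
    rw [← Finset.sum_coe_sort Γ]
    refine (Finset.sum_le_sum fun v _ => herr v).trans ?_
    rw [Finset.sum_comm]
    have h1 : ∀ i ∈ S, ∑ v : Γ, (2 * (∑ x, deviation A (rate τ a b) v x * u i x) ^ 2 +
          2 * a ^ 2 * blockResidual (fun v : Γ => τ v) (fun v => u i v) v ^ 2) ≤ 6 * ν ^ 2 := by
      intro i hi
      rw [Finset.sum_add_distrib, ← Finset.mul_sum, ← Finset.mul_sum,
        Finset.sum_coe_sort Γ fun v => (∑ x, deviation A (rate τ a b) v x * u i x) ^ 2]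
      have h2 := hN.sum_sq_le (y := (u i).ofLp) fun v hv => (hsupp i hi v hv).1
      rw [← EuclideanSpace.real_norm_sq_eq, u.norm_eq_one, one_pow, mul_one] at h2
      have h3 := mul_le_mul_of_nonneg_left (hres i hi) (by positivity : 0 ≤ 2 * a ^ 2)
      have h4 : a ^ 2 * (ν / κ) ^ 2 ≤ ν ^ 2 := by
        rw [div_pow, mul_div_assoc', div_le_iff₀ (by positivity), mul_comm]
        have : a ^ 2 ≤ κ ^ 2 := pow_le_pow_left₀ ha (by linarith) 2
        exact mul_le_mul_of_nonneg_left this (sq_nonneg _)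
      linarith
    refine (Finset.sum_le_sum h1).trans_eq ?_
    rw [Finset.sum_const, hScard, nsmul_eq_mul]; ring
  · intro k
    rw [norm_sum_smul_sq]
    refine sum_centerCoeff_sq_le hb hab.le ?_ u S
    have h1 := hm k
    rw [blockSize, Nat.cast_pos] at h1
    rw [blockSize]
    exact_mod_cast h1
  · intro k l hkl
    rw [← Finset.sum_sub_distrib]
    simp only [← sub_smul]
    rw [norm_sum_smul_sq, Finset.sum_congr rfl fun i _ => by rw [centerCoeff_sub a b hm]]
    have h1 := sum_sq_comb_ge u (f := clusterVector Γ τ) (sum_clusterVector_mul hm) hScard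
      (ε := 2 * (ν / κ) ^ 2) (fun i hi => ?_) hkl
      (((a - b) * m k - a) / √(m k)) (((a - b) * m l - a) / √(m l))
    · simp only [sum_mul_clusterVector (hm _)] at h1
      refine le_trans ?_ h1
      have h2 : ∀ k, μ * (a - b) ^ 2 / 4 ≤ (((a - b) * m k - a) / √(m k)) ^ 2 := by
        intro k
        rw [div_pow, Real.sq_sqrt (hm k).le, le_div_iff₀ (hm k)]
        have h3 : (a - b) * m k / 2 ≤ (a - b) * m k - a := by
          have := mul_le_mul_of_nonneg_left (hμ k) hd'.le
          linarith
        have h4 : ((a - b) * m k / 2) ^ 2 ≤ ((a - b) * m k - a) ^ 2 :=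
          pow_le_pow_left₀ (by have := hm k; positivity) h3 2
        have h5 : μ * m k ≤ m k * m k := mul_le_mul_of_nonneg_right (hμ k) (hm k).le
        have h6 := mul_le_mul_of_nonneg_left h5 (sq_nonneg (a - b))
        nlinarith
      have h3 : 2 * (K * (2 * (ν / κ) ^ 2)) ≤ 1 / 2 := by
        rw [div_pow, hκ]
        have h4 : 2 * (K * (2 * (ν ^ 2 / ((a - b) * μ / 2) ^ 2))) =
            16 * K * ν ^ 2 / ((a - b) * μ) ^ 2 := by
          field_simp; ring
        rw [h4, div_le_div_iff₀ (by positivity) (by norm_num)]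
        linarith
      have h4 := h2 k
      have h5 := h2 l
      nlinarith
    · simp only [sum_mul_clusterVector (hm _)]
      rw [sum_clusterCoeff_sq]
      have h2 : ∑ v : Γ, u i v ^ 2 = 1 := by
        rw [Finset.sum_coe_sort Γ fun v => u i v ^ 2]
        rw [Finset.sum_subset (Finset.subset_univ Γ) fun x _ hx => by
          rw [(hsupp i hi x hx).1]; norm_num]
        rw [← EuclideanSpace.real_norm_sq_eq, u.norm_eq_one]; norm_num
      have h3 := hres i hi
      have h4 : ∑ v : Γ, (u i).ofLp v ^ 2 = ∑ v : Γ, u i v ^ 2 := rfl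
      rw [h4, h2]
      linarith

/-! ### Greedy clustering -/

section Greedy

variable {n K : ℕ}

theorem mem_nearby {Ahat : Matrix (Fin n) (Fin n) ℝ} {ρ : ℝ} {v w : Fin n} :
    w ∈ nearby Ahat ρ v ↔ ‖column Ahat w - column Ahat v‖ ^ 2 ≤ ρ := by
  simp [nearby]

theorem mem_newNearby {Ahat : Matrix (Fin n) (Fin n) ℝ} {ρ : ℝ} {c : Fin K → Fin n} {k : Fin K}
    {v w : Fin n} : w ∈ newNearby Ahat ρ c k v ↔
      w ∈ nearby Ahat ρ v ∧ ∀ j < k, w ∉ nearby Ahat ρ (c j) := by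
  simp [newNearby]

open Classical in
/-- If the nodes outside a small set `Gᶜ` are nearby exactly if they are in the same cluster, then
the greedy clustering finds all clusters. -/
theorem exists_injective_core {Ahat : Matrix (Fin n) (Fin n) ℝ} {ρ : ℝ} {c : Fin K → Fin n}
    (hmax : ∀ k v, (newNearby Ahat ρ c k v).card ≤ (newNearby Ahat ρ c k (c k)).card)
    {τ : Fin n → Fin K} {G : Finset (Fin n)}
    (hnear : ∀ v ∈ G, ∀ w ∈ G, τ w = τ v → w ∈ nearby Ahat ρ v)
    (hfar : ∀ v, ∀ w ∈ G, ∀ w' ∈ G, w ∈ nearby Ahat ρ v → w' ∈ nearby Ahat ρ v → τ w = τ w')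
    (hsize : ∀ l, 2 * Gᶜ.card < (G.filter fun v => τ v = l).card) :
    ∃ π : Fin K → Fin K, Function.Injective π ∧ ∀ k, ∃ w ∈ core Ahat ρ c k, w ∈ G ∧ τ w = π k := by
  let P : Fin K → Fin K → Prop := fun k l =>
      ((G.filter fun v => τ v = l) \ nearby Ahat ρ (c k)).card ≤ Gᶜ.card ∧
      (∃ w ∈ core Ahat ρ c k, w ∈ G ∧ τ w = l) ∧
      ∀ j < k, ∀ w ∈ G, w ∈ nearby Ahat ρ (c j) → τ w ≠ l
  have step : ∀ k : Fin K, (∀ j < k, ∃ l, P j l) → ∃ l, P k l := by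
    intro k ih
    choose π hπ using ih
    have hcore : ∀ v ∈ G, (∀ j < k, ∀ w ∈ G, w ∈ nearby Ahat ρ (c j) → τ w ≠ τ v) →
        (G.filter fun w => τ w = τ v).card ≤ (core Ahat ρ c k).card := by
      intro v hv hfresh
      refine (Finset.card_le_card fun w hw => ?_).trans (hmax k v)
      obtain ⟨hw1, hw2⟩ := Finset.mem_filter.1 hw
      exact mem_newNearby.2 ⟨hnear v hv w hw1 hw2, fun j hj h => hfresh j hj w hw1 h hw2⟩
    have hprev : ∀ j (hj : j < k), ∀ w ∈ G, w ∈ nearby Ahat ρ (c j) → τ w = π j hj := by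
      intro j hj w hw h
      obtain ⟨w', h1, h2, h3⟩ := (hπ j hj).2.1
      rw [← h3]
      exact hfar (c j) w hw w' h2 h (mem_newNearby.1 h1).1
    obtain ⟨l, hl⟩ : ∃ l, ∀ j (hj : j < k), π j hj ≠ l := by
      by_contra! h
      have h1 : Function.Surjective fun j : {j // j < k} => π j j.2 := fun l => by
        obtain ⟨j, hj, e⟩ := h l; exact ⟨⟨j, hj⟩, e⟩
      have h2 := Fintype.card_le_of_surjective _ h1
      exact absurd (Fintype.card_subtype_lt (p := fun j => j < k) (lt_irrefl k)) (not_lt.2 h2)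
    obtain ⟨v, hv⟩ := Finset.card_pos.1 ((Nat.zero_le _).trans_lt (hsize l))
    obtain ⟨hvG, rfl⟩ := Finset.mem_filter.1 hv
    have hbig : 2 * Gᶜ.card < (core Ahat ρ c k).card :=
      (hsize _).trans_le (hcore v hvG fun j hj w hw h => by rw [hprev j hj w hw h]; exact hl j hj)
    obtain ⟨w₀, hw₀, hw₀'⟩ := Finset.exists_mem_notMem_of_card_lt_card
      (show Gᶜ.card < (core Ahat ρ c k).card by omega)
    have hw₀G : w₀ ∈ G := by simpa using hw₀'
    have hcl : ∀ w ∈ core Ahat ρ c k, w ∈ G → τ w = τ w₀ := fun w hw hwG =>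
      hfar (c k) w hwG w₀ hw₀G (mem_newNearby.1 hw).1 (mem_newNearby.1 hw₀).1
    have hfresh : ∀ j < k, ∀ w ∈ G, w ∈ nearby Ahat ρ (c j) → τ w ≠ τ w₀ := by
      intro j hj w hw hwn he
      have h1 : core Ahat ρ c k ⊆
          ((G.filter fun v => τ v = π j hj) \ nearby Ahat ρ (c j)) ∪ Gᶜ := by
        intro x hx
        by_cases hxG : x ∈ G
        · refine Finset.mem_union_left _ (Finset.mem_sdiff.2 ⟨Finset.mem_filter.2 ⟨hxG, ?_⟩,
            (mem_newNearby.1 hx).2 j hj⟩)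
          rw [hcl x hx hxG, ← he]; exact hprev j hj w hw hwn
        · exact Finset.mem_union_right _ (Finset.mem_compl.2 hxG)
      have h2 := (Finset.card_le_card h1).trans (Finset.card_union_le _ _)
      have h3 := (hπ j hj).1
      omega
    refine ⟨τ w₀, ?_, ⟨w₀, hw₀, hw₀G, rfl⟩, hfresh⟩
    have h1 : core Ahat ρ c k ⊆
        ((G.filter fun v => τ v = τ w₀) ∩ nearby Ahat ρ (c k)) ∪ Gᶜ := by
      intro x hx
      by_cases hxG : x ∈ G
      · exact Finset.mem_union_left _ (Finset.mem_inter.2 ⟨Finset.mem_filter.2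
          ⟨hxG, hcl x hx hxG⟩, (mem_newNearby.1 hx).1⟩)
      · exact Finset.mem_union_right _ (Finset.mem_compl.2 hxG)
    have h2 := (Finset.card_le_card h1).trans (Finset.card_union_le _ _)
    have h3 := hcore w₀ hw₀G hfresh
    have h4 := Finset.card_sdiff_add_card_inter (G.filter fun v => τ v = τ w₀)
      (nearby Ahat ρ (c k))
    omega
  have main : ∀ k : Fin K, ∃ l, P k l := by
    intro k
    induction hm : (k : ℕ) using Nat.strong_induction_on generalizing k with
    | _ m ih =>
      refine step k fun j hj => ih j ?_ j rfl
      rw [← hm]; exact hj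
  choose π hπ using main
  have hlt : ∀ j k, j < k → π j ≠ π k := by
    intro j k hjk he
    obtain ⟨w, hw1, hw2⟩ : ∃ w ∈ G.filter (fun v => τ v = π k), w ∈ nearby Ahat ρ (c j) := by
      by_contra! h
      have h1 : (G.filter fun v => τ v = π k) ⊆
          (G.filter fun v => τ v = π j) \ nearby Ahat ρ (c j) := by
        intro w hw
        refine Finset.mem_sdiff.2 ⟨?_, h w hw⟩
        rw [he]; exact hw
      have h2 := Finset.card_le_card h1
      have h3 := (hπ j).1
      have h4 := hsize (π k)
      omega
    obtain ⟨hw3, hw4⟩ := Finset.mem_filter.1 hw1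
    exact (hπ k).2.2 j hjk w hw3 hw2 hw4
  refine ⟨π, fun j k he => ?_, fun k => (hπ k).2.1⟩
  by_contra hne
  rcases lt_or_gt_of_ne hne with h | h
  · exact hlt j k h he
  · exact hlt k j h he.symm

open Classical in
/-- The nodes whose column is close to the center of their cluster. -/
def goodNodes (Ahat : Matrix (Fin n) (Fin n) ℝ) (Γ : Finset (Fin n)) (τ : Fin n → Fin K)
    (c : Fin K → EuclideanSpace ℝ (Fin n)) (ρ : ℝ) : Finset (Fin n) :=
  Γ.filter fun v => ‖column Ahat v - c (τ v)‖ ^ 2 ≤ ρ / 4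

open Classical in
theorem IsClustered.card_compl_goodNodes_le {Ahat : Matrix (Fin n) (Fin n) ℝ}
    {Γ : Finset (Fin n)} {τ : Fin n → Fin K} {c : Fin K → EuclideanSpace ℝ (Fin n)} {S H L ρ : ℝ}
    (h : IsClustered (column Ahat) Γ τ c S H L) (hρ : 0 < ρ) :
    ((goodNodes Ahat Γ τ c ρ)ᶜ.card : ℝ) ≤ 4 * S / ρ + (Γᶜ.card : ℝ) := by
  have h1 : (goodNodes Ahat Γ τ c ρ)ᶜ ⊆
      (Γ.filter fun v => ¬ ‖column Ahat v - c (τ v)‖ ^ 2 ≤ ρ / 4) ∪ Γᶜ := by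
    intro v hv
    by_cases hΓ : v ∈ Γ
    · refine Finset.mem_union_left _ (Finset.mem_filter.2 ⟨hΓ, fun h => ?_⟩)
      exact Finset.mem_compl.1 hv (Finset.mem_filter.2 ⟨hΓ, h⟩)
    · exact Finset.mem_union_right _ (Finset.mem_compl.2 hΓ)
  have h2 : ((goodNodes Ahat Γ τ c ρ)ᶜ.card : ℝ) ≤
      (Γ.filter fun v => ¬ ‖column Ahat v - c (τ v)‖ ^ 2 ≤ ρ / 4).card + (Γᶜ.card : ℝ) := by
    exact_mod_cast (Finset.card_le_card h1).trans (Finset.card_union_le _ _)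
  refine h2.trans (add_le_add_left ?_ _)
  rw [le_div_iff₀ hρ]
  have h3 : ∀ v ∈ Γ.filter (fun v => ¬ ‖column Ahat v - c (τ v)‖ ^ 2 ≤ ρ / 4),
      ρ / 4 ≤ ‖column Ahat v - c (τ v)‖ ^ 2 := fun v hv =>
    (not_le.1 (Finset.mem_filter.1 hv).2).le
  have h4 := Finset.sum_le_sum h3
  rw [Finset.sum_const, nsmul_eq_mul] at h4
  have h5 := h4.trans ((Finset.sum_le_sum_of_subset_of_nonneg (Finset.filter_subset _ Γ)
    fun v _ _ => sq_nonneg _).trans h.error)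
  linarith

theorem norm_le_sqrt_of_sq_le {E : Type} [NormedAddCommGroup E] {x : E} {ρ : ℝ}
    (h : ‖x‖ ^ 2 ≤ ρ) : ‖x‖ ≤ √ρ := Real.le_sqrt_of_sq_le h

theorem norm_coreMean_sub_le {Ahat : Matrix (Fin n) (Fin n) ℝ} {ρ : ℝ} {c : Fin K → Fin n}
    {k : Fin K} (hne : (core Ahat ρ c k).Nonempty) :
    ‖coreMean Ahat ρ c k - column Ahat (c k)‖ ≤ √ρ := by
  have hc : (0 : ℝ) < (core Ahat ρ c k).card := by exact_mod_cast hne.card_pos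
  have h1 : coreMean Ahat ρ c k - column Ahat (c k) = ((core Ahat ρ c k).card : ℝ)⁻¹ •
      ∑ v ∈ core Ahat ρ c k, (column Ahat v - column Ahat (c k)) := by
    rw [Finset.sum_sub_distrib, smul_sub, Finset.sum_const, ← Nat.cast_smul_eq_nsmul ℝ, smul_smul,
      inv_mul_cancel₀ hc.ne', one_smul, coreMean]
  rw [h1, norm_smul, norm_inv, Real.norm_of_nonneg hc.le, inv_mul_le_iff₀ hc]
  refine (norm_sum_le _ _).trans ((Finset.sum_le_card_nsmul _ _ (√ρ) fun v hv => ?_).trans_eq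
    (nsmul_eq_mul _ _))
  exact norm_le_sqrt_of_sq_le (mem_nearby.1 (mem_newNearby.1 hv).1)

open Classical in
/-- The residual of a greedy pass with a suitable radius is small. -/
theorem IsClustered.residual_le {Ahat : Matrix (Fin n) (Fin n) ℝ}
    {Γ : Finset (Fin n)} {τ : Fin n → Fin K} {c : Fin K → EuclideanSpace ℝ (Fin n)} {S H L ρ : ℝ}
    (h : IsClustered (column Ahat) Γ τ c S H L) (hρ : 0 < ρ) (hL : 16 * ρ ≤ L)
    (hsize : ∀ l, 3 * (4 * S / ρ + (Γᶜ.card : ℝ)) < clusterSize τ l)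
    {ctr : Fin K → Fin n} {label : Fin n → Fin K} (hg : IsGreedy Ahat ρ ctr label) :
    residual Ahat ρ ctr label ≤ 13 * n * ρ + 2 * S + 2 * ((Γᶜ.card : ℝ) * H) := by
  set G := goodNodes Ahat Γ τ c ρ with hG
  set r := √ρ with hr
  have hr0 : 0 < r := Real.sqrt_pos.2 hρ
  have hr2 : r ^ 2 = ρ := Real.sq_sqrt hρ.le
  have hgood : ∀ v ∈ G, ‖column Ahat v - c (τ v)‖ ≤ r / 2 := by
    intro v hv
    have h1 := (Finset.mem_filter.1 hv).2
    refine abs_le_of_sq_le_sq' (by rw [div_pow, hr2]; linarith) (by positivity) |>.2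
  have hnb : ∀ {v w}, w ∈ nearby Ahat ρ v → ‖column Ahat w - column Ahat v‖ ≤ r := fun h =>
    norm_le_sqrt_of_sq_le (mem_nearby.1 h)
  obtain ⟨π, hπ, hcore⟩ := exists_injective_core (G := G) (τ := τ) hg.center_max
    (fun v hv w hw he => by
      refine mem_nearby.2 ?_
      rw [← hr2]
      refine pow_le_pow_left₀ (norm_nonneg _) ?_ 2
      have h1 := hgood v hv
      have h2 := hgood w hw
      rw [he] at h2
      calc ‖column Ahat w - column Ahat v‖ =
          ‖(column Ahat w - c (τ v)) - (column Ahat v - c (τ v))‖ := by congr 1; abel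
        _ ≤ _ := norm_sub_le _ _
        _ ≤ r := by linarith)
    (fun v w hw w' hw' h1 h2 => by
      by_contra hne
      have h3 := h.sep _ _ hne
      have h4 : ‖c (τ w) - c (τ w')‖ ≤ 3 * r := by
        calc ‖c (τ w) - c (τ w')‖ = ‖(column Ahat w - column Ahat v) -
            (column Ahat w' - column Ahat v) - (column Ahat w - c (τ w)) +
              (column Ahat w' - c (τ w'))‖ := by congr 1; abel
          _ ≤ ‖(column Ahat w - column Ahat v) -
            (column Ahat w' - column Ahat v) - (column Ahat w - c (τ w))‖ +
              ‖(column Ahat w' - c (τ w'))‖ := norm_add_le _ _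
          _ ≤ ‖(column Ahat w - column Ahat v) - (column Ahat w' - column Ahat v)‖ +
              ‖(column Ahat w - c (τ w))‖ + ‖(column Ahat w' - c (τ w'))‖ := by
            gcongr; exact norm_sub_le _ _
          _ ≤ ‖(column Ahat w - column Ahat v)‖ + ‖(column Ahat w' - column Ahat v)‖ +
              ‖(column Ahat w - c (τ w))‖ + ‖(column Ahat w' - c (τ w'))‖ := by
            gcongr; exact norm_sub_le _ _
          _ ≤ 3 * r := by linarith [hnb h1, hnb h2, hgood w hw, hgood w' hw']
      have h5 := pow_le_pow_left₀ (norm_nonneg _) h4 2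
      rw [mul_pow, hr2] at h5
      linarith)
    (fun l => by
      have h1 := h.card_compl_goodNodes_le hρ
      have h2 := hsize l
      have h3 : clusterSize τ l ≤ (G.filter fun v => τ v = l).card + Gᶜ.card := by
        rw [clusterSize]
        refine (Finset.card_le_card fun v hv => ?_).trans (Finset.card_union_le _ _)
        by_cases hvG : v ∈ G
        · exact Finset.mem_union_left _ (Finset.mem_filter.2 ⟨hvG, (Finset.mem_filter.1 hv).2⟩)
        · exact Finset.mem_union_right _ (Finset.mem_compl.2 hvG)
      have h4 : (3 * Gᶜ.card : ℝ) < clusterSize τ l := by linarith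
      have h5 : 3 * Gᶜ.card < clusterSize τ l := by exact_mod_cast h4
      omega)
  have hmean : ∀ k, ‖coreMean Ahat ρ ctr k - c (π k)‖ ≤ 5 / 2 * r := by
    intro k
    obtain ⟨w, hw, hwG, hwk⟩ := hcore k
    have h1 := norm_coreMean_sub_le ⟨w, hw⟩
    have h2 := hnb (mem_newNearby.1 hw).1
    have h3 := hgood w hwG
    rw [hwk] at h3
    calc ‖coreMean Ahat ρ ctr k - c (π k)‖ = ‖(coreMean Ahat ρ ctr k - column Ahat (ctr k)) -
          (column Ahat w - column Ahat (ctr k)) + (column Ahat w - c (π k))‖ := by congr 1; abel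
      _ ≤ ‖(coreMean Ahat ρ ctr k - column Ahat (ctr k)) -
          (column Ahat w - column Ahat (ctr k))‖ + ‖(column Ahat w - c (π k))‖ := norm_add_le _ _
      _ ≤ ‖(coreMean Ahat ρ ctr k - column Ahat (ctr k))‖ +
          ‖(column Ahat w - column Ahat (ctr k))‖ + ‖(column Ahat w - c (π k))‖ := by
        gcongr; exact norm_sub_le _ _
      _ ≤ 5 / 2 * r := by linarith
  have hterm : ∀ v, ‖column Ahat v - coreMean Ahat ρ ctr (label v)‖ ^ 2 ≤
      13 * ρ + 2 * ‖column Ahat v - c (τ v)‖ ^ 2 := by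
    intro v
    by_cases hv : ∃ k, v ∈ core Ahat ρ ctr k
    · obtain ⟨k, hk⟩ := hv
      have h1 : ‖column Ahat v - coreMean Ahat ρ ctr (label v)‖ ≤ 2 * r := by
        rw [hg.label_core k v hk]
        calc ‖column Ahat v - coreMean Ahat ρ ctr k‖ = ‖(column Ahat v - column Ahat (ctr k)) -
              (coreMean Ahat ρ ctr k - column Ahat (ctr k))‖ := by congr 1; abel
          _ ≤ _ := norm_sub_le _ _
          _ ≤ 2 * r := by
            linarith [hnb (mem_newNearby.1 hk).1, norm_coreMean_sub_le ⟨v, hk⟩]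
      have h2 := pow_le_pow_left₀ (norm_nonneg _) h1 2
      rw [mul_pow, hr2] at h2
      nlinarith [sq_nonneg ‖column Ahat v - c (τ v)‖]
    · push Not at hv
      obtain ⟨k, hk⟩ := Finite.injective_iff_surjective.1 hπ (τ v)
      have h1 : ‖column Ahat v - coreMean Ahat ρ ctr (label v)‖ ≤
          ‖column Ahat v - c (τ v)‖ + 5 / 2 * r := by
        refine (hg.label_rest v hv k).trans ?_
        calc ‖column Ahat v - coreMean Ahat ρ ctr k‖ = ‖(column Ahat v - c (τ v)) -
              (coreMean Ahat ρ ctr k - c (π k))‖ := by rw [hk]; congr 1; abel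
          _ ≤ _ := norm_sub_le _ _
          _ ≤ _ := by linarith [hmean k]
      have h2 := pow_le_pow_left₀ (norm_nonneg _) h1 2
      nlinarith [sq_nonneg (‖column Ahat v - c (τ v)‖ - 5 / 2 * r)]
  rw [residual]
  refine (Finset.sum_le_sum fun v _ => hterm v).trans ?_
  rw [Finset.sum_add_distrib, Finset.sum_const, Finset.card_univ, Fintype.card_fin, nsmul_eq_mul,
    ← Finset.mul_sum, ← Finset.sum_add_sum_compl Γ]
  have h1 : ∑ v ∈ Γᶜ, ‖column Ahat v - c (τ v)‖ ^ 2 ≤ (Γᶜ.card : ℝ) * H := by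
    rw [← nsmul_eq_mul]
    refine Finset.sum_le_card_nsmul _ _ _ fun v hv => ?_
    rw [h.zero v (Finset.mem_compl.1 hv), zero_sub, norm_neg]
    exact h.center _
  have h2 := h.error
  linarith

open Classical in
/-- A labelling with a small residual has few errors, up to a permutation of the labels. -/
theorem IsClustered.exists_perm_errors_le {E : Type} [NormedAddCommGroup E] {x : Fin n → E}
    {Γ : Finset (Fin n)} {τ : Fin n → Fin K} {c : Fin K → E} {S H L R : ℝ}
    (h : IsClustered x Γ τ c S H L) (hL : 0 < L) {ξ : Fin K → E} {label : Fin n → Fin K}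
    (hres : ∑ v, ‖x v - ξ (label v)‖ ^ 2 ≤ R)
    (hsize : ∀ l, 32 * (R + S) / L + (Γᶜ.card : ℝ) < clusterSize τ l) :
    ∃ σ : Equiv.Perm (Fin K),
      ((errors (σ ∘ τ) label).card : ℝ) ≤ 32 * (R + S) / L + (Γᶜ.card : ℝ) := by
  set F := Γ.filter fun v => L / 16 ≤ ‖c (τ v) - ξ (label v)‖ ^ 2 with hF
  have hFcard : ((F ∪ Γᶜ).card : ℝ) ≤ 32 * (R + S) / L + (Γᶜ.card : ℝ) := by
    have h0 : ((F ∪ Γᶜ).card : ℝ) ≤ F.card + (Γᶜ.card : ℝ) := by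
      exact_mod_cast Finset.card_union_le _ _
    refine h0.trans (add_le_add_left ?_ _)
    rw [le_div_iff₀ hL]
    have h1 : ∀ v ∈ F, L / 16 ≤ ‖c (τ v) - ξ (label v)‖ ^ 2 := fun v hv =>
      (Finset.mem_filter.1 hv).2
    have h2 := Finset.sum_le_sum h1
    rw [Finset.sum_const, nsmul_eq_mul] at h2
    have h3 : ∑ v ∈ F, ‖c (τ v) - ξ (label v)‖ ^ 2 ≤
        ∑ v ∈ Γ, (2 * ‖x v - c (τ v)‖ ^ 2 + 2 * ‖x v - ξ (label v)‖ ^ 2) := by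
      refine (Finset.sum_le_sum_of_subset_of_nonneg (Finset.filter_subset _ Γ)
        fun v _ _ => sq_nonneg _).trans (Finset.sum_le_sum fun v _ => ?_)
      have h4 : ‖c (τ v) - ξ (label v)‖ ≤ ‖x v - ξ (label v)‖ + ‖x v - c (τ v)‖ := by
        calc ‖c (τ v) - ξ (label v)‖ = ‖(x v - ξ (label v)) - (x v - c (τ v))‖ := by
              congr 1; abel
          _ ≤ _ := norm_sub_le _ _
      have h5 := pow_le_pow_left₀ (norm_nonneg _) h4 2
      nlinarith [sq_nonneg (‖x v - ξ (label v)‖ - ‖x v - c (τ v)‖)]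
    rw [Finset.sum_add_distrib, ← Finset.mul_sum, ← Finset.mul_sum] at h3
    have h6 : ∑ v ∈ Γ, ‖x v - ξ (label v)‖ ^ 2 ≤ R :=
      (Finset.sum_le_sum_of_subset_of_nonneg (Finset.subset_univ _)
        fun v _ _ => sq_nonneg _).trans hres
    have h7 := h.error
    linarith
  have hclose : ∀ v ∉ F ∪ Γᶜ, ‖c (τ v) - ξ (label v)‖ < √L / 4 := by
    intro v hv
    rw [Finset.mem_union, not_or, Finset.mem_compl, not_not] at hv
    have h1 : ‖c (τ v) - ξ (label v)‖ ^ 2 < L / 16 := by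
      by_contra h2; exact hv.1 (Finset.mem_filter.2 ⟨hv.2, not_lt.1 h2⟩)
    refine lt_of_pow_lt_pow_left₀ 2 (by positivity) ?_
    rw [div_pow, Real.sq_sqrt hL.le]; linarith
  have hsame : ∀ k l (z : E), ‖c k - z‖ < √L / 4 → ‖c l - z‖ < √L / 4 → k = l := by
    intro k l z h1 h2
    by_contra hne
    have h3 := Real.sqrt_le_sqrt (h.sep k l hne)
    rw [Real.sqrt_sq (norm_nonneg _)] at h3
    have h4 : ‖c k - c l‖ ≤ ‖c k - z‖ + ‖c l - z‖ := by
      calc ‖c k - c l‖ = ‖(c k - z) - (c l - z)‖ := by congr 1; abel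
        _ ≤ _ := norm_sub_le _ _
    have h5 := Real.sqrt_pos.2 hL
    linarith
  have hex : ∀ k, ∃ v, τ v = k ∧ v ∉ F ∪ Γᶜ := by
    intro k
    have h1 : (F ∪ Γᶜ).card < (Finset.univ.filter fun w => τ w = k).card := by
      have := hFcard.trans_lt (hsize k)
      rw [clusterSize] at this
      exact_mod_cast this
    obtain ⟨v, hv1, hv2⟩ := Finset.exists_mem_notMem_of_card_lt_card h1
    exact ⟨v, (Finset.mem_filter.1 hv1).2, hv2⟩
  choose v hv1 hv2 using hex
  have hinj : Function.Injective fun k => label (v k) := by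
    intro k l he
    have h1 := hclose _ (hv2 k)
    have h2 := hclose _ (hv2 l)
    rw [hv1] at h1 h2
    have he' : label (v k) = label (v l) := he
    rw [he'] at h1
    exact hsame k l _ h1 h2
  refine ⟨Equiv.ofBijective _ (Finite.injective_iff_bijective.1 hinj), le_trans ?_ hFcard⟩
  have hsub : errors (Equiv.ofBijective _ (Finite.injective_iff_bijective.1 hinj) ∘ τ) label ⊆
      F ∪ Γᶜ := by
    intro w hw
    by_contra hwF
    refine (Finset.mem_filter.1 hw).2 ?_
    obtain ⟨k, hk⟩ := (Finite.injective_iff_bijective.1 hinj).2 (label w)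
    have hk' : label (v k) = label w := hk
    have h1 := hclose _ hwF
    have h2 := hclose _ (hv2 k)
    rw [hv1, hk'] at h2
    have h3 := hsame _ _ _ h2 h1
    change label w = label (v (τ w))
    rw [← h3, hk']
  exact_mod_cast Finset.card_le_card hsub

end Greedy

/-! ### The spectral step -/

theorem radius_bounds {n I K a t : ℝ} (hn : 0 < n) (hI : 1 ≤ I) (hK : 1 ≤ K)
    (hlow : n * (n * a) / (2 * K) ≤ t) (hup : t ≤ 9 * n * (n * a)) :
    I * a / (200 * K) ≤ I * (t / (100 * n ^ 2)) ∧ I * (t / (100 * n ^ 2)) ≤ 9 * I * a / 100 := by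
  constructor
  · have h1 : a / (200 * K) = n * (n * a) / (2 * K) / (100 * n ^ 2) := by field_simp; ring
    rw [mul_div_assoc, h1]
    gcongr
  · have h1 : 9 * I * a / 100 = I * (9 * n * (n * a) / (100 * n ^ 2)) := by field_simp
    rw [h1]
    gcongr

theorem far_nodes_bound {n I K a C α ρ S : ℝ} (hn : 0 < n) (hK : 1 ≤ K) (ha : 0 < a) (hα : 0 < α)
    (hρ : I * a / (200 * K) ≤ ρ) (hρ0 : 0 < ρ) (hS : S ≤ 6 * K * C * (n * a))
    (hIC : 57600 * K ^ 2 * C ≤ α * I) : 12 * (4 * S / ρ) ≤ α * n := by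
  rw [mul_div_assoc', div_le_iff₀ hρ0]
  have h1 := mul_le_mul_of_nonneg_left hρ (by positivity : 0 ≤ α * n)
  refine le_trans ?_ h1
  rw [mul_div_assoc', le_div_iff₀ (by positivity)]
  have h3 := mul_le_mul_of_nonneg_right hIC (by positivity : 0 ≤ n * a)
  have h4 := mul_le_mul_of_nonneg_left hS (by positivity : 0 ≤ 12 * 4 * (200 * K))
  linarith

theorem residual_sum_bound {n I K a C ρ S γ g : ℝ} (hn : 0 < n) (hI : 1 ≤ I) (ha : 0 < a)
    (hρ : ρ ≤ 9 * I * a / 100) (hS : S ≤ 6 * K * C * (n * a)) (hγ : γ * a ≤ g) :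
    (13 * n * ρ + 2 * S + 2 * (γ * (a ^ 2 * n))) + S ≤
      (2 * I + 18 * K * C + 2 * g) * (n * a) := by
  have h2 := mul_le_mul_of_nonneg_left hρ (by positivity : 0 ≤ 13 * n)
  have h3 := mul_le_mul_of_nonneg_right hγ (by positivity : 0 ≤ 2 * (n * a))
  have h4 : 0 ≤ I * (n * a) := by positivity
  linarith

open Classical in
/-- With the greedy clustering, the spectral step makes few errors. -/
theorem exists_perm_errors_le_of_isGreedyOutput {n K : ℕ} (hn : 0 < n) (hK : 0 < K)
    {A : Matrix (Fin n) (Fin n) ℕ} (hs : A.IsSymm) (hd : ∀ v, A v v = 0)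
    {τ : Fin n → Fin K} {a b ν α C D g : ℝ} {I : ℕ} (hb : 0 ≤ b) (hab : b < a) (hα : 0 < α)
    (hsize : ∀ k, α * n ≤ clusterSize τ k)
    (hN : NormBound (kept K A) (deviation A (rate τ a b)) ν) (hν0 : 0 ≤ ν)
    (hν : ν ^ 2 ≤ C * (n * a)) (hD : D * (n * a) = (n * (a - b)) ^ 2)
    (hgap : 16 * a ≤ α * (n * (a - b))) (hD1 : 128 * K * C ≤ α ^ 2 * D)
    (hlow : n * (n * a) / (2 * K) ≤ total A) (hup : total A ≤ 9 * n * (n * a))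
    (hI1 : 1 ≤ I) (hI : I ≤ ⌊Real.log n⌋₊) (hIC : 57600 * K ^ 2 * C ≤ α * I)
    (hΓ : 12 * ((kept K A)ᶜ.card : ℝ) ≤ α * n) (hΓa : ((kept K A)ᶜ.card : ℝ) * a ≤ g)
    (hD2 : 16 * I ≤ α * D) (hD3 : 512 * (2 * I + 18 * K * C + 2 * g) < α ^ 2 * D)
    {out : Fin n → Fin K} (hout : IsGreedyOutput K A out) :
    ∃ σ : Equiv.Perm (Fin K), ((errors (σ ∘ τ) out).card : ℝ) ≤
      n * (256 * (2 * I + 18 * K * C + 2 * g) / (α * D)) + ((kept K A)ᶜ.card : ℝ) := by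
  obtain ⟨Ahat, c, label, i₀, hrank, hgreedy, hi₀, hmin, rfl⟩ := hout
  have hn' : (0 : ℝ) < n := by exact_mod_cast hn
  have hK' : (1 : ℝ) ≤ K := by exact_mod_cast hK
  have hI' : (1 : ℝ) ≤ I := by exact_mod_cast hI1
  have ha : 0 < a := hb.trans_lt hab
  have hab' : 0 < a - b := sub_pos.2 hab
  have hD' : D * a = n * (a - b) ^ 2 := by
    have h1 : n * (D * a) = n * (n * (a - b) ^ 2) := by linarith
    exact mul_left_cancel₀ hn'.ne' h1
  have hD0 : 0 < D := by
    have h1 : 0 < D * a := by rw [hD']; positivity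
    exact pos_of_mul_pos_left h1 ha.le
  have hμ : ∀ k, α * n / 2 ≤ blockSize (fun v : kept K A => τ v) k := fun k => by
    have := blockSize_restrict τ (kept K A) k
    have := hsize k
    have : 0 < α * n := by positivity
    linarith
  have hX0 : 0 < α * (n * (a - b)) := by positivity
  have hν2 : 128 * K * ν ^ 2 ≤ (α * (n * (a - b))) ^ 2 := by
    rw [mul_pow, ← hD]
    have h1 := mul_le_mul_of_nonneg_left hν (by positivity : (0 : ℝ) ≤ 128 * K)
    have h2 := mul_le_mul_of_nonneg_right hD1 (by positivity : 0 ≤ n * a)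
    linarith
  have hν8 : 8 * ν ≤ α * (n * (a - b)) := by
    refine abs_le_of_sq_le_sq' ?_ hX0.le |>.2
    have h1 := mul_le_mul_of_nonneg_right hK' (sq_nonneg ν)
    rw [mul_pow]
    linarith [sq_nonneg ν]
  obtain ⟨ctr, hcl⟩ := exists_isClustered_column hs hd hb hab (μ := α * n / 2) (by positivity) hμ
    hN hν0 (by linarith)
    (by rw [show (a - b) * (α * n / 2) = α * (n * (a - b)) / 2 by ring, div_pow]; linarith) hrank
  set γ : ℝ := ((kept K A)ᶜ.card : ℝ) with hγ
  have hγ0 : 0 ≤ γ := Nat.cast_nonneg _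
  set ρ : ℝ := I * (total A / (100 * (n : ℝ) ^ 2)) with hρ
  obtain ⟨hρ1, hρ2⟩ := radius_bounds (I := I) hn' hI' hK' hlow hup
  rw [← hρ] at hρ1 hρ2
  have hρ0 : 0 < ρ := lt_of_lt_of_le (by positivity) hρ1
  set S : ℝ := 6 * K * ν ^ 2 with hS
  have hS0 : 0 ≤ S := by positivity
  have hS1 : S ≤ 6 * K * C * (n * a) := by
    have := mul_le_mul_of_nonneg_left hν (by positivity : (0 : ℝ) ≤ 6 * K)
    linarith
  have hSρ : 12 * (4 * S / ρ) ≤ α * n := far_nodes_bound hn' hK' ha hα hρ1 hρ0 hS1 hIC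
  have hαn : 0 < α * n := by positivity
  have hL : 16 * ρ ≤ α * n / 2 * (a - b) ^ 2 / 4 := by
    have h1 := mul_le_mul_of_nonneg_right hD2 ha.le
    rw [mul_assoc α D a, hD'] at h1
    have h2 : 0 ≤ (I : ℝ) * a := by positivity
    linarith
  have hIm : I ∈ Finset.Icc 1 ⌊Real.log n⌋₊ := Finset.mem_Icc.2 ⟨hI1, hI⟩
  have hres := hcl.residual_le hρ0 hL (fun l => by have := hsize l; linarith) (hgreedy I hIm)
  have hR := (hmin I hIm).trans hres
  have hLD : α * n / 2 * (a - b) ^ 2 / 4 = α * D * a / 8 := by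
    rw [mul_assoc α D a, hD']; ring
  have hRS : 32 * ((13 * n * ρ + 2 * S + 2 * (γ * (a ^ 2 * n))) + S) /
      (α * n / 2 * (a - b) ^ 2 / 4) ≤ n * (256 * (2 * I + 18 * K * C + 2 * g) / (α * D)) := by
    rw [hLD, mul_div_assoc', div_le_div_iff₀ (by positivity) (by positivity)]
    have h1 := residual_sum_bound (K := K) (C := C) hn' hI' ha hρ2 hS1 hΓa
    have h2 := mul_le_mul_of_nonneg_left h1 (by positivity : 0 ≤ 32 * (α * D))
    linarith
  have hhalf : n * (256 * (2 * I + 18 * K * C + 2 * g) / (α * D)) ≤ α * n / 2 := by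
    rw [mul_div_assoc', div_le_div_iff₀ (by positivity) (by norm_num)]
    have := mul_le_mul_of_nonneg_left hD3.le hn'.le
    linarith
  obtain ⟨σ, hσ⟩ := hcl.exists_perm_errors_le (by positivity) hR
    (fun l => by have := hsize l; linarith)
  exact ⟨σ, by linarith⟩

theorem isGreedyOutput_of_isSpectralStep {n K : ℕ} (hK : K ≠ 2) {A : Matrix (Fin n) (Fin n) ℕ}
    {S : PMF (Fin n → Fin K)} (h : IsSpectralStep K A S) :
    ∃ out, IsGreedyOutput K A out ∧ S = PMF.pure out := by
  unfold IsSpectralStep at h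
  split at h
  · exact absurd rfl hK
  · exact h

open Classical in
/-- The spectral step makes few errors, up to a permutation of the labels. -/
theorem exists_perm_errors_le_of_isSpectralStep {n K : ℕ} (hn : 0 < n) (hK : 0 < K)
    {A : Matrix (Fin n) (Fin n) ℕ} (hs : A.IsSymm) (hd : ∀ v, A v v = 0)
    {τ : Fin n → Fin K} {a b ν α C D g : ℝ} {I : ℕ} (hb : 0 ≤ b) (hab : b < a) (hα : 0 < α)
    (hsize : ∀ k, α * n ≤ clusterSize τ k)
    (hN : NormBound (kept K A) (deviation A (rate τ a b)) ν) (hν0 : 0 ≤ ν)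
    (hν : ν ^ 2 ≤ C * (n * a)) (hC : 0 < C) (hD : D * (n * a) = (n * (a - b)) ^ 2)
    (hgap : 16 * a ≤ α * (n * (a - b))) (hD1 : 144 * K * C ≤ α ^ 2 * D)
    (hlow : n * (n * a) / (2 * K) ≤ total A) (hup : total A ≤ 9 * n * (n * a))
    (hI1 : 1 ≤ I) (hI : I ≤ ⌊Real.log n⌋₊) (hIC : 57600 * K ^ 2 * C ≤ α * I)
    (hΓ : 400 * ((kept K A)ᶜ.card : ℝ) ≤ α * n) (hΓa : ((kept K A)ᶜ.card : ℝ) * a ≤ g)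
    (hD2 : 16 * I ≤ α * D) (hD3 : 102400 * (2 * I + 18 * K * C + 2 * g) < α ^ 2 * D)
    (hD4 : 102400 * C ≤ α ^ 4 * D)
    {S : PMF (Fin n → Fin K)} (hS : IsSpectralStep K A S) {label : Fin n → Fin K}
    (hlabel : label ∈ S.support) :
    ∃ σ : Equiv.Perm (Fin K), 200 * ((errors (σ ∘ τ) label).card : ℝ) ≤ α * n := by
  have hn' : (0 : ℝ) < n := by exact_mod_cast hn
  have hK' : (1 : ℝ) ≤ K := by exact_mod_cast hK
  have ha : 0 < a := hb.trans_lt hab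
  have hab' : 0 < a - b := sub_pos.2 hab
  have hna : 0 < n * a := by positivity
  have hX0 : 0 < α * (n * (a - b)) := by positivity
  have hD0 : 0 < D := by
    have h1 : 0 < D * (n * a) := by rw [hD]; positivity
    exact pos_of_mul_pos_left h1 hna.le
  have hαn : 0 < α * n := by positivity
  by_cases h2 : K = 2
  · subst h2
    obtain ⟨x₁, x₂, hx, rfl⟩ := hS
    have hν12 : 12 * ν ≤ α * (n * (a - b)) := by
      refine abs_le_of_sq_le_sq' ?_ hX0.le |>.2
      rw [mul_pow, mul_pow, ← hD]
      have h1 := mul_le_mul_of_nonneg_left hν (by norm_num : (0 : ℝ) ≤ 144)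
      have h2 := mul_le_mul_of_nonneg_right hD1 hna.le
      push_cast at h2
      nlinarith [mul_pos hC hna]
    obtain ⟨σ, hσ⟩ := exists_perm_errors_le_of_signPartition hn hd hb hab hα hsize hN hν0 hν12
      (by linarith [(Nat.cast_nonneg (kept 2 A)ᶜ.card : (0 : ℝ) ≤ _)]) hx hlabel
    refine ⟨σ, ?_⟩
    have h1 : (ν / (n * (a - b))) ^ 2 ≤ C / D := by
      rw [div_pow, div_le_div_iff₀ (by positivity) hD0, ← hD]
      have := mul_le_mul_of_nonneg_right hν hD0.le
      linarith
    have h3 : n * (256 / α ^ 3 * (ν / (n * (a - b))) ^ 2) ≤ α * n / 400 := by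
      have h4 : 256 / α ^ 3 * (ν / (n * (a - b))) ^ 2 ≤ α / 400 := by
        refine (mul_le_mul_of_nonneg_left h1 (by positivity)).trans ?_
        rw [div_mul_div_comm, div_le_div_iff₀ (by positivity) (by norm_num)]
        linarith
      have := mul_le_mul_of_nonneg_left h4 hn'.le
      linarith
    linarith
  · obtain ⟨out, hout, rfl⟩ := isGreedyOutput_of_isSpectralStep h2 hS
    rw [PMF.mem_support_pure_iff] at hlabel
    subst hlabel
    have hE : 0 ≤ 2 * I + 18 * K * C + 2 * g := by
      have : 0 ≤ g := le_trans (by positivity) hΓa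
      positivity
    obtain ⟨σ, hσ⟩ := exists_perm_errors_le_of_isGreedyOutput hn hK hs hd hb hab hα hsize hN hν0 hν
      hD hgap (by linarith [mul_pos (by linarith : (0 : ℝ) < K) hC]) hlow hup hI1 hI hIC
      (by linarith [(Nat.cast_nonneg (kept K A)ᶜ.card : (0 : ℝ) ≤ _)]) hΓa hD2 (by linarith) hout
    refine ⟨σ, ?_⟩
    have h3 : n * (256 * (2 * I + 18 * K * C + 2 * g) / (α * D)) ≤ α * n / 400 := by
      rw [mul_div_assoc', div_le_div_iff₀ (by positivity) (by norm_num)]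
      have := mul_le_mul_of_nonneg_left hD3.le hn'.le
      linarith
    linarith

/-! ### Relabelling the clusters -/

section Relabel

variable {n K : ℕ} (τ : Fin n → Fin K) (σ : Equiv.Perm (Fin K)) (a b : ℝ)

theorem rate_relabel : rate (σ ∘ τ) a b = rate τ a b := by
  classical
  funext v w
  simp [rate]

theorem clusterSize_relabel (l : Fin K) : clusterSize (σ ∘ τ) l = clusterSize τ (σ.symm l) := by
  classical
  simp [clusterSize, Equiv.eq_symm_apply]

theorem clusterDegree_relabel (A : Matrix (Fin n) (Fin n) ℕ) (v : Fin n) (l : Fin K) :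
    clusterDegree A (σ ∘ τ) v l = clusterDegree A τ v (σ.symm l) := by
  classical
  simp [clusterDegree, Equiv.eq_symm_apply]

theorem clusterMean_relabel (v : Fin n) (l : Fin K) :
    clusterMean (σ ∘ τ) a b v l = clusterMean τ a b v (σ.symm l) := by
  classical
  simp [clusterMean, clusterSize_relabel, Equiv.eq_symm_apply]

theorem deviates_relabel {A : Matrix (Fin n) (Fin n) ℕ} {v : Fin n}
    (h : Deviates A (σ ∘ τ) a b v) : Deviates A τ a b v := by
  obtain ⟨l, hl⟩ := h
  rw [clusterSize_relabel, clusterDegree_relabel, clusterMean_relabel] at hl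
  exact ⟨σ.symm l, hl⟩

variable {τ a b}

theorem GoodOutside.relabel {A : Matrix (Fin n) (Fin n) ℕ} {α : ℝ} {Z : Finset (Fin n)}
    (h : GoodOutside A τ a b α Z) : GoodOutside A (σ ∘ τ) a b α Z where
  pos := h.pos
  nonneg := h.nonneg
  lt := h.lt
  size l := by rw [clusterSize_relabel]; exact h.size _
  diag := h.diag
  typical v hv hd := h.typical v hv (deviates_relabel τ σ a b hd)
  small := h.small
  sparse := h.sparse
  norm := by rw [rate_relabel]; exact h.norm

end Relabel

open Classical in
theorem misclassified_le {n K : ℕ} {τ out : Fin n → Fin K} (σ : Equiv.Perm (Fin K)) :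
    misclassified τ out ≤ ((errors (σ ∘ τ) out).card : ℝ) / n := by
  rw [misclassified]
  gcongr
  exact Finset.inf'_le _ (Finset.mem_univ σ)

/-! ### Good observations -/

/-- The constant in the bound of the norm of the deviation of the observation matrix. -/
def normConstant (K : ℕ) : ℝ := (8 * (40 * (45 * K) + 1346)) ^ 2

theorem normConstant_pos (K : ℕ) : 0 < normConstant K := by unfold normConstant; positivity

/-- The conditions on the parameters: `n a` is the order of the degrees, `D` is the signal to noise
ratio, `exp (-s)` is the proportion of nodes that may be misclassified, and the radius of the pass
`I` of the greedy clustering is suitable. -/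
structure IsRegime (K n I : ℕ) (a b α D s : ℝ) : Prop where
  eight_le : 8 ≤ n
  nonneg : 0 ≤ b
  lt : b < a
  pos : 0 < α
  le_one : α ≤ 1
  ratio : D * (n * a) = (n * (a - b)) ^ 2
  degree : 24 ≤ n * a
  exp_mul_le : n * a * Real.exp (-s) ≤ 4
  exp_le : 400 * K * Real.exp (-s) ≤ α
  gap : 400 * a ≤ α * (n * (a - b))
  one_le_pass : 1 ≤ I
  pass_le : I ≤ ⌊Real.log n⌋₊
  le_pass : 57600 * K ^ 2 * normConstant K ≤ α * I
  pass_le_ratio : 16 * I ≤ α * D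
  le_ratio : 102400 * (2 * I + 18 * K * normConstant K + 2 * 4) < α ^ 2 * D
  le_ratio_four : 102400 * normConstant K ≤ α ^ 4 * D
  le_ratio_two : 640000 * K * normConstant K ≤ α ^ 2 * D
  le_ratio_sq : 41600 ^ 2 ≤ α ^ 2 * D

/-- The event on which the algorithm works. -/
structure IsGoodObservation {n K : ℕ} (A : Matrix (Fin n) (Fin n) ℕ) (τ : Fin n → Fin K)
    (a b s : ℝ) (m : ℕ) : Prop where
  symm : A.IsSymm
  diag : ∀ v, A v v = 0
  discrepancy : Discrepancy A a
  light : LightBound A (rate τ a b) (2 ^ m)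
  deviating_le : ((deviating A τ a b).card : ℝ) ≤ n * Real.exp (-s) / 2

open Classical in
theorem IsGoodObservation.misclassified_le {n K I : ℕ} [NeZero K] {A : Matrix (Fin n) (Fin n) ℕ}
    {τ : Fin n → Fin K} {a b α D s : ℝ} {m : ℕ} (h : IsGoodObservation A τ a b s m)
    (hr : IsRegime K n I a b α D s) (hsize : ∀ k, α * n ≤ clusterSize τ k)
    (hm1 : n * a ≤ 4 * (2 ^ m) ^ 2) (hm2 : (2 ^ m) ^ 2 ≤ n * a)
    {S : PMF (Fin n → Fin K)} (hS : IsSpectralStep K A S) {label : Fin n → Fin K}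
    (hlabel : label ∈ S.support) {out : Fin n → Fin K}
    (hout : out ∈ (improve A ⌊Real.log n⌋₊ label).support) :
    misclassified τ out ≤ Real.exp (-s) := by
  have hn : 0 < n := lt_of_lt_of_le (by norm_num) hr.eight_le
  have hn' : (0 : ℝ) < n := by exact_mod_cast hn
  have hK : 0 < K := Nat.pos_of_ne_zero (NeZero.ne K)
  have hK' : (1 : ℝ) ≤ K := by exact_mod_cast hK
  have hb := hr.nonneg
  have hab := hr.lt
  have hα := hr.pos
  have ha : 0 < a := hb.trans_lt hab
  have hna : 0 < n * a := by positivity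
  have hd' : 0 < a - b := sub_pos.2 hab
  have hE := Real.exp_pos (-s)
  set β := n * Real.exp (-s) with hβ
  have hβ0 : 0 < β := by positivity
  have hβα : 400 * K * β ≤ α * n := by
    have := mul_le_mul_of_nonneg_right hr.exp_le hn'.le
    linarith
  have hβn : 400 * (K * β) ≤ n := by
    have := mul_le_mul_of_nonneg_right hr.le_one hn'.le
    linarith
  have hKβ : β ≤ K * β := le_mul_of_one_le_left hβ0.le hK'
  have haβ : a * β ≤ 4 := by
    have := hr.exp_mul_le
    linarith
  have hdev : ((deviating A τ a b).card : ℝ) ≤ n / (20 * K) := by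
    refine h.deviating_le.trans ?_
    rw [div_le_div_iff₀ (by norm_num) (by positivity)]
    linarith
  have hlow := le_total hK hb hab.le hdev
  have hup := total_le hn h.symm h.diag h.discrepancy hr.degree
  have hnorm := normBound_deviation (by linarith [hr.eight_le]) h.symm (rate_nonneg τ hb hab.le)
    (rate_le τ hab.le) (rate_symm τ a b) h.discrepancy hm1 h.light (C := 45 * K) (by positivity)
    (Γ := kept K A) fun v hv => kept_degree_le hup hv
  set ν : ℝ := 8 * (40 * (45 * K) + 1346) * 2 ^ m with hν
  have hν0 : 0 ≤ ν := by positivity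
  have hν2 : ν ^ 2 ≤ normConstant K * (n * a) := by
    rw [hν, mul_pow, normConstant]
    exact mul_le_mul_of_nonneg_left hm2 (sq_nonneg _)
  have hΓ : ((kept K A)ᶜ.card : ℝ) ≤ β / 2 := by
    refine le_trans ?_ h.deviating_le
    have : (kept K A)ᶜ ⊆ deviating A τ a b := by
      intro v hv
      by_contra hv'
      exact Finset.mem_compl.1 hv (not_deviates_subset_kept hK hb hab.le hdev hv')
    exact_mod_cast Finset.card_le_card this
  have hCpos := normConstant_pos K
  have hKC : 0 < K * normConstant K := by positivity
  have hX0 : 0 < α * (n * (a - b)) := by positivity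
  obtain ⟨σ, hσ⟩ := exists_perm_errors_le_of_isSpectralStep hn hK h.symm h.diag hb hab hα hsize
    hnorm hν0 hν2 hCpos hr.ratio (by linarith [hr.gap]) (by linarith [hr.le_ratio_two]) hlow hup
    hr.one_le_pass hr.pass_le hr.le_pass (by linarith)
    (g := 4) (by
      have := mul_le_mul_of_nonneg_right hΓ ha.le
      linarith) hr.pass_le_ratio hr.le_ratio hr.le_ratio_four hS hlabel
  obtain ⟨Z, hDZ, hZ, hZA⟩ := exists_closed_superset h.symm h.diag ha.le h.discrepancy
    (by linarith) haβ (by linarith [hr.degree]) le_rfl h.deviating_le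
  have hgood : GoodOutside A τ a b α Z := by
    refine ⟨hα, hb, hab, hsize, h.diag, ?_, by linarith, ⟨_, hZA, ?_⟩, ⟨ν, ?_, ?_⟩⟩
    · intro v hv hd
      exact hv (hDZ (Finset.mem_filter.2 ⟨Finset.mem_univ _, hd⟩))
    · have h1 : 1 ≤ √(n * a) := Real.one_le_sqrt.2 (by linarith [hr.degree])
      have h2 : a * Z.card ≤ 4 := (mul_le_mul_of_nonneg_left hZ ha.le).trans haβ
      have h3 : 41600 * √(n * a) ≤ α * (n * (a - b)) := by
        refine abs_le_of_sq_le_sq' ?_ hX0.le |>.2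
        rw [mul_pow, mul_pow, Real.sq_sqrt hna.le, ← hr.ratio]
        have := mul_le_mul_of_nonneg_right hr.le_ratio_sq hna.le
        linarith
      have h4 := hr.gap
      linarith
    · refine hnorm.mono fun v hv => ?_
      refine not_deviates_subset_kept hK hb hab.le hdev fun hd => Finset.mem_compl.1 hv (hDZ hd)
    · have h1 := mul_le_mul_of_nonneg_right hr.le_ratio_two hna.le
      have h2 := mul_le_mul_of_nonneg_left hν2 (by positivity : (0 : ℝ) ≤ 64 * K)
      have h3 : (α * n * (a - b) / 100) ^ 2 = α ^ 2 * (n * (a - b)) ^ 2 / 10000 := by ring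
      rw [h3, ← hr.ratio]
      linarith
  have hsub := (hgood.relabel σ).misclassified_le hr.eight_le hσ hout
  refine (SpectralPartition.misclassified_le σ).trans ?_
  rw [div_le_iff₀ hn', mul_comm]
  refine le_trans ?_ hZ
  exact_mod_cast Finset.card_le_card hsub

/-- The probability of good observations. -/
theorem not_isGoodObservation_prob {n K : ℕ} (hn : 0 < n) {P : PMF (Matrix (Fin n) (Fin n) ℕ)}
    {τ : Fin n → Fin K} {a b α s : ℝ} {m : ℕ} (hb : 0 ≤ b) (hab : b < a)
    (hP : SubPoisson P (rate τ a b)) (hsupp : ∀ A, P A ≠ 0 → A.IsSymm ∧ ∀ v, A v v = 0)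
    (hsize : ∀ k, α * n ≤ clusterSize τ k) (hm : n * a ≤ 4 * (2 ^ m) ^ 2) :
    P.toOuterMeasure {A | ¬ IsGoodObservation A τ a b s m} ≤
      ENNReal.ofReal (2 / n + 2 * Real.exp (-n) +
        4 * K * Real.exp (s - α * n * (a - b) ^ 2 / a / 25 + (a - b) / 5)) := by
  classical
  have hn' : (0 : ℝ) < n := by exact_mod_cast hn
  have ha : 0 ≤ a := hb.trans hab.le
  have h1 := discrepancy_prob hn hP ha (rate_le τ hab.le)
  have h2 := lightBound_prob hP (θ := 2 ^ m) (by positivity) hm (rate_nonneg τ hb hab.le)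
    (rate_le τ hab.le)
  have h3 := toOuterMeasure_card_le P (fun v => {A | Deviates A τ a b v})
    (c := n * Real.exp (-s) / 2) (by positivity) (deviates_prob hb hab hP hsupp hsize)
  have h4 : Fintype.card (Fin n) * (2 * K * Real.exp (-(α * n * (a - b) ^ 2 / a / 25) +
      (a - b) / 5)) / (n * Real.exp (-s) / 2) =
      4 * K * Real.exp (s - α * n * (a - b) ^ 2 / a / 25 + (a - b) / 5) := by
    rw [Fintype.card_fin, show s - α * n * (a - b) ^ 2 / a / 25 + (a - b) / 5 =
      (-(α * n * (a - b) ^ 2 / a / 25) + (a - b) / 5) - (-s) by ring, Real.exp_sub]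
    field_simp
    ring
  rw [h4] at h3
  rw [ENNReal.ofReal_add (by positivity) (by positivity),
    ENNReal.ofReal_add (by positivity) (by positivity)]
  have h5 : P.toOuterMeasure {A | ¬ IsGoodObservation A τ a b s m} ≤
      P.toOuterMeasure ({A | ¬ Discrepancy A a} ∪ {A | ¬ LightBound A (rate τ a b) (2 ^ m)} ∪
        {A | n * Real.exp (-s) / 2 <
          ((Finset.univ.filter fun v => A ∈ {A | Deviates A τ a b v}).card : ℝ)}) := by
    refine PMF.toOuterMeasure_mono P ?_
    rintro A ⟨hA, hAs⟩
    obtain ⟨hs, hd⟩ := hsupp A ((PMF.mem_support_iff _ _).1 hAs)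
    by_contra hno
    simp only [Set.mem_union, Set.mem_ofPred_eq, not_or, not_not, not_lt] at hno
    refine hA ⟨hs, hd, hno.1.1, hno.1.2, ?_⟩
    have := hno.2
    rw [deviating]
    convert this
  refine h5.trans ((MeasureTheory.measure_union_le _ _).trans ?_)
  gcongr
  exact (MeasureTheory.measure_union_le _ _).trans (by gcongr)

/-! ### The output of the algorithm -/

theorem le_outputLaw {n K T : ℕ} [NeZero K] {U : Finset (Fin T → NodePair n)}
    {τ : Fin n → Fin K} {p q : unitInterval}
    {spectral : Matrix (Fin n) (Fin n) ℕ → PMF (Fin n → Fin K)} {S : Set (Fin n → Fin K)}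
    {G : Set (Matrix (Fin n) (Fin n) ℕ)} {ε : ℝ≥0∞}
    (hG : (observationLaw U τ p q).toOuterMeasure Gᶜ ≤ ε)
    (hS : ∀ A ∈ G, ∀ label ∈ (spectral A).support,
      ∀ out ∈ (improve A ⌊Real.log n⌋₊ label).support, out ∈ S) :
    1 - ε ≤ (outputLaw U τ p q spectral).toMeasure S := by
  have h1 : (outputLaw U τ p q spectral).toMeasure Sᶜ ≤ ε := by
    rw [PMF.toMeasure_apply_eq_toOuterMeasure_apply _ MeasurableSet.of_discrete, outputLaw,
      PMF.toOuterMeasure_bind_apply]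
    refine le_trans ?_ hG
    rw [PMF.toOuterMeasure_apply]
    refine ENNReal.tsum_le_tsum fun A => ?_
    by_cases hA : A ∈ G
    · have h2 : ((spectral A).bind (improve A ⌊Real.log n⌋₊)).toOuterMeasure Sᶜ = 0 := by
        rw [PMF.toOuterMeasure_apply_eq_zero_iff, Set.disjoint_left]
        intro out hout hno
        obtain ⟨label, h3, h4⟩ := (PMF.mem_support_bind_iff _ _ _).1 hout
        exact hno (hS A hA label h3 out h4)
      rw [h2, mul_zero]
      exact zero_le
    · rw [Set.indicator_of_mem (show A ∈ Gᶜ from hA)]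
      refine mul_le_of_le_one_right' ?_
      have h2 : ((spectral A).bind (improve A ⌊Real.log n⌋₊)).toOuterMeasure Set.univ = 1 :=
        (PMF.toOuterMeasure_apply_eq_one_iff _ _).2 (Set.subset_univ _)
      exact (MeasureTheory.measure_mono (Set.subset_univ _)).trans_eq h2
  rw [tsub_le_iff_right]
  have h2 : (outputLaw U τ p q spectral).toMeasure S +
      (outputLaw U τ p q spectral).toMeasure Sᶜ = 1 := by
    rw [MeasureTheory.measure_add_measure_compl MeasurableSet.of_discrete,
      MeasureTheory.measure_univ]
  rw [← h2]
  gcongr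

/-- The algorithm works with high probability on the observations with a given law. -/
theorem le_outputLaw_misclassified {n K T I : ℕ} [NeZero K] {U : Finset (Fin T → NodePair n)}
    {τ : Fin n → Fin K} {p q : unitInterval} {a b α D s : ℝ}
    (hP : SubPoisson (observationLaw U τ p q) (rate τ a b)) (hr : IsRegime K n I a b α D s)
    (hsize : ∀ k, α * n ≤ clusterSize τ k)
    {spectral : Matrix (Fin n) (Fin n) ℕ → PMF (Fin n → Fin K)}
    (hspectral : ∀ A : Matrix (Fin n) (Fin n) ℕ, A.IsSymm → IsSpectralStep K A (spectral A)) :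
    1 - ENNReal.ofReal (2 / n + 2 * Real.exp (-n) +
        4 * K * Real.exp (s - α * n * (a - b) ^ 2 / a / 25 + (a - b) / 5)) ≤
      (outputLaw U τ p q spectral).toMeasure {label | misclassified τ label ≤ Real.exp (-s)} := by
  have hna : 0 ≤ n * a := by linarith [hr.degree]
  obtain ⟨m, hm1, hm2⟩ := exists_nat_pow_near
    (Real.one_le_sqrt.2 (by linarith [hr.degree] : 1 ≤ n * a)) (by norm_num : (1 : ℝ) < 2)
  have hm1' : ((2 : ℝ) ^ m) ^ 2 ≤ n * a := by
    have := pow_le_pow_left₀ (by positivity) hm1 2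
    rwa [Real.sq_sqrt hna] at this
  have hm2' : n * a ≤ 4 * ((2 : ℝ) ^ m) ^ 2 := by
    have := pow_le_pow_left₀ (Real.sqrt_nonneg _) hm2.le 2
    rw [Real.sq_sqrt hna, pow_succ (2 : ℝ) m, mul_pow] at this
    linarith
  refine le_outputLaw (G := {A | IsGoodObservation A τ a b s m}) ?_ ?_
  · exact not_isGoodObservation_prob (lt_of_lt_of_le (by norm_num) hr.eight_le) hr.nonneg hr.lt hP
      (fun A hA => observationLaw_support U τ p q hA) hsize hm2'
  · intro A hA label hlabel out hout
    exact IsGoodObservation.misclassified_le hA hr hsize hm2' hm1'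
      (hspectral A (IsGoodObservation.symm hA)) hlabel hout

/-! ### Asymptotics -/

/-- The mean number of observations of a pair. -/
def meanCount (n T : ℕ) : ℝ := T / (n * (n - 1) / 2 : ℝ)

/-- The conditions on the parameters follow from lower bounds. -/
theorem isRegime_of_le {K n T I : ℕ} {p q α x : ℝ} (hK : 0 < K) (hα : 0 < α) (hα1 : α ≤ 1)
    (hq : 0 ≤ q) (hqp : q < p) (hx : x = (p - q) ^ 2 / p * (α * T / n))
    (hI1 : 1 ≤ I) (hI : 57600 * K ^ 2 * normConstant K ≤ α * I) (hn : 8 ≤ n)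
    (hlogn : I ≤ Real.log n) (h2 : Real.log (p * (T / n)) ≤ x / 20) (hx24 : 24 ≤ x)
    (hxs : 20 * Real.log (400 * K / α) ≤ x) (hg : 400 / α ≤ (p - q) * n / p) (hxI : 16 * I ≤ x)
    (hx1 : (102400 * (2 * I + 18 * K * normConstant K + 2 * 4) + 1) / α ≤ x)
    (hx2 : 102400 * normConstant K / α ^ 3 ≤ x) (hx3 : 640000 * K * normConstant K / α ≤ x)
    (hx4 : 41600 ^ 2 / α ≤ x) :
    IsRegime K n I (meanCount n T * p) (meanCount n T * q) α
        (meanCount n T * n * ((p - q) ^ 2 / p)) (x / 20) ∧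
      x / 20 - α * n * (meanCount n T * p - meanCount n T * q) ^ 2 / (meanCount n T * p) / 25 +
        (meanCount n T * p - meanCount n T * q) / 5 ≤ -x / 50 := by
  have hp : 0 < p := hq.trans_lt hqp
  have hd : 0 < p - q := sub_pos.2 hqp
  have hn' : (8 : ℝ) ≤ n := by exact_mod_cast hn
  have hT : (0 : ℝ) < T := by
    rcases Nat.eq_zero_or_pos T with h | h
    · rw [h] at hx; norm_num at hx; linarith
    · exact_mod_cast h
  have hK' : (0 : ℝ) < K := by exact_mod_cast hK
  obtain ⟨t, ht⟩ : ∃ t, t = meanCount n T := ⟨_, rfl⟩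
  have htn : t * n = 2 * T / (n - 1) := by
    rw [ht, meanCount]
    have : (n : ℝ) - 1 ≠ 0 := by linarith
    field_simp
  rw [← ht]
  have ht0 : 0 < t := by
    have h3 : 0 < t * n := by rw [htn]; exact div_pos (by positivity) (by linarith)
    exact pos_of_mul_pos_left h3 (by linarith)
  obtain ⟨D, hD⟩ : ∃ D, D = t * n * ((p - q) ^ 2 / p) := ⟨_, rfl⟩
  rw [← hD]
  have htn1 : 2 * (T / n) ≤ t * n := by
    rw [htn, mul_div_assoc]
    have : (T : ℝ) / n ≤ T / (n - 1) := div_le_div_of_nonneg_left hT.le (by linarith) (by linarith)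
    linarith
  have htn2 : t * n ≤ 4 * (T / n) := by
    rw [htn, mul_div_assoc', div_le_div_iff₀ (by linarith) (by linarith)]
    nlinarith
  have hαD : 2 * x ≤ α * D := by
    rw [hx, hD]
    have h3 := mul_le_mul_of_nonneg_left htn1 (by positivity : 0 ≤ α * ((p - q) ^ 2 / p))
    calc 2 * ((p - q) ^ 2 / p * (α * T / n)) = α * ((p - q) ^ 2 / p) * (2 * (T / n)) := by ring
      _ ≤ _ := h3
      _ = _ := by ring
  have hgD : (t * p - t * q) * ((p - q) * n / p) = D := by rw [hD]; ring
  have hDn : D ≤ n * (t * p) := by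
    have h3 : (p - q) ^ 2 / p ≤ p := by
      rw [div_le_iff₀ hp, ← sq]
      exact pow_le_pow_left₀ hd.le (by linarith) 2
    have h4 := mul_le_mul_of_nonneg_left h3 (by positivity : 0 ≤ t * n)
    rw [hD]; linarith
  have hD0 : 0 < D := by rw [hD]; positivity
  have hD1 : α * D ≤ D := mul_le_of_le_one_left hD0.le hα1
  have hgap : 400 * p ≤ α * (n * (p - q)) := by
    rw [div_le_div_iff₀ hα hp] at hg
    linarith
  have key : ∀ c : ℝ, c / α ≤ x → 2 * c ≤ α ^ 2 * D := by
    intro c hc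
    rw [div_le_iff₀ hα] at hc
    have h3 := mul_le_mul_of_nonneg_left hαD hα.le
    linarith
  have hC := normConstant_pos K
  refine ⟨⟨hn, by positivity, by gcongr, hα, hα1, ?_, by linarith, ?_, ?_, ?_, hI1,
    Nat.le_floor hlogn, hI, by linarith, ?_, ?_, ?_, ?_⟩, ?_⟩
  · rw [hD]; field_simp
  · have h3 : p * (T / n) ≤ Real.exp (x / 20) := by
      rw [← Real.exp_log (show 0 < p * (T / n) by positivity)]
      exact Real.exp_le_exp.2 h2
    have h4 : n * (t * p) ≤ 4 * Real.exp (x / 20) := by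
      have := mul_le_mul_of_nonneg_left htn2 hp.le
      linarith
    rw [Real.exp_neg, ← div_eq_mul_inv, div_le_iff₀ (Real.exp_pos _)]
    exact h4
  · have h3 : 400 * K / α ≤ Real.exp (x / 20) := by
      rw [← Real.exp_log (show 0 < 400 * K / α by positivity)]
      exact Real.exp_le_exp.2 (by linarith)
    rw [div_le_iff₀ hα] at h3
    rw [Real.exp_neg, ← div_eq_mul_inv, div_le_iff₀ (Real.exp_pos _)]
    linarith
  · have := mul_le_mul_of_nonneg_left hgap ht0.le
    linarith
  · have h3 := key _ hx1
    have h4 : 0 ≤ 102400 * (2 * I + 18 * K * normConstant K + 2 * 4) := by positivity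
    linarith
  · rw [div_le_iff₀ (by positivity)] at hx2
    have h3 := mul_le_mul_of_nonneg_left hαD (by positivity : 0 ≤ α ^ 3)
    have h4 : 0 ≤ α ^ 3 * x := by positivity
    linarith
  · have h3 := key _ hx3
    have h4 : 0 ≤ 640000 * K * normConstant K := by positivity
    linarith
  · have h3 := key _ hx4
    linarith
  · have h3 : α * n * (t * p - t * q) ^ 2 / (t * p) = α * D := by
      rw [hD]; field_simp
    have h4 : 400 * (t * p - t * q) ≤ α * D := by
      rw [← hgD]
      have h5 : 400 ≤ α * ((p - q) * n / p) := by rwa [div_le_iff₀' hα] at hg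
      have h6 : 0 ≤ t * p - t * q := by nlinarith
      have := mul_le_mul_of_nonneg_left h5 h6
      linarith
    rw [h3]
    linarith

theorem tendsto_outputLaw {K : ℕ} [NeZero K] {N T : ℕ → ℕ} {p q : ℕ → unitInterval} {α : ℝ}
    (hα : 0 < α) (hN : Tendsto N atTop atTop) {τ : ∀ j, Fin (N j) → Fin K}
    (hsize : ∀ j k, α * N j ≤ clusterSize (τ j) k) (hqp : ∀ j, q j < p j)
    (hgap : Tendsto (fun j => ((p j : ℝ) - q j) * N j / p j) atTop atTop)
    (h₁ : Tendsto (fun j => ((p j : ℝ) - q j) ^ 2 / p j * (α * T j / N j)) atTop atTop)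
    (h₂ : ∀ᶠ j in atTop, Real.log (p j * (T j / N j)) ≤
      ((p j : ℝ) - q j) ^ 2 / (20 * p j) * (α * T j / N j))
    {U : ∀ j, Finset (Fin (T j) → NodePair (N j))}
    (hU : ∀ j, 2 ≤ N j → SubPoisson (observationLaw (U j) (τ j) (p j) (q j))
      (rate (τ j) (meanCount (N j) (T j) * p j) (meanCount (N j) (T j) * q j)))
    {spectral : ∀ j, Matrix (Fin (N j)) (Fin (N j)) ℕ → PMF (Fin (N j) → Fin K)}
    (hspectral : ∀ᶠ j in atTop, ∀ A : Matrix (Fin (N j)) (Fin (N j)) ℕ, A.IsSymm →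
      IsSpectralStep K A (spectral j A)) :
    Tendsto (fun j => (outputLaw (U j) (τ j) (p j) (q j) (spectral j)).toMeasure
        {label | misclassified (τ j) label ≤
          Real.exp (-(((p j : ℝ) - q j) ^ 2 / (20 * p j) * (α * T j / N j)))})
      atTop (𝓝 1) := by
  have hK : 0 < K := Nat.pos_of_ne_zero (NeZero.ne K)
  have hα1 : α ≤ 1 := by
    obtain ⟨j, hj⟩ := (hN.eventually_ge_atTop 1).exists
    have hj' : (0 : ℝ) < N j := by exact_mod_cast hj
    have h1 := hsize j ⟨0, hK⟩
    have h2 : (clusterSize (τ j) ⟨0, hK⟩ : ℝ) ≤ N j := by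
      rw [← sum_clusterSize (τ j)]
      exact Finset.single_le_sum (f := fun l => (clusterSize (τ j) l : ℝ))
        (fun l _ => Nat.cast_nonneg _) (Finset.mem_univ _)
    exact le_of_mul_le_mul_right (by linarith) hj'
  have hNr : Tendsto (fun j => (N j : ℝ)) atTop atTop := tendsto_natCast_atTop_atTop.comp hN
  have hlog : Tendsto (fun j => Real.log (N j)) atTop atTop := Real.tendsto_log_atTop.comp hNr
  obtain ⟨I, hI⟩ := exists_nat_ge (57600 * K ^ 2 * normConstant K / α + 1)
  have hI1 : 1 ≤ I := by
    have h1 : 0 ≤ 57600 * K ^ 2 * normConstant K / α := by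
      have := normConstant_pos K
      positivity
    have h2 : (1 : ℝ) ≤ I := by linarith
    exact_mod_cast h2
  have hIC : 57600 * K ^ 2 * normConstant K ≤ α * I := by
    rw [← div_le_iff₀' hα]; linarith
  set x : ℕ → ℝ := fun j => ((p j : ℝ) - q j) ^ 2 / p j * (α * T j / N j) with hx
  have hs : ∀ j, ((p j : ℝ) - q j) ^ 2 / (20 * p j) * (α * T j / N j) = x j / 20 := by
    intro j
    simp only [hx]
    rw [mul_comm (20 : ℝ), ← div_div]
    ring
  simp only [hs] at h₂ ⊢
  have hε : Tendsto (fun j => 1 - ENNReal.ofReal (2 / N j + 2 * Real.exp (-N j) +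
      4 * K * Real.exp (-(x j) / 50))) atTop (𝓝 1) := by
    have e1 : Tendsto (fun j => 2 / (N j : ℝ)) atTop (𝓝 0) := hNr.const_div_atTop 2
    have e2 : Tendsto (fun j => 2 * Real.exp (-(N j : ℝ))) atTop (𝓝 (2 * 0)) :=
      (Real.tendsto_exp_neg_atTop_nhds_zero.comp hNr).const_mul 2
    have e3 : Tendsto (fun j => 4 * K * Real.exp (-(x j) / 50)) atTop (𝓝 (4 * K * 0)) := by
      refine Tendsto.const_mul _ ?_
      have : (fun j => Real.exp (-(x j) / 50)) = fun j => Real.exp (-(x j / 50)) := by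
        funext j; rw [neg_div]
      rw [this]
      exact Real.tendsto_exp_neg_atTop_nhds_zero.comp (h₁.atTop_div_const (by norm_num))
    have e4 := ENNReal.tendsto_ofReal ((e1.add e2).add e3)
    have e5 : ENNReal.ofReal (0 + 2 * 0 + 4 * K * 0) = 0 := by norm_num
    rw [e5] at e4
    have e6 := ENNReal.Tendsto.sub (tendsto_const_nhds (x := (1 : ℝ≥0∞))) e4
      (Or.inl ENNReal.one_ne_top)
    rwa [tsub_zero] at e6
  refine tendsto_of_tendsto_of_tendsto_of_le_of_le' hε tendsto_const_nhds ?_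
    (Eventually.of_forall fun j => MeasureTheory.prob_le_one)
  filter_upwards [hN.eventually_ge_atTop 8, hlog.eventually_ge_atTop I, h₂, hspectral,
    h₁.eventually_ge_atTop 24, h₁.eventually_ge_atTop (20 * Real.log (400 * K / α)),
    hgap.eventually_ge_atTop (400 / α), h₁.eventually_ge_atTop (16 * I),
    h₁.eventually_ge_atTop ((102400 * (2 * I + 18 * K * normConstant K + 2 * 4) + 1) / α),
    h₁.eventually_ge_atTop (102400 * normConstant K / α ^ 3),
    h₁.eventually_ge_atTop (640000 * K * normConstant K / α),
    h₁.eventually_ge_atTop (41600 ^ 2 / α)]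
    with j hn hlogn h2 hspec hx24 hxs hg hxI hx1 hx2 hx3 hx4
  obtain ⟨hr, hexp⟩ := isRegime_of_le hK hα hα1 (q j).2.1 (hqp j) (rfl : x j = x j) hI1 hIC hn hlogn
    h2 hx24 hxs hg hxI hx1 hx2 hx3 hx4
  refine le_trans (tsub_le_tsub_left (ENNReal.ofReal_le_ofReal ?_) 1)
    (le_outputLaw_misclassified (hU j (by omega)) hr (hsize j) hspec)
  gcongr

end SpectralPartition

end

theorem theorem5 (K : ℕ) [NeZero K] (hK : 2 ≤ K)
    (α : Fin K → ℝ) (hα_pos : ∀ k, 0 < α k) (hα_mono : Monotone α)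
    (N : ℕ → ℕ) (hN : Tendsto N atTop atTop)
    (τ : ∀ j, Fin (N j) → Fin K)
    (hτ : ∀ j k, (Nat.card {v // τ j v = k} : ℝ) = α k * N j)
    (p q : ℕ → unitInterval) (hqp : ∀ j, q j < p j)
    (T : ℕ → ℕ)
    (hgap : Tendsto (fun j => ((p j : ℝ) - q j) * N j / p j) atTop atTop)
    (h₁ : Tendsto (fun j => ((p j : ℝ) - q j) ^ 2 / p j * (α 0 * T j / N j)) atTop atTop)
    (h₂ : ∀ᶠ j in atTop, Real.log (p j * (T j / N j)) ≤
      ((p j : ℝ) - q j) ^ 2 / (20 * p j) * (α 0 * T j / N j))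
    (spectral : ∀ j, Matrix (Fin (N j)) (Fin (N j)) ℕ → PMF (Fin (N j) → Fin K))
    (hspectral : ∀ᶠ j in atTop, ∀ A : Matrix (Fin (N j)) (Fin (N j)) ℕ, A.IsSymm →
      SpectralPartition.IsSpectralStep K A (spectral j A)) :
    Tendsto (fun j =>
      (SpectralPartition.outputLaw (SpectralPartition.urs1 (N j) (T j)) (τ j) (p j) (q j)
        (spectral j)).toMeasure
        {label | SpectralPartition.misclassified (τ j) label ≤
          Real.exp (-(((p j : ℝ) - q j) ^ 2 / (20 * p j) * (α 0 * T j / N j)))})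
      atTop (𝓝 1) ∧
    Tendsto (fun j =>
      (SpectralPartition.outputLaw (SpectralPartition.urs2 (N j) (T j)) (τ j) (p j) (q j)
        (spectral j)).toMeasure
        {label | SpectralPartition.misclassified (τ j) label ≤
          Real.exp (-(((p j : ℝ) - q j) ^ 2 / (20 * p j) * (α 0 * T j / N j)))})
      atTop (𝓝 1) := by
  have hsize : ∀ j k, α 0 * N j ≤ SpectralPartition.clusterSize (τ j) k := by
    intro j k
    have h : (SpectralPartition.clusterSize (τ j) k : ℝ) = α k * N j := by
      rw [← hτ j k, Nat.card_eq_fintype_card, Fintype.card_subtype, SpectralPartition.clusterSize]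
    rw [h]
    exact mul_le_mul_of_nonneg_right (hα_mono (Fin.zero_le k)) (Nat.cast_nonneg _)
  exact ⟨SpectralPartition.tendsto_outputLaw (hα_pos 0) hN hsize hqp hgap h₁ h₂
      (fun j hj => SpectralPartition.subPoisson_urs1 hj (τ j) (p j) (q j)) hspectral,
    SpectralPartition.tendsto_outputLaw (hα_pos 0) hN hsize hqp hgap h₁ h₂
      (fun j hj => SpectralPartition.subPoisson_urs2 hj (τ j) (p j) (q j)) hspectral⟩
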